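/- Let $N\ge 1$. A localized word is $w=((n_i);(\xi^{j_i}))_d$ with $d\ge 0$, $n_1,\dots,n_d\in\mathbb Z$, $j_1,\dots,j_{d+1}\in\mathbb Z/N\mathbb Z$; it is ordinary if all $n_i\ge 1$. Put $|w|=n_1+\dots+n_d$ and $a_i=j_{i+1}-j_i$. Let $e_0^{-1}\mathcal O$ be the localization of $\mathbb Q\langle e_0,e_{\xi^1},\dots,e_{\xi^N}\rangle$ (concatenation product) at the multiplicative part generated by $e_0$; $w$ is identified with the basis element $e_{\xi^{j_{d+1}}}e_0^{n_d-1}e_{\xi^{j_d}}\cdots e_0^{n_1-1}e_{\xi^{j_1}}$. For a primitive $N$-th root of unity $\xi$ in a field of characteristic $0$ and $m\in\mathbb N$, write, for a sequence $V=((t_1,c_1),\dots,(t_k,c_k))$ in $\mathbb Z\times\mathbb Z/N\mathbb Z$, $$H_m(V)=\sum_{0<m_1<\dots<m_k<m}\ \prod_{i=1}^k \xi^{c_im_i}m_i^{-t_i},$$ and define the localized multiple harmonic sums and their weighted versions by $$\mathfrak h_m(w)=\xi^{-j_{d+1}m}H_m\big((n_1,a_1),\dots,(n_d,a_d)\big),\qquad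 \mathrm{har}_m(w)=m^{|w|}\,\mathfrak h_m(w).$$ **1. Localized quasi-shuffle product.** Let $\ast_{\rm loc}$ be the $\mathbb Q$-bilinear product on $e_0^{-1}\mathcal O$ which is $0$ on pairs of basis elements that are not both localized words, and which sends localized words $w,w'$ with last indices $j_{d+1},j'_{d'+1}$ to the sum of the localized words with last index $j_{d+1}+j'_{d'+1}$ whose sequences $((n_i,a_i))_i$ run over the terms of Hoffman's quasi-shuffle of the sequences $((n_i,a_i))_i$ and $((n'_i,a'_i))_i$, the letters being added in $\mathbb Z\times\mathbb Z/N\mathbb Z$. Then, with $\mathfrak h_m$ extended linearly, for all localized words $w,w'$, all $m$ and all $\xi$ as above, $$\mathfrak h_m(w)\,\mathfrak h_m(w')=\mathfrak h_m(w\ast_{\rm loc}w').$$ On ordinary words $\ast_{\rm loc}$ is the usual quasi-shuffle product. **2. Localized adjoint $p$-adic multiple zeta values.** Let $p$ be a prime not dividing $N$, $K$ a complete normed field extension of $\mathbb Q_p$ containing a primitive $N$-th root of unity $\xi$, $\alpha\ge1$, $q=p^\alpha$. (a) For any $V$ there is an explicit finite expression $H_m(V)=\sum_{c,t,v}\lambda_V(c,t,v)\,\xi^{cm}m^tH_m(v)$,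 where $c\in\mathbb Z/N\mathbb Z$, $t\ge 0$, and $v$ has only positive exponents. It is computed by iterating the summation over $0<k<m$ of $\xi^{ck}k^tH_k(v)$: if $t<0$ this is the nested sum of $v$ followed by $(-t,c)$, and if $t\ge0$ one sums by parts, with an explicit polynomial $Q$ such that $\xi^cQ(X+1)-Q(X)=X^t$, until no exponent $\leq 0$ is left. (b) For a sequence $L=((n_1,a_1),\dots,(n_d,a_d))$, write the summation variables of $H_{qm}(L)$ as $m_i=qu_i+r_i$ with $0\le r_i<q$, group the consecutive indices having the same $u_i$, and expand $(qu_i+r_i)^{-n_i}=r_i^{-n_i}\sum_{s\ge0}\binom{-n_i}{s}(qu_i/r_i)^s$ if $r_i\ne0$ (keeping $(qu_i)^{-n_i}$ if $r_i=0$). This gives an expression $H_{qm}(L)=\sum_V D_L(V)\,H_m(V)$, where $D_L(V)\in K$ is an explicit finite sum of products of powers of $q$, binomial coefficients and sums $H_q$. For a localized word $w$ with sequence $L=((n_i,a_i))_i$, $j\in\mathbb Z/N\mathbb Z$, $l\in\mathbb Z$ and $v$ with positive exponents, put $$C_w(j,l,v)=q^{|w|}\sum_V D_L(V)\,\lambda_V\big(j+q\,j_{d+1},\,l-|w|,\,v\big)$$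 ($0$ if $l<|w|$). Then these series converge, and for all $m\ge1$ $$\mathrm{har}_{p^\alpha m}(w)=\sum_{j,l,v}C_w(j,l,v)\,\xi^{jm}m^l\,H_m(v).$$ The localized adjoint $p$-adic multiple zeta value at $N$-th roots of unity $\zeta^{\rm Ad}_{p,\alpha}(j;l;w)=C_w(j,l,\emptyset)$ is the coefficient of $\xi^{jm}m^l\,\mathrm{har}_m(\emptyset)$ in this expression. **3. Localized adjoint quasi-shuffle relations.** For all localized words $w,w'$, all $j\in\mathbb Z/N\mathbb Z$ and $l\in\mathbb Z$, $$\sum_{j_1+j_2=j}\ \sum_{\substack{l_1+l_2=l\\ l_1\ge|w|,\ l_2\ge|w'|}}\zeta^{\rm Ad}_{p,\alpha}(j_1;l_1;w)\,\zeta^{\rm Ad}_{p,\alpha}(j_2;l_2;w')=\zeta^{\rm Ad}_{p,\alpha}(j;l;w\ast_{\rm loc}w'),$$ where $\zeta^{\rm Ad}_{p,\alpha}(j;l;\cdot)$ is extended linearly. This family of polynomial relations, regarded as a family of polynomials in the variables $X_{j,l,w}$, generalizes the adjoint quasi-shuffle relations: for ordinary words $w,w'$ its members are the polynomials in the variables attached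 with ordinary words defined by the same formula with the usual quasi-shuffle product. -/

import Mathlib

noncomputable section

namespace LocHar

/-! ### Harmonic words and the quasi-shuffle product -/

/-- The index `((n_i);(ξ^{j_i}))_d`, i.e. `n_1, …, n_d ∈ A` and `j_1, …, j_{d+1} ∈ ℤ/N`:
`top = j_{d+1}` and `rest = [(n_d, j_d), …, (n_1, j_1)]`.
For `A = ℤ` these are the localized words, for `A = ℕ+` the ordinary ones. -/
@[ext]
structure HarWord (A : Type) (N : ℕ) where
  top : ZMod N
  rest : List (A × ZMod N)

/-- From `j_{d+1}` and `[(n_d, j_d), …, (n_1, j_1)]` to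
`[(n_d, j_{d+1} - j_d), …, (n_1, j_2 - j_1)]`. -/
def toChars {A : Type} {N : ℕ} : ZMod N → List (A × ZMod N) → List (A × ZMod N)
  | _, [] => []
  | J, (n, j) :: L => (n, J - j) :: toChars j L

/-- The inverse of `toChars`: from `j_{d+1}` and `[(n_d, a_d), …, (n_1, a_1)]`, where
`a_i = j_{i+1} - j_i`, back to `[(n_d, j_d), …, (n_1, j_1)]`. -/
def ofChars {A : Type} {N : ℕ} : ZMod N → List (A × ZMod N) → List (A × ZMod N)
  | _, [] => []
  | J, (n, a) :: V => (n, J - a) :: ofChars (J - a) V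

/-- The letters `(n_i, j_{i+1} - j_i)` of a word, the one of largest index first. -/
def HarWord.chars {A : Type} {N : ℕ} (w : HarWord A N) : List (A × ZMod N) :=
  toChars w.top w.rest

/-- Hoffman's quasi-shuffle of two sequences of letters taken in an additive semigroup:
the list of all its terms, with multiplicity. -/
def quasiShuffle {B : Type} [Add B] : List B → List B → List (List B)
  | [], v => [v]
  | a :: u, [] => [a :: u]
  | a :: u, b :: v =>
      (quasiShuffle u (b :: v)).map (a :: ·) ++ (quasiShuffle (a :: u) v).map (b :: ·) ++
        (quasiShuffle u v).map ((a + b) :: ·)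
termination_by u v => u.length + v.length

/-- The terms, with multiplicity, of the quasi-shuffle product of two words. -/
def HarWord.star {A : Type} [Add A] {N : ℕ} (w w' : HarWord A N) : List (HarWord A N) :=
  (quasiShuffle w.chars w'.chars).map fun V => ⟨w.top + w'.top, ofChars (w.top + w'.top) V⟩

/-- An ordinary word seen as a localized word. -/
def HarWord.toLoc {N : ℕ} (w : HarWord ℕ+ N) : HarWord ℤ N :=
  ⟨w.top, w.rest.map fun x => ((x.1 : ℤ), x.2)⟩

/-- The weight `n_1 + ⋯ + n_d`; `val` is the inclusion of the exponents in `ℤ`. -/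
def HarWord.weight {A : Type} {N : ℕ} (val : A → ℤ) (w : HarWord A N) : ℤ :=
  (w.rest.map fun x => val x.1).sum

/-! ### Localized multiple harmonic sums -/

section Field

variable {K : Type*} [Field K] {N : ℕ}

/-- For `V = [(n_d, a_d), …, (n_1, a_1)]`, the sum over `0 < m_1 < ⋯ < m_d < m` of
`∏ (ξ ^ a_i) ^ m_i / m_i ^ n_i`. -/
def nestedSum (ξ : K) : List (ℤ × ZMod N) → ℕ → K
  | [], _ => 1
  | (n, a) :: V, m => ∑ k ∈ Finset.Ioo 0 m, (ξ ^ a.val) ^ k / (k : K) ^ n * nestedSum ξ V k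

/-- The localized multiple harmonic sum `𝔥_m((n_i);(ξ^{j_i}))_d`: the sum over
`0 < m_1 < ⋯ < m_d < m` of
`(ξ^{j_2}/ξ^{j_1})^{m_1} ⋯ (ξ^{j_{d+1}}/ξ^{j_d})^{m_d} (1/ξ^{j_{d+1}})^m / (m_1^{n_1} ⋯ m_d^{n_d})`. -/
def mhs (ξ : K) (m : ℕ) (w : HarWord ℤ N) : K :=
  nestedSum ξ w.chars m * (1 / ξ ^ w.top.val) ^ m

/-- The weighted localized multiple harmonic sum `har_m(w) = m ^ weight(w) * 𝔥_m(w)`. -/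
def har (ξ : K) (m : ℕ) (w : HarWord ℤ N) : K :=
  (m : K) ^ w.weight id * mhs ξ m w

/-- The nested sum of a sequence with positive exponents. -/
def nestedSumPos (ξ : K) (v : List (ℕ+ × ZMod N)) (m : ℕ) : K :=
  nestedSum ξ (v.map fun x => ((x.1 : ℤ), x.2)) m

end Field

/-! ### The localized algebra -/

/-- Words in `e_0, e_0⁻¹` and the `e_{ξ^j}`, `j ∈ ℤ/N`, under concatenation. -/
abbrev LocMonoid (N : ℕ) : Type := Monoid.Coprod (Multiplicative ℤ) (FreeMonoid (ZMod N))

/-- `e_0⁻¹ 𝒪`: the localization of `ℚ⟨e_0, e_{ξ^1}, …, e_{ξ^N}⟩`, for the concatenation product,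
at the multiplicative part generated by `e_0`. -/
abbrev LocAlg (N : ℕ) : Type := MonoidAlgebra ℚ (LocMonoid N)

/-- `e_0 ^ k`. -/
def eZero (N : ℕ) (k : ℤ) : LocMonoid N := Monoid.Coprod.inl (Multiplicative.ofAdd k)

/-- `e_{ξ^j}`. -/
def eRoot {N : ℕ} (j : ZMod N) : LocMonoid N := Monoid.Coprod.inr (FreeMonoid.of j)

/-- `LocAlg N` has the universal property of the localization. -/
theorem LocAlg.existsUnique_lift (N : ℕ) {R : Type*} [Ring R] [Algebra ℚ R]
    (u : Rˣ) (f : ZMod N → R) :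
    ∃! φ : LocAlg N →ₐ[ℚ] R, φ (MonoidAlgebra.of ℚ _ (eZero N 1)) = u ∧
      ∀ j, φ (MonoidAlgebra.of ℚ _ (eRoot j)) = f j := by
  let g : LocMonoid N →* R :=
    Monoid.Coprod.lift ((Units.coeHom R).comp (zpowersHom Rˣ u)) (FreeMonoid.lift f)
  refine ⟨MonoidAlgebra.lift ℚ R (LocMonoid N) g, ⟨?_, ?_⟩, ?_⟩
  · simp [g, eZero]
  · intro j
    simp [g, eRoot]
  · rintro φ ⟨h0, h1⟩
    refine MonoidAlgebra.algHom_ext' ?_ (Subsingleton.elim _ _)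
    apply Monoid.Coprod.hom_ext
    · ext
      simpa [g, eZero] using h0
    · ext j
      simpa [g, eRoot] using h1 j

/-- The element `e_{ξ^{j_{d+1}}} e_0^{n_d - 1} e_{ξ^{j_d}} ⋯ e_0^{n_1 - 1} e_{ξ^{j_1}}`
attached with a localized word. -/
def HarWord.toMonoid {N : ℕ} (w : HarWord ℤ N) : LocMonoid N :=
  eRoot w.top * (w.rest.map fun x => eZero N (x.1 - 1) * eRoot x.2).prod

/-- Left multiplication on reduced words `e_0^k e_{ξ^{j}} e_0^{k'} e_{ξ^{j'}} e_0^{k''} ⋯`. -/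
def reducedAction (N : ℕ) : LocMonoid N →* Function.End (ℤ × List (ZMod N × ℤ)) :=
  Monoid.Coprod.lift
    { toFun := fun k x => (k.toAdd + x.1, x.2)
      map_one' := by funext x; simp; rfl
      map_mul' := by
        intro a b
        funext x
        change _ = ((Multiplicative.toAdd a + (Multiplicative.toAdd b + x.1), x.2) : ℤ × _)
        simp [add_assoc] }
    (FreeMonoid.lift fun j x => (0, (j, x.1) :: x.2))

theorem HarWord.toMonoid_injective {N : ℕ} :
    Function.Injective (HarWord.toMonoid : HarWord ℤ N → LocMonoid N) := by
  have e0 : ∀ (k : ℤ) (y : LocMonoid N) (x), reducedAction N (eZero N k * y) x =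
      (k + (reducedAction N y x).1, (reducedAction N y x).2) := by
    intro k y x
    rw [map_mul]
    rfl
  have e1 : ∀ (j : ZMod N) (y : LocMonoid N) (x), reducedAction N (eRoot j * y) x =
      (0, (j, (reducedAction N y x).1) :: (reducedAction N y x).2) := by
    intro j y x
    rw [map_mul]
    rfl
  have key : ∀ L : List (ℤ × ZMod N), ∀ L' : List (ℤ × ZMod N),
      reducedAction N (L.map fun x => eZero N (x.1 - 1) * eRoot x.2).prod (0, []) =
        reducedAction N (L'.map fun x => eZero N (x.1 - 1) * eRoot x.2).prod (0, []) →
      L = L' := by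
    have e2 : reducedAction N 1 (0, []) = (0, []) := by rw [map_one]; rfl
    intro L
    induction L with
    | nil =>
      rintro (_ | ⟨⟨n, j⟩, L'⟩) h
      · rfl
      · simp [mul_assoc, e0, e1, e2] at h
    | cons x L ih =>
      rintro (_ | ⟨⟨n, j⟩, L'⟩) h
      · simp [mul_assoc, e0, e1, e2] at h
      · simp only [List.map_cons, List.prod_cons, mul_assoc, e0, e1, Prod.mk.injEq,
          List.cons.injEq, add_zero] at h
        obtain ⟨h0, ⟨h1, h2⟩, h3⟩ := h
        rw [ih L' (Prod.ext h2 h3)]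
        congr 1
        exact Prod.ext (by simpa using h0) h1
  rintro ⟨J, L⟩ ⟨J', L'⟩ h
  have h' := congrArg (fun y => reducedAction N y (0, [])) h
  simp only [HarWord.toMonoid, e1, Prod.mk.injEq, List.cons.injEq, true_and] at h'
  obtain ⟨⟨h1, h2⟩, h3⟩ := h'
  rw [h1, key L L' (Prod.ext h2 h3)]

/-- A localized word as a basis element of `e_0⁻¹ 𝒪`. -/
def HarWord.toAlg {N : ℕ} (w : HarWord ℤ N) : LocAlg N := MonoidAlgebra.of ℚ _ w.toMonoid

/-- The localized quasi-shuffle product `∗_loc` on `e_0⁻¹ 𝒪`: the bilinear map given by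
the quasi-shuffle of localized words, and by `0` on the basis elements that are not of the form
`e_{ξ^{j_{d+1}}} e_0^{n_d - 1} e_{ξ^{j_d}} ⋯ e_0^{n_1 - 1} e_{ξ^{j_1}}`. -/
def locStar (N : ℕ) : LocAlg N →ₗ[ℚ] LocAlg N →ₗ[ℚ] LocAlg N :=
  (MonoidAlgebra.basis (LocMonoid N) ℚ).constr ℚ
    (Function.extend HarWord.toMonoid
      (fun w => (MonoidAlgebra.basis (LocMonoid N) ℚ).constr ℚ
        (Function.extend HarWord.toMonoid
          (fun w' => ((w.star w').map HarWord.toAlg).sum) 0)) 0)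

/-- The linear extension of `w ↦ 𝔥_m(w)` to `e_0⁻¹ 𝒪`, by `0` on the basis elements that are not
localized words. -/
def mhsLin {K : Type*} [Field K] [CharZero K] (N : ℕ) (ξ : K) (m : ℕ) : LocAlg N →ₗ[ℚ] K :=
  (MonoidAlgebra.basis (LocMonoid N) ℚ).constr ℚ
    (Function.extend HarWord.toMonoid (mhs ξ m) 0)

theorem mhsLin_toAlg {K : Type*} [Field K] [CharZero K] {N : ℕ} (ξ : K) (m : ℕ)
    (w : HarWord ℤ N) : mhsLin N ξ m w.toAlg = mhs ξ m w := by
  have h : w.toAlg = MonoidAlgebra.basis (LocMonoid N) ℚ w.toMonoid := by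
    simp [HarWord.toAlg]
  rw [mhsLin, h, Module.Basis.constr_basis, HarWord.toMonoid_injective.extend_apply]

theorem locStar_toAlg {N : ℕ} (w w' : HarWord ℤ N) :
    locStar N w.toAlg w'.toAlg = ((w.star w').map HarWord.toAlg).sum := by
  have h : ∀ w : HarWord ℤ N,
      w.toAlg = MonoidAlgebra.basis (LocMonoid N) ℚ w.toMonoid := by
    simp [HarWord.toAlg]
  rw [locStar, h w, Module.Basis.constr_basis, HarWord.toMonoid_injective.extend_apply, h w',
    Module.Basis.constr_basis, HarWord.toMonoid_injective.extend_apply]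

/-! ### The map `loc` for sums with exponents of any sign -/

section Loc

open Polynomial

variable {K : Type*} [Field K] [CharZero K] {N : ℕ}

/-- A polynomial `Q` such that `ζ * Q(X + 1) - Q(X) = X ^ t`: for `ζ = 1` it is given by the
Bernoulli polynomial, and otherwise it is the sum over `k ≤ t` of
`(-ζ)^k / (ζ - 1)^(k+1) * Δ^k X^t`, where `Δ P = P(X + 1) - P(X)`. -/
def antidiff (ζ : K) (t : ℕ) : K[X] :=
  open Classical in
  if ζ = 1 then C (1 / ((t : K) + 1)) * (Polynomial.bernoulli (t + 1)).map (algebraMap ℚ K)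
  else ∑ k ∈ Finset.range (t + 1),
    C ((-ζ) ^ k / (ζ - 1) ^ (k + 1)) * (fun P : K[X] => P.comp (X + 1) - P)^[k] (X ^ t)

theorem antidiff_spec (ζ : K) (t : ℕ) :
    C ζ * (antidiff ζ t).comp (X + 1) - antidiff ζ t = X ^ t := by
  unfold antidiff
  split_ifs with h
  · subst h
    have ht : ((t : K) + 1) ≠ 0 := by exact_mod_cast Nat.succ_ne_zero t
    have hb := congrArg (Polynomial.map (algebraMap ℚ K)) (bernoulli_comp_one_add_X (t + 1))
    simp only [Polynomial.map_comp, Polynomial.map_add, Polynomial.map_one, Polynomial.map_X,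
      Nat.add_sub_cancel] at hb
    rw [add_comm X 1, mul_comp, C_comp, hb]
    simp only [map_one, one_mul, mul_add, add_sub_cancel_left]
    have hx : ((t + 1) • X ^ t : ℚ[X]).map (algebraMap ℚ K) = C ((t : K) + 1) * X ^ t := by
      simp [nsmul_eq_mul]
    rw [hx, ← mul_assoc, ← C_mul, one_div_mul_cancel ht, C_1, one_mul]
  · have h1 : ζ - 1 ≠ 0 := sub_ne_zero.2 h
    set D : K[X] → K[X] := fun P => P.comp (X + 1) - P with hD
    have hz : D^[t + 1] (X ^ t) = 0 := by
      have hfun : ∀ (k : ℕ) (P : K[X]), (D^[k] P).eval = (fwdDiff 1)^[k] P.eval := by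
        intro k
        induction k with
        | zero => intro P; rfl
        | succ k ih =>
          intro P
          rw [Function.iterate_succ_apply, Function.iterate_succ_apply, ih]
          congr 1
          funext x
          simp [hD, fwdDiff]
      have h2 := hfun (t + 1) (X ^ t)
      apply Polynomial.funext
      intro x
      rw [fwdDiff_iter_eq_zero_of_degree_lt (by simp)] at h2
      simpa using congrFun h2 x
    have hs : ∀ P : K[X], P.comp (X + 1) = D P + P := by intro P; simp [hD]
    have key : ∀ n : ℕ, C ζ * (∑ k ∈ Finset.range n,
        C ((-ζ) ^ k / (ζ - 1) ^ (k + 1)) * D^[k] (X ^ t)).comp (X + 1) -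
        (∑ k ∈ Finset.range n, C ((-ζ) ^ k / (ζ - 1) ^ (k + 1)) * D^[k] (X ^ t)) =
        X ^ t - C ((-ζ) ^ n / (ζ - 1) ^ n) * D^[n] (X ^ t) := by
      intro n
      induction n with
      | zero => simp
      | succ n ih =>
        rw [Finset.sum_range_succ, add_comp, mul_comp, C_comp, hs (D^[n] (X ^ t)),
          ← Function.iterate_succ_apply' D]
        have e1 : (-ζ) ^ n / (ζ - 1) ^ n = (ζ - 1) * ((-ζ) ^ n / (ζ - 1) ^ (n + 1)) := by
          rw [pow_succ (ζ - 1)]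
          field_simp
        have e2 : (-ζ) ^ (n + 1) / (ζ - 1) ^ (n + 1) =
            -ζ * ((-ζ) ^ n / (ζ - 1) ^ (n + 1)) := by
          ring
        rw [e1] at ih
        rw [e2]
        simp only [C_mul, C_sub, C_neg, C_1] at ih ⊢
        linear_combination ih
    rw [key, hz]
    simp

/-- Finite formal sums of the terms `ξ^{cm} m^t 𝔥(v)`, where `𝔥(v)` is the nested sum of
upper bound `m` of a sequence `v` with positive exponents. -/
abbrev Expr (K : Type*) [Field K] (N : ℕ) : Type _ :=
  (ZMod N × ℕ × List (ℕ+ × ZMod N)) →₀ K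

/-- The expression, as a function of `m`, of the sum over `0 < k < m` of
`ξ^{ck} k^t 𝔥_k(v)`, obtained by summation by parts when `t ≥ 0`. -/
def sumExpr (ξ : K) : List (ℕ+ × ZMod N) → ZMod N → ℤ → Expr K N
  | v, c, Int.negSucc s => Finsupp.single (0, 0, (s.succPNat, c) :: v) 1
  | [], c, Int.ofNat t =>
      ((antidiff (ξ ^ c.val) t).sum fun i y => Finsupp.single (c, i, []) y) -
        Finsupp.single (0, 0, []) (ξ ^ c.val * (antidiff (ξ ^ c.val) t).eval 1)
  | (n, a) :: v, c, Int.ofNat t =>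
      ((antidiff (ξ ^ c.val) t).sum fun i y => Finsupp.single (c, i, (n, a) :: v) y) -
        ((antidiff (ξ ^ c.val) t).comp (X + 1)).sum fun i y =>
          (ξ ^ c.val * y) • sumExpr ξ v (a + c) ((i : ℤ) - (n : ℤ))

/-- The map `loc`: the expression of the nested sum of a sequence with exponents of any sign in
terms of nested sums with positive exponents, powers of the upper bound `m` and the `ξ^{cm}`. -/
def locExpr (ξ : K) : List (ℤ × ZMod N) → Expr K N
  | [] => Finsupp.single (0, 0, []) 1
  | (n, a) :: V =>
      (locExpr ξ V).sum fun x y => y • sumExpr ξ x.2.2 (a + x.1) ((x.2.1 : ℤ) - n)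

/-! ### The localized harmonic action -/

/-- The coefficient of `u^s` in the expansion, by the binomial series, of the sum over
`0 < r_1 < ⋯ < r_k < q` of `∏ ξ^{a_i r_i} (q u + r_i)^{-n_i}`, where
`B = [(n_k, a_k), …, (n_1, a_1)]`. -/
def blockCoeff (ξ : K) (q : ℕ) (B : List (ℤ × ZMod N)) (s : ℕ) : K :=
  (q : K) ^ s * ∑ l ∈ Finset.Nat.antidiagonalTuple B.length s,
    (((∏ i, Ring.choose (-(B.get i).1) (l i) : ℤ)) : K) *
      nestedSum ξ (List.ofFn fun i => ((B.get i).1 + (l i : ℤ), (B.get i).2)) q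

/-- The coefficient of `𝔥_m(V)` in the expression of the nested sum `𝔥_{qm}(L)` obtained by
writing `m_i = q u_i + r_i` with `0 ≤ r_i < q`, grouping the consecutive indices that have the
same quotient `u`, and expanding `(q u + r_i)^{-n_i}` by the binomial series if `r_i ≠ 0`.
If `V = []` all the quotients are `0`. Otherwise the letter `(t, c)` of `V` stands for
`ξ^{cu} u^{-t}`, where `u > 0` is the largest quotient; the sum is over the number `i + 1` of
letters of `L` having this quotient. Among their remainders only the smallest one may be `0`:
the two terms correspond to the cases where it is not `0` and where it is `0`. -/
def actionCoeff (ξ : K) (q : ℕ) : List (ℤ × ZMod N) → List (ℤ × ZMod N) → K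
  | L, [] => nestedSum ξ L q
  | L, (t, c) :: V =>
      ∑ i : Fin L.length,
        if c = q • ((L.take (i + 1)).map Prod.snd).sum then
          ((if t ≤ 0 then blockCoeff ξ q (L.take (i + 1)) (-t).toNat else 0) +
            (if t ≤ (L.get i).1 then
              (q : K) ^ (-(L.get i).1) * blockCoeff ξ q (L.take i) ((L.get i).1 - t).toNat
            else 0)) * actionCoeff ξ q (L.drop (i + 1)) V
        else 0

end Loc

/-! ### Localized adjoint `p`-adic multiple zeta values -/

section Padic

variable {K : Type*} [NormedField K] [CharZero K] {N : ℕ}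

/-- The contribution of the sequence `V` to the coefficient of `ξ^{jm} m^l 𝔥_m(v)` in the
expression of `har_{qm}(w)`. -/
def harCoeffTerm (ξ : K) (q : ℕ) (w : HarWord ℤ N)
    (x : ZMod N × ℤ × List (ℕ+ × ZMod N)) (V : List (ℤ × ZMod N)) : K :=
  if w.weight id ≤ x.2.1 then
    (q : K) ^ w.weight id * actionCoeff ξ q w.chars V *
      locExpr ξ V (x.1 + q • w.top, (x.2.1 - w.weight id).toNat, x.2.2)
  else 0

/-- The coefficient of `ξ^{jm} m^l 𝔥_m(v)`, for `x = (j, l, v)`, in the expression of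
`har_{qm}(w)` in terms of `m` and of the nested sums `𝔥_m(v)` with positive exponents. -/
def harCoeff (ξ : K) (q : ℕ) (w : HarWord ℤ N) (x : ZMod N × ℤ × List (ℕ+ × ZMod N)) : K :=
  ∑' V : List (ℤ × ZMod N), harCoeffTerm ξ q w x V

/-- The localized adjoint `p`-adic multiple zeta value attached with `w`, `l` and `j`: the
coefficient of `ξ^{jm} m^l har_m(∅)` in the expression of `har_{p^α m}(w)`. -/
def locAdMZV (ξ : K) (p α : ℕ) (x : ZMod N × ℤ × HarWord ℤ N) : K :=
  harCoeff ξ (p ^ α) x.2.2 (x.1, x.2.1, [])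

end Padic

/-! ### The adjoint quasi-shuffle relations -/

/-- The adjoint quasi-shuffle relation of index `(j, l)` attached with `w` and `w'`, in the
variables `X (j, l, w)`: it is
`∑ X (j₁, l₁, w) * X (j₂, l₂, w') - X (j, l, w ∗ w')`, with the sum over `j₁ + j₂ = j` and
`l₁ + l₂ = l`, `l₁ ≥ weight w`, `l₂ ≥ weight w'`, and with `X (j, l, ·)` extended linearly. -/
def adjointRel {A : Type} [Add A] {N : ℕ} [NeZero N] (val : A → ℤ) (w w' : HarWord A N)
    (j : ZMod N) (l : ℤ) : MvPolynomial (ZMod N × ℤ × HarWord A N) ℤ :=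
  ∑ i : ZMod N, ∑ k ∈ Finset.Icc (w.weight val) (l - w'.weight val),
      MvPolynomial.X (i, k, w) * MvPolynomial.X (j - i, l - k, w') -
    ((w.star w').map fun v => MvPolynomial.X (j, l, v)).sum

end LocHar

end

open LocHar

/-! The product formula for the sums H_m is a fact about nested sums in any commutative ring:
raising the upper bound by one adds to a product of two nested sums exactly the three kinds of terms
of the quasi-shuffle recursion (`nestSum_mul`). The factor ξ^{-jm} is multiplicative in j, and the
inclusion of ordinary words preserves letters, weights and quasi-shuffles.

For the p-adic statements, numerical equalities between sums would have to be turned into equalities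
of coefficients. The proof therefore works in the formal quasi-shuffle algebra `QSh`: for a given m
the monomials ξ^{cm} m^t are evaluated, but H_m(v) stays a symbol v. The expansion of H_{qm}(L)
becomes an element `nestedElem`. Passing from m to m + 1 becomes the operator `theta`, which
respects the quasi-shuffle product (`theta_qmul`). By `theta_nestedElem`, `nestedElem` obeys the
recursion that H_{qm}(L) obeys when the indices in [qm, q(m+1)) are split off. Together with the
value at m = 1 this gives the expression of H_{qm}(L) by induction on m (`nestedLin_nestedElem`).

For the relations, consider the product of two expansions minus the expansion of the quasi-shuffle.
By induction on the total length, this is a family g with theta (g (m+1)) = g m, with bounded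
coefficients supported in a fixed finite set, and with constant term 0 at m = 1. Such a family
vanishes (`BoundedFamily.eq_zero`): coefficients of the longest words do not depend on m, and
coefficients of words one letter shorter then change by a combination of terms ξ^{cm} m^{-n} with n
> 0, which is unbounded as m tends p-adically to 0 in a suitable residue class unless it is trivial.
Taking constant terms in `qmul_nestedElem` gives an identity of functions of m. Letting m tend to 0
inside each class modulo N separates the powers of m (`eq_zero_of_hasSum_zero`), and independence of
characters separates the ξ^{cm}.

All convergence rests on `tendsto_actionCoeff_mul_locExpr`. The sequences V that occur have bounded
length and bounded positive exponents, so only their negative exponents grow. In that direction the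
block coefficients decay geometrically, while the coefficients of `locExpr` grow at most
polynomially, by von Staudt–Clausen and because ξ^c - 1 is a unit when nonzero. -/

noncomputable section

namespace LocHar

/-! ### Nested sums in a commutative ring -/

section NestSum

variable {A B : Type*} [CommRing A]

/-- The sum over `0 ≤ r_1 < ⋯ < r_k < M` of `∏ φ x_i r_i`, for `[x_k, …, x_1]`. -/
def nestSum (φ : B → ℕ → A) : List B → ℕ → A
  | [], _ => 1
  | x :: V, M => ∑ r ∈ Finset.range M, φ x r * nestSum φ V r

@[simp] theorem nestSum_nil (φ : B → ℕ → A) (M : ℕ) : nestSum φ [] M = 1 := rfl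

theorem nestSum_cons (φ : B → ℕ → A) (x : B) (V : List B) (M : ℕ) :
    nestSum φ (x :: V) M = ∑ r ∈ Finset.range M, φ x r * nestSum φ V r := rfl

@[simp] theorem nestSum_cons_zero (φ : B → ℕ → A) (x : B) (V : List B) :
    nestSum φ (x :: V) 0 = 0 := by simp [nestSum_cons]

theorem nestSum_cons_succ (φ : B → ℕ → A) (x : B) (V : List B) (M : ℕ) :
    nestSum φ (x :: V) (M + 1) = nestSum φ (x :: V) M + φ x M * nestSum φ V M := by
  simp [nestSum_cons, Finset.sum_range_succ]

theorem nestSum_congr {φ ψ : B → ℕ → A} {L : List B} {M : ℕ}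
    (h : ∀ x ∈ L, ∀ r < M, φ x r = ψ x r) : nestSum φ L M = nestSum ψ L M := by
  induction L generalizing M with
  | nil => rfl
  | cons x V ih =>
    refine Finset.sum_congr rfl fun r hr => ?_
    have hr' := Finset.mem_range.1 hr
    rw [h x (by simp) r hr', ih fun y hy s hs => h y (by simp [hy]) s (hs.trans hr')]

theorem nestSum_smul (χ : B → A) (φ : B → ℕ → A) (L : List B) (M : ℕ) :
    nestSum (fun x r => χ x * φ x r) L M = (L.map χ).prod * nestSum φ L M := by
  induction L generalizing M with
  | nil => simp
  | cons x V ih =>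
    simp only [nestSum_cons, ih, List.map_cons, List.prod_cons, Finset.mul_sum]
    exact Finset.sum_congr rfl fun r _ => by ring

/-- Nested sums over `[0, M + R)` in terms of nested sums over `[0, M)` and `[M, M + R)`. -/
theorem nestSum_add (φ : B → ℕ → A) (L : List B) (M R : ℕ) :
    nestSum φ L (M + R) = ∑ i ∈ Finset.range (L.length + 1),
      nestSum (fun x r => φ x (M + r)) (L.take i) R * nestSum φ (L.drop i) M := by
  induction R generalizing L with
  | zero =>
    rw [Finset.sum_range_succ', Finset.sum_eq_zero]
    · simp
    · intro i hi
      cases L with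
      | nil => simp at hi
      | cons x V => simp
  | succ R ih =>
    cases L with
    | nil => simp
    | cons x V =>
      rw [← add_assoc, nestSum_cons_succ, ih, ih, List.length_cons,
        Finset.sum_range_succ' _ (V.length + 1), Finset.sum_range_succ' _ (V.length + 1)]
      simp only [List.take_succ_cons, List.drop_succ_cons, nestSum_cons_succ, add_mul,
        Finset.sum_add_distrib, Finset.mul_sum, List.take_zero, List.drop_zero, nestSum_nil, mul_assoc]
      ring

/-- Nested sums over `[0, M)` in terms of nested sums over `(0, M)`. -/
theorem nestSum_append_singleton (φ : B → ℕ → A) (L : List B) (x : B) {M : ℕ} (hM : 0 < M) :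
    nestSum φ (L ++ [x]) M = nestSum (fun x r => if r = 0 then 0 else φ x r) (L ++ [x]) M +
      nestSum (fun x r => if r = 0 then 0 else φ x r) L M * φ x 0 := by
  induction L generalizing M with
  | nil =>
    obtain ⟨M, rfl⟩ := Nat.exists_eq_succ_of_ne_zero hM.ne'
    simp [nestSum_cons, Finset.sum_range_succ']
  | cons y L ih =>
    simp only [List.cons_append, nestSum_cons, Finset.sum_mul, ← Finset.sum_add_distrib]
    refine Finset.sum_congr rfl fun r _ => ?_
    rcases Nat.eq_zero_or_pos r with rfl | hr
    · cases L <;> simp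
    · rw [ih hr, if_neg hr.ne']
      ring

/-! ### Quasi-shuffles of lists and products of nested sums. -/

theorem quasiShuffle_nil_left {B : Type} [Add B] (v : List B) : quasiShuffle [] v = [v] := by
  simp [quasiShuffle]

theorem quasiShuffle_nil_right {B : Type} [Add B] (u : List B) : quasiShuffle u [] = [u] := by
  cases u <;> simp [quasiShuffle]

theorem quasiShuffle_cons_cons {B : Type} [Add B] (a b : B) (u v : List B) :
    quasiShuffle (a :: u) (b :: v) =
      (quasiShuffle u (b :: v)).map (a :: ·) ++ (quasiShuffle (a :: u) v).map (b :: ·) ++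
        (quasiShuffle u v).map ((a + b) :: ·) := by
  rw [quasiShuffle]

/-- Induction along the recursive definition of the quasi-shuffle. -/
theorem quasiShuffle_induction {B : Type} {P : List B → List B → Prop}
    (nil_left : ∀ v, P [] v) (nil_right : ∀ u, P u [])
    (cons_cons : ∀ a u b v, P u (b :: v) → P (a :: u) v → P u v → P (a :: u) (b :: v))
    (u v : List B) : P u v := by
  induction u generalizing v with
  | nil => exact nil_left v
  | cons a u ihu =>
    induction v with
    | nil => exact nil_right _
    | cons b v ihv => exact cons_cons a u b v (ihu _) ihv (ihu _)

/-- Sums over the terms of a quasi-shuffle of nonempty lists. -/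
theorem sum_map_quasiShuffle_cons_cons {B : Type} {M : Type*} [Add B] [AddCommMonoid M]
    (F : List B → M) (a b : B) (u v : List B) :
    ((quasiShuffle (a :: u) (b :: v)).map F).sum =
      ((quasiShuffle u (b :: v)).map fun W => F (a :: W)).sum +
      ((quasiShuffle (a :: u) v).map fun W => F (b :: W)).sum +
      ((quasiShuffle u v).map fun W => F ((a + b) :: W)).sum := by
  simp [quasiShuffle_cons_cons, List.map_map, Function.comp_def, add_assoc]

/-- The increment at M of the product is (S_{au} + φ_a S_u)(S_{bv} + φ_b S_v) - S_{au} S_{bv}. Its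
three terms match the three families of the quasi-shuffle recursion, the term φ_a φ_b being the
letter a + b. -/
theorem nestSum_mul {B : Type} [Add B] (φ : B → ℕ → A) (hφ : ∀ x y r, φ (x + y) r = φ x r * φ y r)
    (u v : List B) (M : ℕ) :
    nestSum φ u M * nestSum φ v M = ((quasiShuffle u v).map fun W => nestSum φ W M).sum := by
  induction u, v using quasiShuffle_induction generalizing M with
  | nil_left v => simp [quasiShuffle_nil_left]
  | nil_right u => simp [quasiShuffle_nil_right]
  | cons_cons a u b v h1 h2 h3 =>
    induction M with
    | zero =>
      simp [quasiShuffle_cons_cons, Function.comp_def]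
    | succ M ih =>
      rw [sum_map_quasiShuffle_cons_cons] at ih ⊢
      simp only [nestSum_cons_succ, List.sum_map_add, List.sum_map_mul_left, ← h1, ← h2, ← h3,
        hφ] at ih ⊢
      linear_combination ih

/-- The quasi-shuffle product is compatible with deconcatenation. -/
theorem sum_quasiShuffle_take_drop {B : Type} {M : Type*} [Add B] [AddCommMonoid M]
    (F : List B → List B → M) (u v : List B) :
    ((quasiShuffle u v).map fun W =>
        ∑ i ∈ Finset.range (W.length + 1), F (W.take i) (W.drop i)).sum =
      ∑ i ∈ Finset.range (u.length + 1), ∑ j ∈ Finset.range (v.length + 1),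
        ((quasiShuffle (u.take i) (v.take j)).map fun X =>
          ((quasiShuffle (u.drop i) (v.drop j)).map fun Y => F X Y).sum).sum := by
  induction u, v using quasiShuffle_induction generalizing F with
  | nil_left v => simp [quasiShuffle_nil_left]
  | nil_right u => simp [quasiShuffle_nil_right]
  | cons_cons a u b v h1 h2 h3 =>
    rw [sum_map_quasiShuffle_cons_cons]
    simp only [List.length_cons, Finset.sum_range_succ' _ (_ + 1), List.take_succ_cons,
      List.drop_succ_cons, List.sum_map_add, List.take_zero, List.drop_zero,
      h1 fun X Y => F (a :: X) Y, h2 fun X Y => F (b :: X) Y, h3 fun X Y => F ((a + b) :: X) Y,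
      quasiShuffle_nil_left, quasiShuffle_nil_right, sum_map_quasiShuffle_cons_cons,
      Finset.sum_add_distrib, List.map_cons, List.map_nil, List.sum_cons, List.sum_nil, add_zero]
    abel

/-- An additive function is additive on the sums of letters. -/
theorem sum_of_mem_quasiShuffle {B : Type} {M : Type*} [Add B] [AddCommMonoid M] (f : B → M)
    (hf : ∀ x y, f (x + y) = f x + f y) {u v W : List B} (hW : W ∈ quasiShuffle u v) :
    (W.map f).sum = (u.map f).sum + (v.map f).sum := by
  induction u, v using quasiShuffle_induction generalizing W with
  | nil_left v => simp_all [quasiShuffle_nil_left]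
  | nil_right u => simp_all [quasiShuffle_nil_right]
  | cons_cons a u b v h1 h2 h3 =>
    simp only [quasiShuffle_cons_cons, List.mem_append, List.mem_map] at hW
    rcases hW with (⟨W, h, rfl⟩ | ⟨W, h, rfl⟩) | ⟨W, h, rfl⟩
    · simp only [List.map_cons, List.sum_cons, h1 h]
      abel
    · simp only [List.map_cons, List.sum_cons, h2 h]
      abel
    · simp only [List.map_cons, List.sum_cons, h3 h, hf]
      abel

theorem quasiShuffle_map {B C : Type} [Add B] [Add C] (f : B → C)
    (hf : ∀ x y, f (x + y) = f x + f y) (u v : List B) :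
    quasiShuffle (u.map f) (v.map f) = (quasiShuffle u v).map (List.map f) := by
  induction u, v using quasiShuffle_induction with
  | nil_left v => simp [quasiShuffle_nil_left]
  | nil_right u => simp [quasiShuffle_nil_right]
  | cons_cons a u b v h1 h2 h3 =>
    simp only [List.map_cons] at h1 h2 h3 ⊢
    simp [quasiShuffle_cons_cons, h1, h2, h3, Function.comp_def, hf]

end NestSum

/-! ### Letters of words -/

section Words

variable {A : Type} {N : ℕ}

theorem toChars_ofChars (J : ZMod N) (V : List (A × ZMod N)) : toChars J (ofChars J V) = V := by
  induction V generalizing J with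
  | nil => rfl
  | cons x V ih => simp [ofChars, toChars, ih]

theorem ofChars_map {A' : Type} (f : A → A') (J : ZMod N) (V : List (A × ZMod N)) :
    ofChars J (V.map fun x => (f x.1, x.2)) = (ofChars J V).map fun x => (f x.1, x.2) := by
  induction V generalizing J with
  | nil => rfl
  | cons x V ih => simp [ofChars, ih]

theorem toChars_map {A' : Type} (f : A → A') (J : ZMod N) (V : List (A × ZMod N)) :
    toChars J (V.map fun x => (f x.1, x.2)) = (toChars J V).map fun x => (f x.1, x.2) := by
  induction V generalizing J with
  | nil => rfl
  | cons x V ih => simp [toChars, ih]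

theorem toChars_fst (J : ZMod N) (V : List (A × ZMod N)) :
    (toChars J V).map Prod.fst = V.map Prod.fst := by
  induction V generalizing J with
  | nil => rfl
  | cons x V ih => simp [toChars, ih]

theorem HarWord.weight_eq_chars (val : A → ℤ) (w : HarWord A N) :
    w.weight val = (w.chars.map fun x => val x.1).sum := by
  have h := congrArg (List.map val) (toChars_fst w.top w.rest)
  simp only [List.map_map, Function.comp_def] at h
  rw [HarWord.weight, HarWord.chars, ← h]

theorem HarWord.top_chars_of_mem_star [Add A] {w w' v : HarWord A N} (hv : v ∈ w.star w') :
    v.top = w.top + w'.top ∧ v.chars ∈ quasiShuffle w.chars w'.chars := by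
  obtain ⟨V, hV, rfl⟩ := List.mem_map.1 hv
  refine ⟨rfl, ?_⟩
  change toChars (w.top + w'.top) (ofChars (w.top + w'.top) V) ∈ _
  rwa [toChars_ofChars]

theorem HarWord.map_chars_star [Add A] (w w' : HarWord A N) :
    (w.star w').map HarWord.chars = quasiShuffle w.chars w'.chars := by
  simp [HarWord.star, HarWord.chars, Function.comp_def, toChars_ofChars]

theorem HarWord.weight_of_mem_star [Add A] {val : A → ℤ} (hval : ∀ x y, val (x + y) = val x + val y)
    {w w' v : HarWord A N} (hv : v ∈ w.star w') :
    v.weight val = w.weight val + w'.weight val := by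
  simp only [HarWord.weight_eq_chars]
  exact sum_of_mem_quasiShuffle (fun x => val x.1) (fun x y => hval _ _) (top_chars_of_mem_star hv).2

theorem HarWord.toLoc_weight (w : HarWord ℕ+ N) :
    w.toLoc.weight id = w.weight fun n : ℕ+ => (n : ℤ) := by
  simp [HarWord.weight, HarWord.toLoc, Function.comp_def]

theorem HarWord.toLoc_star (w w' : HarWord ℕ+ N) :
    w.toLoc.star w'.toLoc = (w.star w').map HarWord.toLoc := by
  have h : ∀ u : HarWord ℕ+ N, u.toLoc.chars = u.chars.map fun x => ((x.1 : ℤ), x.2) := fun u =>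
    toChars_map (fun n : ℕ+ => (n : ℤ)) _ _
  rw [HarWord.star, HarWord.star, h, h, quasiShuffle_map _ (fun x y => by simp), List.map_map,
    List.map_map]
  refine List.map_congr_left fun V _ => ?_
  simp [HarWord.toLoc, ofChars_map (fun n : ℕ+ => (n : ℤ))]

theorem locStar_toLoc (w w' : HarWord ℕ+ N) :
    locStar N w.toLoc.toAlg w'.toLoc.toAlg = ((w.star w').map fun v => v.toLoc.toAlg).sum := by
  rw [locStar_toAlg, HarWord.toLoc_star, List.map_map]
  rfl

/-- The same formula defines both families, so it suffices that `toLoc` preserves weights and the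
terms of the product. -/
theorem rename_adjointRel [NeZero N] (w w' : HarWord ℕ+ N) (j : ZMod N) (l : ℤ) :
    MvPolynomial.rename (fun x => (x.1, x.2.1, x.2.2.toLoc))
        (adjointRel (fun n : ℕ+ => (n : ℤ)) w w' j l) =
      adjointRel id w.toLoc w'.toLoc j l := by
  simp [adjointRel, HarWord.toLoc_weight, HarWord.toLoc_star, map_list_sum, Function.comp_def]

end Words

/-! ### The quasi-shuffle relations for localized multiple harmonic sums -/

section Field

variable {K : Type*} [Field K] {N : ℕ}

theorem pow_val_add [NeZero N] {ξ : K} (hξ : ξ ^ N = 1) (a b : ZMod N) :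
    ξ ^ (a + b).val = ξ ^ a.val * ξ ^ b.val := by
  rw [ZMod.val_add, ← pow_add, pow_eq_pow_mod (a.val + b.val) hξ]

/-- The function `r ↦ (ξ ^ a) ^ r / r ^ n` attached with the letter `(n, a)`. -/
def letterFun (ξ : K) (x : ℤ × ZMod N) (r : ℕ) : K := (ξ ^ x.2.val) ^ r / (r : K) ^ x.1

/-- The value r = 0 must be excluded: opposite exponents cancel in x + y, whereas the product of the
two values at 0 is 0. -/
theorem letterFun_add [NeZero N] [CharZero K] {ξ : K} (hξ : ξ ^ N = 1) (x y : ℤ × ZMod N) {r : ℕ}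
    (hr : r ≠ 0) : letterFun ξ (x + y) r = letterFun ξ x r * letterFun ξ y r := by
  have : (r : K) ≠ 0 := by exact_mod_cast hr
  simp only [letterFun, Prod.fst_add, Prod.snd_add, pow_val_add hξ, zpow_add₀ this, mul_pow]
  rw [mul_div_mul_comm]

/-- Setting the letters to 0 at r = 0 encodes the condition 0 < m_1, and makes the letters
multiplicative at every r, as `nestSum_mul` requires. -/
theorem nestedSum_eq_nestSum (ξ : K) (V : List (ℤ × ZMod N)) (m : ℕ) :
    nestedSum ξ V m = nestSum (fun x r => if r = 0 then 0 else letterFun ξ x r) V m := by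
  induction V generalizing m with
  | nil => rfl
  | cons x V ih =>
    rw [nestSum_cons, nestedSum]
    have : Finset.Ioo 0 m = (Finset.range m).filter (· ≠ 0) := by
      ext; simp [Nat.pos_iff_ne_zero, and_comm]
    rw [this, Finset.sum_filter]
    refine Finset.sum_congr rfl fun r _ => ?_
    by_cases hr : r = 0
    · simp [hr]
    · simp [hr, letterFun, ih]

theorem nestedSum_mul [NeZero N] [CharZero K] {ξ : K} (hξ : ξ ^ N = 1) (u v : List (ℤ × ZMod N)) (m : ℕ) :
    nestedSum ξ u m * nestedSum ξ v m =
      ((quasiShuffle u v).map fun W => nestedSum ξ W m).sum := by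
  simp only [nestedSum_eq_nestSum]
  refine nestSum_mul _ (fun x y r => ?_) u v m
  by_cases hr : r = 0
  · simp [hr]
  · simp [hr, letterFun_add hξ x y hr]

theorem mhs_mul [NeZero N] [CharZero K] {ξ : K} (hξ : ξ ^ N = 1) (m : ℕ) (w w' : HarWord ℤ N) :
    mhs ξ m w * mhs ξ m w' = mhsLin N ξ m (locStar N w.toAlg w'.toAlg) := by
  rw [locStar_toAlg, map_list_sum, List.map_map]
  have h : ∀ v ∈ w.star w', (mhsLin N ξ m ∘ HarWord.toAlg) v =
      nestedSum ξ v.chars m * ((1 / ξ ^ w.top.val) ^ m * (1 / ξ ^ w'.top.val) ^ m) := by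
    intro v hv
    rw [Function.comp_apply, mhsLin_toAlg, mhs, (HarWord.top_chars_of_mem_star hv).1,
      pow_val_add hξ, ← mul_pow]
    congr 2
    ring
  rw [List.map_congr_left h, List.sum_map_mul_right]
  have h2 := congrArg (fun l => (l.map fun V => nestedSum ξ V m).sum) (HarWord.map_chars_star w w')
  simp only [List.map_map, Function.comp_def] at h2
  rw [h2, ← nestedSum_mul hξ, mhs, mhs]
  ring

end Field

/-! ### The quasi-shuffle algebra of sequences with positive exponents -/

section QuasiShuffleAlgebra

variable {K : Type*} [Field K] {N : ℕ}

/-- Formal linear combinations of sequences with positive exponents. -/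
abbrev QSh (K : Type*) [Field K] (N : ℕ) : Type _ := List (ℕ+ × ZMod N) →₀ K

/-- The quasi-shuffle product on `QSh K N`. -/
def qmul : QSh K N →ₗ[K] QSh K N →ₗ[K] QSh K N :=
  Finsupp.linearCombination K fun u =>
    Finsupp.linearCombination K fun v =>
      ((quasiShuffle u v).map fun W => Finsupp.single W (1 : K)).sum

theorem qmul_single_single (u v : List (ℕ+ × ZMod N)) :
    qmul (Finsupp.single u (1 : K)) (Finsupp.single v 1) =
      ((quasiShuffle u v).map fun W => Finsupp.single W (1 : K)).sum := by
  simp [qmul]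

/-- The part of degree `-1` of `theta`. -/
def thetaAux (χ : ℕ+ × ZMod N → K) : List (ℕ+ × ZMod N) → QSh K N
  | [] => 0
  | x :: v => χ x • Finsupp.single v 1

@[simp] theorem thetaAux_nil (χ : ℕ+ × ZMod N → K) : thetaAux χ [] = 0 := rfl

@[simp] theorem thetaAux_cons (χ : ℕ+ × ZMod N → K) (x : ℕ+ × ZMod N) (v : List (ℕ+ × ZMod N)) :
    thetaAux χ (x :: v) = χ x • Finsupp.single v 1 := rfl

/-- The map `x :: v ↦ x :: v + χ x • v`. -/
def theta (χ : ℕ+ × ZMod N → K) : QSh K N →ₗ[K] QSh K N :=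
  LinearMap.id + Finsupp.linearCombination K (thetaAux χ)

theorem theta_single (χ : ℕ+ × ZMod N → K) (v : List (ℕ+ × ZMod N)) (y : K) :
    theta χ (Finsupp.single v y) = Finsupp.single v y + y • thetaAux χ v := by
  simp [theta]

theorem theta_sum_single_cons (χ : ℕ+ × ZMod N → K) (x : ℕ+ × ZMod N)
    (l : List (List (ℕ+ × ZMod N))) :
    theta χ (l.map fun W => Finsupp.single (x :: W) (1 : K)).sum =
      (l.map fun W => Finsupp.single (x :: W) (1 : K)).sum +
        χ x • (l.map fun W => Finsupp.single W (1 : K)).sum := by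
  induction l with
  | nil => simp
  | cons W l ih =>
    simp only [List.map_cons, List.sum_cons, map_add, ih, theta_single, thetaAux_cons, one_smul]
    module

/-- For nonempty words, the three families of the quasi-shuffle of a :: u and b :: v contribute χ a,
χ b and χ (a + b) times shorter products. These are the cross terms in the product of a :: u + χ a •
u and b :: v + χ b • v. -/
theorem theta_qmul {χ : ℕ+ × ZMod N → K} (hχ : ∀ x y, χ (x + y) = χ x * χ y) (f g : QSh K N) :
    theta χ (qmul f g) = qmul (theta χ f) (theta χ g) := by
  have key : qmul.compr₂ (theta χ) = (qmul (K := K) (N := N)).compl₁₂ (theta χ) (theta χ) := by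
    ext u v : 4
    simp only [LinearMap.comp_apply, LinearMap.compr₂_apply, LinearMap.compl₁₂_apply,
      Finsupp.lsingle_apply, theta_single, one_smul]
    rcases u with _ | ⟨a, u⟩
    · rcases v with _ | ⟨b, v⟩ <;>
        simp only [thetaAux_nil, thetaAux_cons, qmul_single_single, quasiShuffle_nil_left,
          theta_single, add_zero, one_smul, map_add, map_smul, List.map_cons, List.map_nil,
          List.sum_cons, List.sum_nil]
    rcases v with _ | ⟨b, v⟩
    · simp only [thetaAux_nil, thetaAux_cons, qmul_single_single, quasiShuffle_nil_right,
        theta_single, add_zero, one_smul, map_add, map_smul, LinearMap.add_apply,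
        LinearMap.smul_apply, List.map_cons, List.map_nil, List.sum_cons, List.sum_nil]
    simp only [thetaAux_cons, map_add, map_smul, LinearMap.add_apply, LinearMap.smul_apply,
      qmul_single_single, sum_map_quasiShuffle_cons_cons, theta_sum_single_cons, hχ]
    generalize (List.map (fun W => Finsupp.single W (1 : K)) (quasiShuffle u v)).sum = q1
    module
  exact congrArg (fun F => F f g) key

/-- The finite set F is left free so that one choice serves a whole family of elements f. -/
theorem theta_apply (χ : ℕ+ × ZMod N → K) (f : QSh K N) (v : List (ℕ+ × ZMod N))
    (F : Finset (ℕ+ × ZMod N)) (hF : ∀ x, f (x :: v) ≠ 0 → x ∈ F) :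
    theta χ f v = f v + ∑ x ∈ F, χ x * f (x :: v) := by
  rw [theta, LinearMap.add_apply, Finsupp.add_apply, LinearMap.id_apply,
    Finsupp.linearCombination_apply, Finsupp.sum, Finsupp.finsetSum_apply]
  congr 1
  have hinj : Function.Injective fun x : ℕ+ × ZMod N => x :: v := fun x y h => (List.cons.inj h).1
  have h : ∑ x ∈ F, χ x * f (x :: v) = ∑ u ∈ F.map ⟨_, hinj⟩, (f u • thetaAux χ u) v := by
    rw [Finset.sum_map]
    refine Finset.sum_congr rfl fun x _ => ?_
    rw [Function.Embedding.coeFn_mk, thetaAux_cons]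
    simp [mul_comm]
  rw [h]
  refine Finset.sum_congr_of_eq_on_inter (fun u hu hu' => ?_) (fun u _ hu => ?_) fun _ _ _ => rfl
  · rcases u with _ | ⟨x, u⟩
    · simp
    · by_cases huv : u = v
      · subst huv
        exact absurd (Finset.mem_map.2 ⟨x, hF x (Finsupp.mem_support_iff.1 hu), rfl⟩) hu'
      · simp [huv]
  · simp [Finsupp.notMem_support_iff.1 hu]

/-- The empty word is a term of a quasi-shuffle only when both factors are empty. -/
theorem qmul_apply_nil (f g : QSh K N) : qmul f g [] = f [] * g [] := by
  have key : qmul.compr₂ (Finsupp.lapply []) =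
      (LinearMap.mul K K).compl₁₂ (Finsupp.lapply (R := K) ([] : List (ℕ+ × ZMod N)))
        (Finsupp.lapply []) := by
    ext u v
    rcases u with _ | ⟨a, u⟩
    · simp [qmul_single_single, quasiShuffle_nil_left]
    rcases v with _ | ⟨b, v⟩
    · simp [qmul_single_single, quasiShuffle_nil_right]
    have h : ∀ (x : ℕ+ × ZMod N) (l : List (List (ℕ+ × ZMod N))),
        (l.map fun W => Finsupp.single (x :: W) (1 : K)).sum [] = 0 := by
      intro x l
      induction l with
      | nil => rfl
      | cons W l ih => simp [ih]
    simp [qmul_single_single, sum_map_quasiShuffle_cons_cons, h]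
  exact congrArg (fun F => F f g) key

end QuasiShuffleAlgebra

/-! ### The map `loc` and the shift of the upper bound -/

section Loc

open Polynomial

variable {K : Type*} [Field K] {N : ℕ}

/-- The evaluation of `ξ^{cm}` and `m^t`. -/
def evl (ξ : K) (m : ℕ) : Expr K N →ₗ[K] QSh K N :=
  Finsupp.linearCombination K fun x => Finsupp.single x.2.2 ((ξ ^ x.1.val) ^ m * (m : K) ^ x.2.1)

theorem evl_single (ξ : K) (m : ℕ) (x : ZMod N × ℕ × List (ℕ+ × ZMod N)) (y : K) :
    evl ξ m (Finsupp.single x y) =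
      (y * ((ξ ^ x.1.val) ^ m * (m : K) ^ x.2.1)) • Finsupp.single x.2.2 1 := by
  simp only [evl, Finsupp.linearCombination_single, Finsupp.smul_single, smul_eq_mul, mul_one]

/-- The letters of positive exponent at `m`. -/
def posLetter (ξ : K) (m : ℕ) (x : ℕ+ × ZMod N) : K := letterFun ξ ((x.1 : ℤ), x.2) m

variable [CharZero K]

theorem posLetter_add [NeZero N] {ξ : K} (hξ : ξ ^ N = 1) {m : ℕ} (hm : m ≠ 0) (x y : ℕ+ × ZMod N) :
    posLetter ξ m (x + y) = posLetter ξ m x * posLetter ξ m y := by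
  rw [posLetter, posLetter, posLetter, ← letterFun_add hξ _ _ hm]
  simp

omit [CharZero K] in
theorem evl_polynomial_sum (ξ : K) (m : ℕ) (c : ZMod N) (v : List (ℕ+ × ZMod N)) (Q : K[X]) :
    evl ξ m (Q.sum fun i y => Finsupp.single (c, i, v) y) =
      ((ξ ^ c.val) ^ m * Q.eval (m : K)) • Finsupp.single v 1 := by
  rw [Polynomial.sum, map_sum, Polynomial.eval_eq_sum, Polynomial.sum, Finset.mul_sum,
    Finset.sum_smul]
  refine Finset.sum_congr rfl fun i _ => ?_
  rw [evl_single]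
  congr 1
  ring

theorem antidiff_eval (ζ : K) (t m : ℕ) :
    ζ * (antidiff ζ t).eval ((m : K) + 1) = (antidiff ζ t).eval (m : K) + (m : K) ^ t := by
  have h := congrArg (Polynomial.eval (m : K)) (antidiff_spec ζ t)
  simp only [eval_sub, eval_mul, eval_C, eval_comp, eval_add, eval_X, eval_one, eval_pow] at h
  linear_combination h

theorem sumExpr_cons_ofNat (ξ : K) (n : ℕ+) (a : ZMod N) (v : List (ℕ+ × ZMod N)) (c : ZMod N)
    (t : ℕ) :
    sumExpr ξ ((n, a) :: v) c (Int.ofNat t) =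
      ((antidiff (ξ ^ c.val) t).sum fun i y => Finsupp.single (c, i, (n, a) :: v) y) -
        ∑ i ∈ ((antidiff (ξ ^ c.val) t).comp (X + 1)).support,
          (ξ ^ c.val * ((antidiff (ξ ^ c.val) t).comp (X + 1)).coeff i) •
            sumExpr ξ v (a + c) ((i : ℤ) - (n : ℤ)) := by
  rw [sumExpr]
  rfl

/-- Formally, the sum over 0 < k < m + 1 exceeds the sum over 0 < k < m by the term k = m. The
identity holds in `QSh`, before the symbols v are replaced by numbers. For t ≥ 0 it reduces to the
difference equation of `antidiff`. -/
theorem theta_evl_sumExpr [NeZero N] {ξ : K} (hξ : ξ ^ N = 1) {m : ℕ} (hm : m ≠ 0)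
    (v : List (ℕ+ × ZMod N)) (c : ZMod N) (t : ℤ) :
    theta (posLetter ξ m) (evl ξ (m + 1) (sumExpr ξ v c t)) =
      evl ξ m (sumExpr ξ v c t) + letterFun ξ (-t, c) m • Finsupp.single v 1 := by
  have hm' : (m : K) ≠ 0 := by exact_mod_cast hm
  induction v generalizing c t with
  | nil =>
    rcases t with t | s
    · simp only [sumExpr, map_sub, evl_polynomial_sum, evl_single, ZMod.val_zero, pow_zero, one_pow,
        mul_one, map_smul, theta_single, thetaAux, smul_zero, add_zero, Nat.cast_add, Nat.cast_one,
        pow_succ, mul_assoc, antidiff_eval, letterFun, Int.ofNat_eq_natCast, zpow_neg, zpow_natCast,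
        div_inv_eq_mul]
      module
    · simp [sumExpr, evl_single, theta_single, posLetter]
  | cons x v ih =>
    obtain ⟨n, a⟩ := x
    rcases t with t | s
    · set ζ := ξ ^ c.val with hζ
      set R := (antidiff ζ t).comp (X + 1) with hR
      have hRm : ζ * R.eval (m : K) = (antidiff ζ t).eval (m : K) + (m : K) ^ t := by
        rw [← antidiff_eval, hR, eval_comp, eval_add, eval_X, eval_one]
      -- The multiple of v that `theta` extracts from the head letter (n, a) is cancelled by the
      -- terms k = m of the recursive sums.
      have h1 : ∑ i ∈ R.support, (ζ * R.coeff i) * letterFun ξ (-((i : ℤ) - (n : ℤ)), a + c) m =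
          ζ ^ (m + 1) * R.eval (m : K) * posLetter ξ m (n, a) := by
        rw [eval_eq_sum, Polynomial.sum, Finset.mul_sum, Finset.sum_mul]
        refine Finset.sum_congr rfl fun i _ => ?_
        simp only [posLetter, letterFun, pow_val_add hξ, neg_sub, zpow_sub₀ hm', zpow_natCast,
          mul_pow, pow_succ, ← hζ]
        field_simp
      have h2 : theta (posLetter ξ m) (evl ξ (m + 1) (sumExpr ξ ((n, a) :: v) c (Int.ofNat t))) =
          (ζ ^ (m + 1) * R.eval (m : K)) • Finsupp.single ((n, a) :: v) 1 +
          (ζ ^ (m + 1) * R.eval (m : K) * posLetter ξ m (n, a)) • Finsupp.single v 1 -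
          ∑ i ∈ R.support, ((ζ * R.coeff i) • evl ξ m (sumExpr ξ v (a + c) ((i : ℤ) - (n : ℤ))) +
            ((ζ * R.coeff i) * letterFun ξ (-((i : ℤ) - (n : ℤ)), a + c) m) •
              Finsupp.single v 1) := by
        rw [sumExpr_cons_ofNat, map_sub, map_sub, evl_polynomial_sum, map_sum, map_sum, map_smul,
          theta_single, thetaAux_cons, ← hζ, ← hR]
        simp only [map_smul, ih, smul_add, smul_smul]
        rw [hR, eval_comp]
        simp
      rw [h2, Finset.sum_add_distrib, ← Finset.sum_smul, h1, sumExpr_cons_ofNat, map_sub,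
        evl_polynomial_sum, map_sum, ← hζ, ← hR]
      simp only [map_smul]
      have h3 : letterFun ξ (-(Int.ofNat t), c) m = ζ ^ m * (m : K) ^ t := by
        simp [letterFun, hζ]
      rw [h3, pow_succ, mul_assoc, hRm]
      module
    · simp [sumExpr, evl_single, theta_single, posLetter]

/-- At m = 1 the range 0 < k < 1 is empty; the constant -ζ Q(1) in `sumExpr` is what makes the
expression vanish there. -/
theorem sumExpr_evl_one_nil (ξ : K) (v : List (ℕ+ × ZMod N)) (c : ZMod N) (t : ℤ) :
    evl ξ 1 (sumExpr ξ v c t) [] = 0 := by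
  induction v generalizing c t with
  | nil =>
    rcases t with t | s
    · simp only [sumExpr, map_sub, evl_polynomial_sum, evl_single]
      simp
    · simp [sumExpr, evl_single]
  | cons x v ih =>
    obtain ⟨n, a⟩ := x
    rcases t with t | s
    · rw [sumExpr_cons_ofNat, map_sub, evl_polynomial_sum, map_sum]
      simp only [map_smul, Finsupp.sub_apply, Finsupp.finsetSum_apply, Finsupp.smul_apply, ih]
      simp
    · simp [sumExpr, evl_single]

theorem theta_evl_locExpr [NeZero N] {ξ : K} (hξ : ξ ^ N = 1) {m : ℕ} (hm : m ≠ 0)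
    (x : ℤ × ZMod N) (V : List (ℤ × ZMod N)) :
    theta (posLetter ξ m) (evl ξ (m + 1) (locExpr ξ (x :: V))) =
      evl ξ m (locExpr ξ (x :: V)) + letterFun ξ x m • evl ξ m (locExpr ξ V) := by
  have hm' : (m : K) ≠ 0 := by exact_mod_cast hm
  obtain ⟨n, a⟩ := x
  have h : evl ξ m (locExpr ξ V) = (locExpr ξ V).sum fun x y =>
      (y * ((ξ ^ x.1.val) ^ m * (m : K) ^ x.2.1)) • Finsupp.single x.2.2 1 := by
    conv_lhs => rw [← Finsupp.sum_single (locExpr ξ V)]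
    simp only [Finsupp.sum, map_sum, evl_single]
  rw [h]
  simp only [locExpr, Finsupp.sum, map_sum, map_smul, theta_evl_sumExpr hξ hm, Finset.smul_sum,
    ← Finset.sum_add_distrib, smul_add, smul_smul]
  refine Finset.sum_congr rfl fun y _ => ?_
  congr 2
  simp only [letterFun, pow_val_add hξ, neg_sub, zpow_sub₀ hm', zpow_natCast, mul_pow]
  field_simp

theorem theta_evl_locExpr_nil (ξ : K) (m : ℕ) (χ : ℕ+ × ZMod N → K) :
    theta χ (evl ξ (m + 1) (locExpr ξ [])) = evl ξ m (locExpr ξ ([] : List (ℤ × ZMod N))) := by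
  simp [locExpr, evl_single, theta_single]

theorem locExpr_evl_one_nil (ξ : K) (V : List (ℤ × ZMod N)) :
    evl ξ 1 (locExpr ξ V) [] = if V = [] then 1 else 0 := by
  rcases V with _ | ⟨x, V⟩
  · simp [locExpr, evl_single]
  · simp [locExpr, Finsupp.sum, sumExpr_evl_one_nil, Finsupp.finsetSum_apply]

end Loc

/-! ### Norms of the coefficients of `loc` -/

section Padic

open Polynomial

/-- By von Staudt–Clausen an even Bernoulli number is an integer minus a sum of inverses of distinct
primes, among which only 1/p can have norm greater than 1. -/
theorem padicNorm_bernoulli_le (p : ℕ) [hp : Fact p.Prime] (k : ℕ) :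
    padicNorm p (_root_.bernoulli k) ≤ p := by
  have hp1 : (1 : ℚ) ≤ p := by exact_mod_cast hp.out.one_le
  have hinv : ∀ r : ℕ, r.Prime → padicNorm p (1 / (r : ℚ)) ≤ p := by
    intro r hr
    by_cases h : r = p
    · subst h
      rw [padicNorm.div, padicNorm.one, padicNorm.padicNorm_p hp.out.one_lt]
      simp
    · have : Fact r.Prime := ⟨hr⟩
      rw [padicNorm.div, padicNorm.one, padicNorm.padicNorm_of_prime_of_ne (Ne.symm h)]
      simpa using hp1
  rcases Nat.even_or_odd' k with ⟨j, rfl | rfl⟩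
  · obtain ⟨z, hz⟩ := Bernoulli.vonStaudt_clausen j
    rw [eq_sub_of_add_eq hz.symm]
    refine (padicNorm.sub (p := p)).trans (max_le ((padicNorm.of_int z).trans hp1) ?_)
    exact padicNorm.sum_le' (fun r hr => hinv r (Finset.mem_filter.1 hr).2.1) (by positivity)
  · rcases Nat.eq_zero_or_pos j with rfl | hj
    · have := hinv 2 Nat.prime_two
      rw [mul_zero, zero_add, _root_.bernoulli_one, neg_div, padicNorm.neg]
      exact_mod_cast this
    · rw [bernoulli_eq_zero_of_odd ⟨j, rfl⟩ (by lia), padicNorm.zero]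
      positivity

variable {p : ℕ} {K : Type*} [NormedField K]

theorem norm_ratCast_eq_padicNorm [Fact p.Prime] [NormedAlgebra ℚ_[p] K] (x : ℚ) : ‖(x : K)‖ = padicNorm p x := by
  have h : (x : K) = algebraMap ℚ_[p] K x := by simp
  rw [h, norm_algebraMap', Padic.eq_padicNorm]

theorem isUltrametricDist_of_padicNorm [Fact p.Prime] (hK : ∀ x : ℚ, ‖(x : K)‖ = padicNorm p x) :
    IsUltrametricDist K := by
  apply IsUltrametricDist.isUltrametricDist_of_forall_norm_natCast_le_one
  intro n
  have := hK n
  rw [Rat.cast_natCast] at this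
  rw [this]
  exact_mod_cast padicNorm.of_nat n

theorem norm_inv_natCast_le (hK : ∀ x : ℚ, ‖(x : K)‖ = padicNorm p x) {n : ℕ} (hn : n ≠ 0) :
    ‖(n : K)‖⁻¹ ≤ n := by
  have := hK n
  rw [Rat.cast_natCast] at this
  have h2 : (p : ℝ) ^ padicValNat p n ≤ n := by
    exact_mod_cast Nat.le_of_dvd (Nat.pos_of_ne_zero hn) (pow_padicValNat_dvd (p := p) (n := n))
  rw [this, padicNorm.eq_zpow_of_nonzero (by exact_mod_cast hn), padicValRat.of_nat]
  simpa using h2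

variable [Fact p.Prime]

theorem norm_bernoulli_le (hK : ∀ x : ℚ, ‖(x : K)‖ = padicNorm p x) (k : ℕ) :
    ‖((_root_.bernoulli k : ℚ) : K)‖ ≤ p := by
  rw [hK]
  exact_mod_cast padicNorm_bernoulli_le p k

/-- Integral coefficients have norm at most 1, which is all that the case ζ ≠ 1 of `antidiff` needs.
-/
theorem exists_int_fwdDiff_iterate (K : Type*) [Field K] (t k : ℕ) :
    ∃ P : ℤ[X], P.natDegree ≤ t ∧
      (fun P : K[X] => P.comp (X + 1) - P)^[k] (X ^ t) = P.map (Int.castRingHom K) := by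
  induction k with
  | zero => exact ⟨X ^ t, by simp, by simp⟩
  | succ k ih =>
    obtain ⟨P, hP, h⟩ := ih
    refine ⟨P.comp (X + 1) - P, ?_, ?_⟩
    · refine (natDegree_sub_le _ _).trans (max_le ?_ hP)
      rw [natDegree_comp, ← C_1, natDegree_X_add_C, mul_one]
      exact hP
    · rw [Function.iterate_succ_apply', h]
      simp [Polynomial.map_comp]

theorem natDegree_antidiff_le [CharZero K] (ζ : K) (t : ℕ) :
    (antidiff ζ t).natDegree ≤ t + 1 := by
  unfold antidiff
  split_ifs with h
  · refine (natDegree_C_mul_le _ _).trans (natDegree_map_le.trans ?_)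
    refine natDegree_le_iff_coeff_eq_zero.2 fun i hi => ?_
    rw [Polynomial.coeff_bernoulli, if_neg (by lia)]
  · refine natDegree_sum_le_of_forall_le _ _ fun k _ => ?_
    obtain ⟨P, hP, hk⟩ := exists_int_fwdDiff_iterate K t k
    rw [hk]
    exact (natDegree_C_mul_le _ _).trans (natDegree_map_le.trans (hP.trans (Nat.le_succ t)))

variable [CharZero K] [IsUltrametricDist K]

/-- For ζ = 1 the factor p comes from the Bernoulli numbers and t + 1 from the division by t + 1.
For ζ ≠ 1 the only denominators are powers of the unit ζ - 1. The growth in t is at most linear in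
both cases. -/
theorem norm_coeff_antidiff_le (hK : ∀ x : ℚ, ‖(x : K)‖ = padicNorm p x) {ζ : K}
    (h1 : ‖ζ‖ = 1) (h2 : ζ = 1 ∨ ‖ζ - 1‖ = 1) (t i : ℕ) :
    ‖(antidiff ζ t).coeff i‖ ≤ p * ((t : ℝ) + 1) := by
  have hp1 : (1 : ℝ) ≤ p := by exact_mod_cast (Fact.out : p.Prime).one_le
  have h3 := norm_inv_natCast_le hK (Nat.succ_ne_zero t)
  push_cast at h3
  unfold antidiff
  split_ifs with h
  · rw [coeff_C_mul, coeff_map, norm_mul, mul_comm, norm_div, norm_one, one_div]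
    refine mul_le_mul ?_ h3 (by positivity) (by positivity)
    rw [Polynomial.coeff_bernoulli]
    split_ifs
    · simp only [map_mul, eq_ratCast, norm_mul, Rat.cast_natCast]
      calc _ ≤ (p : ℝ) * 1 := mul_le_mul (norm_bernoulli_le hK _)
            (IsUltrametricDist.norm_natCast_le_one K _) (norm_nonneg _) (by positivity)
        _ = p := mul_one _
    · simp
  · have h4 : ‖ζ - 1‖ = 1 := h2.resolve_left h
    rw [finsetSum_coeff]
    refine IsUltrametricDist.norm_sum_le_of_forall_le_of_nonneg (by positivity) fun k _ => ?_
    obtain ⟨P, -, hk⟩ := exists_int_fwdDiff_iterate K t k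
    rw [hk, coeff_C_mul, coeff_map, norm_mul, norm_div, norm_pow, norm_pow, norm_neg, h1, h4,
      one_pow, one_pow, div_one, one_mul]
    refine (IsUltrametricDist.norm_intCast_le_one K _).trans ?_
    nlinarith [(Nat.cast_nonneg t : (0 : ℝ) ≤ t)]

-- The product of the 1 - ξ^j over 0 < j < N equals N, which has norm 1 since p does not divide N.
-- Each factor has norm at most 1, hence exactly 1.
omit [CharZero K] in
theorem norm_sub_one_of_pow_eq_one (hK : ∀ x : ℚ, ‖(x : K)‖ = padicNorm p x) {N : ℕ}
    (hN : p.Coprime N) {ξ : K} (hξ : IsPrimitiveRoot ξ N) (k : ℕ) :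
    ξ ^ k = 1 ∨ ‖ξ ^ k - 1‖ = 1 := by
  obtain ⟨n, rfl⟩ : ∃ n, N = n + 1 := by
    refine Nat.exists_eq_succ_of_ne_zero ?_
    rintro rfl
    exact (Fact.out : p.Prime).one_lt.ne' (by simpa using hN)
  have hN1 : ‖((n + 1 : ℕ) : K)‖ = 1 := by
    have h := hK (n + 1 : ℕ)
    rw [Rat.cast_natCast, (padicNorm.nat_eq_one_iff _).2
      ((Nat.Prime.coprime_iff_not_dvd Fact.out).1 hN)] at h
    simpa using h
  have hξ1 : ‖ξ‖ = 1 := by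
    refine (pow_eq_one_iff_of_nonneg (norm_nonneg ξ) n.succ_ne_zero).1 ?_
    rw [← norm_pow, hξ.pow_eq_one, norm_one]
  have hle : ∀ j, ‖1 - ξ ^ j‖ ≤ 1 := by
    intro j
    rw [sub_eq_add_neg]
    refine (IsUltrametricDist.norm_add_le_max _ _).trans ?_
    simp [hξ1]
  by_cases hk : k % (n + 1) = 0
  · left
    rw [pow_eq_pow_mod k hξ.pow_eq_one, hk, pow_zero]
  · right
    rw [pow_eq_pow_mod k hξ.pow_eq_one, norm_sub_rev]
    have hmem : k % (n + 1) - 1 ∈ Finset.range n := by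
      have := Nat.mod_lt k (Nat.succ_pos n)
      rw [Finset.mem_range]
      lia
    have hprod := congrArg norm hξ.prod_one_sub_pow_eq_order
    rw [norm_prod, ← Finset.mul_prod_erase _ _ hmem, Nat.sub_add_cancel (Nat.pos_of_ne_zero hk)]
      at hprod
    push_cast at hN1
    rw [hN1] at hprod
    refine le_antisymm (hle _) ?_
    rw [← hprod]
    exact mul_le_of_le_one_right (norm_nonneg _)
      (Finset.prod_le_one (fun _ _ => norm_nonneg _) fun _ _ => hle _)

/-! ### Bounds for expressions -/

variable {N : ℕ}

/-- The sum of the exponents of a sequence with positive exponents. -/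
def posWeight (v : List (ℕ+ × ZMod N)) : ℕ := (v.map fun x => (x.1 : ℕ)).sum

/-- The coefficients have norm at most `C`, and the terms `ξ^{cm} m^t 𝔥(v)` with nonzero
coefficient have `t ≤ T`, `v` of length at most `d` and weight at most `W`. -/
def ExprBound (C : ℝ) (T d W : ℕ) (x : Expr K N) : Prop :=
  (∀ y, ‖x y‖ ≤ C) ∧ ∀ y, x y ≠ 0 → y.2.1 ≤ T ∧ y.2.2.length ≤ d ∧ posWeight y.2.2 ≤ W

namespace ExprBound

variable {C C' : ℝ} {T T' d d' W W' : ℕ} {x z : Expr K N}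

omit [CharZero K] [IsUltrametricDist K] in
theorem mono (h : ExprBound C T d W x) (hC : C ≤ C') (hT : T ≤ T') (hd : d ≤ d') (hW : W ≤ W') :
    ExprBound C' T' d' W' x :=
  ⟨fun y => (h.1 y).trans hC, fun y hy => by
    obtain ⟨h1, h2, h3⟩ := h.2 y hy
    exact ⟨h1.trans hT, h2.trans hd, h3.trans hW⟩⟩

omit [CharZero K] in
theorem sum {ι : Type*} {s : Finset ι} {f : ι → Expr K N} (hC : 0 ≤ C)
    (h : ∀ i ∈ s, ExprBound C T d W (f i)) : ExprBound C T d W (∑ i ∈ s, f i) := by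
  refine ⟨fun y => ?_, fun y hy => ?_⟩
  · rw [Finsupp.finsetSum_apply]
    exact IsUltrametricDist.norm_sum_le_of_forall_le_of_nonneg hC fun i hi => (h i hi).1 y
  · rw [Finsupp.finsetSum_apply] at hy
    obtain ⟨i, hi, h'⟩ := Finset.exists_ne_zero_of_sum_ne_zero hy
    exact (h i hi).2 y h'

omit [CharZero K] in
theorem sub (h : ExprBound C T d W x) (h' : ExprBound C T d W z) : ExprBound C T d W (x - z) := by
  refine ⟨fun y => ?_, fun y hy => ?_⟩
  · rw [Finsupp.sub_apply, sub_eq_add_neg]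
    exact (IsUltrametricDist.norm_add_le_max _ _).trans
      (max_le (h.1 y) ((norm_neg (z y)).trans_le (h'.1 y)))
  · by_cases hx : x y = 0
    · exact h'.2 y fun hz => hy (by simp [hx, hz])
    · exact h.2 y hx

omit [CharZero K] [IsUltrametricDist K] in
theorem smul (h : ExprBound C T d W x) {a : K} (ha : ‖a‖ ≤ C') :
    ExprBound (C' * C) T d W (a • x) := by
  refine ⟨fun y => ?_, fun y hy => h.2 y fun hx => hy (by simp [hx])⟩
  rw [Finsupp.smul_apply, smul_eq_mul, norm_mul]
  exact mul_le_mul ha (h.1 y) (norm_nonneg _) ((norm_nonneg a).trans ha)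

omit [CharZero K] [IsUltrametricDist K] in
theorem single {y : ZMod N × ℕ × List (ℕ+ × ZMod N)} {a : K} (ha : ‖a‖ ≤ C) (hT : y.2.1 ≤ T)
    (hd : y.2.2.length ≤ d) (hW : posWeight y.2.2 ≤ W) :
    ExprBound C T d W (Finsupp.single y a) := by
  refine ⟨fun z => ?_, fun z hz => ?_⟩
  · by_cases h : y = z
    · simpa [← h] using ha
    · simpa [Finsupp.single_apply, h] using (norm_nonneg a).trans ha
  · by_cases h : y = z
    · exact h ▸ ⟨hT, hd, hW⟩
    · simp [h] at hz

end ExprBound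

/-- Each summation by parts costs one factor A. The same A serves at every level: `antidiff` raises
the degree by at most one, and the exponent n ≥ 1 of the next letter takes it back. -/
theorem exprBound_sumExpr (hK : ∀ x : ℚ, ‖(x : K)‖ = padicNorm p x) (hN : p.Coprime N)
    {ξ : K} (hξ : IsPrimitiveRoot ξ N) (hξ1 : ‖ξ‖ = 1) (v : List (ℕ+ × ZMod N)) (c : ZMod N) (t : ℤ)
    {A : ℝ} (hA : p * ((t.toNat : ℝ) + 1) ≤ A) :
    ExprBound (A ^ (v.length + 1)) (t + 1).toNat (v.length + 1) (posWeight v + (-t).toNat)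
      (sumExpr ξ v c t) := by
  have hp1 : (1 : ℝ) ≤ p := by exact_mod_cast (Fact.out : p.Prime).one_le
  have hA1 : 1 ≤ A := by
    refine le_trans ?_ hA
    nlinarith [(Nat.cast_nonneg t.toNat : (0 : ℝ) ≤ t.toNat)]
  have hpow : ∀ k, (1 : ℝ) ≤ A ^ k := fun k => one_le_pow₀ hA1
  have hζ1 : ∀ c : ZMod N, ‖ξ ^ c.val‖ = 1 := fun c => by rw [norm_pow, hξ1, one_pow]
  have hpoly : ∀ (c : ZMod N) (t : ℕ) (v : List (ℕ+ × ZMod N)), p * ((t : ℝ) + 1) ≤ A →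
      ExprBound A (t + 1) v.length (posWeight v)
        ((antidiff (ξ ^ c.val) t).sum fun i y => Finsupp.single (c, i, v) y) := by
    intro c t v ht
    refine ExprBound.sum (zero_le_one.trans hA1) fun i hi => ExprBound.single ?_ ?_ le_rfl le_rfl
    · exact (norm_coeff_antidiff_le hK (hζ1 c) (norm_sub_one_of_pow_eq_one hK hN hξ _) t i).trans ht
    · exact (le_natDegree_of_mem_supp i hi).trans (natDegree_antidiff_le _ t)
  have hnormeval : ∀ (c : ZMod N) (t : ℕ), p * ((t : ℝ) + 1) ≤ A → ‖(antidiff (ξ ^ c.val) t).eval 1‖ ≤ A := by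
    intro c t ht
    rw [eval_eq_sum, Polynomial.sum]
    refine IsUltrametricDist.norm_sum_le_of_forall_le_of_nonneg (zero_le_one.trans hA1)
      fun i _ => ?_
    rw [one_pow, mul_one]
    exact (norm_coeff_antidiff_le hK (hζ1 c) (norm_sub_one_of_pow_eq_one hK hN hξ _) t i).trans ht
  induction v generalizing c t with
  | nil =>
    rcases t with t | s
    · have ht : p * ((t : ℝ) + 1) ≤ A := by simpa using hA
      rw [sumExpr]
      refine ExprBound.sub ((hpoly c t [] ht).mono (by simp) ?_ (by simp) (by simp))
        (ExprBound.single ?_ (by simp) (by simp) (by simp [posWeight]))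
      · simp only [Int.ofNat_eq_natCast]
        lia
      · rw [norm_mul, hζ1 c, one_mul, List.length_nil, zero_add, pow_one]
        exact hnormeval c t ht
    · refine ExprBound.single ?_ (by simp) (by simp) ?_
      · simpa using hA1
      · simp [posWeight]
  | cons x v ih =>
    obtain ⟨n, a⟩ := x
    have hn := n.pos
    have hW : posWeight ((n, a) :: v) = n + posWeight v := by simp [posWeight]
    rcases t with t | s
    · have ht : p * ((t : ℝ) + 1) ≤ A := by simpa using hA
      have hζ2 := norm_sub_one_of_pow_eq_one hK hN hξ c.val
      rw [sumExpr_cons_ofNat]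
      refine ExprBound.sub ((hpoly c t _ ht).mono ?_ ?_ (by simp) (by simp)) (ExprBound.sum
        (by positivity) fun i hi => ?_)
      · exact le_self_pow₀ hA1 (by simp)
      · simp only [Int.ofNat_eq_natCast]
        lia
      have hi' : i ≤ t + 1 := by
        refine (le_natDegree_of_mem_supp i hi).trans ?_
        rw [natDegree_comp, ← C_1, natDegree_X_add_C, mul_one]
        exact natDegree_antidiff_le _ t
      have hcoeff : ‖ξ ^ c.val * ((antidiff (ξ ^ c.val) t).comp (X + 1)).coeff i‖ ≤ A := by
        -- By the difference equation ζ Q(X + 1) is Q + X^t, so the bound on the coefficients of Q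
        -- suffices.
        rw [← coeff_C_mul, eq_add_of_sub_eq (antidiff_spec (ξ ^ c.val) t), coeff_add, add_comm]
        refine (IsUltrametricDist.norm_add_le_max _ _).trans (max_le
          ((norm_coeff_antidiff_le hK (hζ1 c) hζ2 t i).trans ht) ?_)
        rw [coeff_X_pow]
        split_ifs
        · simpa using hA1
        · simpa using zero_le_one.trans hA1
      have htn : ((i : ℤ) - n).toNat ≤ t := by lia
      have htn' : (((i : ℤ) - n).toNat : ℝ) ≤ t := by exact_mod_cast htn
      refine ((ih (a + c) ((i : ℤ) - n) (le_trans ?_ ht)).smul hcoeff).mono ?_ ?_ ?_ ?_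
      · gcongr
      · rw [List.length_cons, pow_succ' A (v.length + 1)]
      · simp only [Int.ofNat_eq_natCast]
        lia
      · simp
      · simp only [Int.ofNat_eq_natCast]
        lia
    · refine ExprBound.single ?_ (by simp) (by simp) ?_
      · simpa using hpow _
      · simp [posWeight, add_comm]

/-- The sum of the absolute values of the negative exponents. -/
def negPart (V : List (ℤ × ZMod N)) : ℕ := (V.map fun x => (-x.1).toNat).sum

/-- The sum of the positive exponents. -/
def posPart (V : List (ℤ × ZMod N)) : ℕ := (V.map fun x => x.1.toNat).sum

/-- A new letter raises the power of m by at most 1 plus the negative part of its exponent, and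
costs at most A^(|V| + 1). The exponents of A add up to at most |V|^2, so for bounded length the
bound is polynomial in `negPart V`. -/
theorem exprBound_locExpr (hK : ∀ x : ℚ, ‖(x : K)‖ = padicNorm p x) (hN : p.Coprime N)
    {ξ : K} (hξ : IsPrimitiveRoot ξ N) (hξ1 : ‖ξ‖ = 1) (V : List (ℤ × ZMod N))
    {A : ℝ} (hA : p * ((negPart V + V.length : ℕ) + 1 : ℝ) ≤ A) :
    ExprBound (A ^ (V.length ^ 2)) (negPart V + V.length) V.length (posPart V) (locExpr ξ V) := by
  have hp1 : (1 : ℝ) ≤ p := by exact_mod_cast (Fact.out : p.Prime).one_le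
  have hA1 : 1 ≤ A := by
    refine le_trans ?_ hA
    nlinarith [(Nat.cast_nonneg (negPart V + V.length) : (0 : ℝ) ≤ _)]
  induction V with
  | nil => exact ExprBound.single (by simp) (by simp) (by simp) (by simp [posWeight])
  | cons x V ih =>
    obtain ⟨n, a⟩ := x
    have h1 : negPart ((n, a) :: V) = (-n).toNat + negPart V := by simp [negPart]
    have h2 : posPart ((n, a) :: V) = n.toNat + posPart V := by simp [posPart]
    have h3 : ((n, a) :: V).length = V.length + 1 := rfl
    have hV := ih (le_trans (by gcongr <;> lia) hA)
    rw [locExpr, Finsupp.sum]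
    refine ExprBound.sum (by positivity) fun y hy => ?_
    obtain ⟨hT, hd, hW⟩ := hV.2 y (Finsupp.mem_support_iff.1 hy)
    have ht : ((y.2.1 : ℤ) - n).toNat ≤ negPart ((n, a) :: V) + ((n, a) :: V).length := by lia
    refine ((exprBound_sumExpr hK hN hξ hξ1 y.2.2 (a + y.1) ((y.2.1 : ℤ) - n)
      (le_trans (by gcongr) hA)).smul (hV.1 y)).mono ?_ ?_ ?_ ?_
    · rw [← pow_add]
      refine pow_le_pow_right₀ hA1 ?_
      rw [h3]
      nlinarith
    all_goals lia

end Padic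

/-! ### Power series expansions of blocks -/

section PowerSeries

open PowerSeries

theorem sum_antidiagonalTuple_succ {M : Type*} [AddCommMonoid M] (k n : ℕ)
    (F : (Fin (k + 1) → ℕ) → M) :
    ∑ l ∈ Finset.Nat.antidiagonalTuple (k + 1) n, F l =
      ∑ ij ∈ Finset.HasAntidiagonal.antidiagonal n, ∑ l ∈ Finset.Nat.antidiagonalTuple k ij.2,
        F (Fin.cons ij.1 l) := by
  rw [Finset.sum_sigma']
  refine Finset.sum_bij' (fun (l : Fin (k + 1) → ℕ) _ => ⟨(l 0, ∑ i, l (Fin.succ i)), Fin.tail l⟩)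
    (fun x _ => Fin.cons x.1.1 x.2) ?_ ?_ ?_ ?_ ?_
  · intro l hl
    rw [Finset.Nat.mem_antidiagonalTuple, Fin.sum_univ_succ] at hl
    simp [Finset.Nat.mem_antidiagonalTuple, hl, Fin.tail]
  · rintro ⟨⟨i, j⟩, l⟩ hx
    simp only [Finset.mem_sigma, Finset.HasAntidiagonal.mem_antidiagonal, Finset.Nat.mem_antidiagonalTuple] at hx
    rw [Finset.Nat.mem_antidiagonalTuple, Fin.sum_univ_succ]
    simp [hx.1, hx.2]
  · intro l _
    simp
  · rintro ⟨⟨i, j⟩, l⟩ hx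
    simp only [Finset.mem_sigma, Finset.HasAntidiagonal.mem_antidiagonal, Finset.Nat.mem_antidiagonalTuple] at hx
    simp [hx.2]
  · intro l _
    simp

variable {K : Type*} [Field K] {N : ℕ}

/-- The expansion in powers of `u` of `ξ^{ar} (q u + r)^{-n}`, for `r ≠ 0`. -/
def letterPS (ξ : K) (q : ℕ) (x : ℤ × ZMod N) (r : ℕ) : K⟦X⟧ :=
  if r = 0 then 0 else
    PowerSeries.mk fun s => (q : K) ^ s * (((Ring.choose (-x.1) s : ℤ) : K) *
      letterFun ξ (x.1 + (s : ℤ), x.2) r)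

/-- Multiplying power series spreads the total exponent s over the letters. A block coefficient is
thus a coefficient of a single nested sum over the ring of power series, where decay and evaluation
can be checked letter by letter. -/
theorem coeff_nestSum_letterPS (ξ : K) (q : ℕ) (B : List (ℤ × ZMod N)) (s M : ℕ) :
    coeff s (nestSum (letterPS ξ q) B M) =
      (q : K) ^ s * ∑ l ∈ Finset.Nat.antidiagonalTuple B.length s,
        (((∏ i, Ring.choose (-(B.get i).1) (l i) : ℤ)) : K) *
          nestedSum ξ (List.ofFn fun i => ((B.get i).1 + (l i : ℤ), (B.get i).2)) M := by
  induction B generalizing s M with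
  | nil =>
    rcases s with _ | s
    · simp [nestedSum]
    · simp [PowerSeries.coeff_one]
  | cons x B ih =>
    have h : ∀ l : Fin (B.length + 1) → ℕ, List.ofFn (fun i : Fin (x :: B).length =>
        (((x :: B).get i).1 + (l i : ℤ), ((x :: B).get i).2)) =
        (x.1 + (l 0 : ℤ), x.2) :: List.ofFn fun i : Fin B.length =>
          ((B.get i).1 + (l i.succ : ℤ), (B.get i).2) := fun l => List.ofFn_succ
    rw [nestSum_cons, map_sum]
    simp only [PowerSeries.coeff_mul, ih]
    refine Eq.trans ?_ (congrArg ((q : K) ^ s * ·) (sum_antidiagonalTuple_succ B.length s _).symm)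
    rw [Finset.sum_comm, Finset.mul_sum]
    refine Finset.sum_congr rfl fun ij hij => ?_
    rw [← Finset.HasAntidiagonal.mem_antidiagonal.1 hij, Finset.mul_sum]
    simp only [Finset.mul_sum]
    rw [Finset.sum_comm]
    refine Finset.sum_congr rfl fun l _ => ?_
    rw [h, nestedSum_eq_nestSum, nestSum_cons]
    simp only [← nestedSum_eq_nestSum, Finset.mul_sum]
    refine Finset.sum_congr rfl fun r _ => ?_
    have hp : (∏ i : Fin (x :: B).length, Ring.choose (-((x :: B).get i).1)
        ((Fin.cons ij.1 l : Fin (B.length + 1) → ℕ) i) : ℤ) =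
        Ring.choose (-x.1) ij.1 * ∏ i : Fin B.length, Ring.choose (-(B.get i).1) (l i) :=
      Fin.prod_univ_succ _
    rw [hp]
    by_cases hr : r = 0
    · simp [hr, letterPS]
    · simp only [letterPS, if_neg hr, PowerSeries.coeff_mk, Fin.cons_zero, Fin.cons_succ]
      push_cast
      ring

theorem blockCoeff_eq_coeff [CharZero K] (ξ : K) (q : ℕ) (B : List (ℤ × ZMod N)) (s : ℕ) :
    blockCoeff ξ q B s = coeff s (nestSum (letterPS ξ q) B q) :=
  (coeff_nestSum_letterPS ξ q B s q).symm

end PowerSeries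

/-! ### Decay and evaluation of power series over an ultrametric field. -/

section Padic

open PowerSeries

variable {K : Type*} [NormedField K]

/-- Power series whose coefficients decay at least like `ρ ^ s`. -/
def Decay (ρ : ℝ) (f : K⟦X⟧) : Prop := ∃ C, 0 ≤ C ∧ ∀ s, ‖coeff s f‖ ≤ C * ρ ^ s

/-- The power series `f` converges at `u` with sum `y`. -/
def HasEval (f : K⟦X⟧) (u y : K) : Prop := HasSum (fun s => coeff s f * u ^ s) y

variable {ρ : ℝ} {f g : K⟦X⟧} {u y z : K}

theorem HasEval.sum {ι : Type*} {s : Finset ι} {f : ι → K⟦X⟧} {y : ι → K}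
    (h : ∀ i ∈ s, HasEval (f i) u (y i)) : HasEval (∑ i ∈ s, f i) u (∑ i ∈ s, y i) := by
  simpa only [HasEval, map_sum, Finset.sum_mul] using hasSum_sum h

theorem hasEval_zero (u : K) : HasEval (0 : K⟦X⟧) u 0 := by
  simp [HasEval, hasSum_zero]

theorem hasEval_one (u : K) : HasEval (1 : K⟦X⟧) u 1 := by
  have : (fun s => coeff s (1 : K⟦X⟧) * u ^ s) = fun s => if s = 0 then (1 : K) else 0 := by
    funext s
    by_cases h : s = 0 <;> simp [PowerSeries.coeff_one, h]
  rw [HasEval, this]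
  exact hasSum_ite_eq 0 1

theorem decay_one (hρ : 0 ≤ ρ) : Decay ρ (1 : K⟦X⟧) := by
  refine ⟨1, zero_le_one, fun s => ?_⟩
  by_cases h : s = 0
  · simp [h]
  · simpa [PowerSeries.coeff_one, h] using pow_nonneg hρ s

variable [IsUltrametricDist K]

theorem nonarchimedeanRing_of_ultrametric (K : Type*) [NormedField K] [IsUltrametricDist K] :
    NonarchimedeanRing K where
  is_nonarchimedean := NonarchimedeanAddGroup.is_nonarchimedean

/-- In the nonarchimedean setting the products of two summable families are summable over all pairs;
grouping by antidiagonals gives the Cauchy product. -/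
theorem HasEval.mul (hf : HasEval f u y) (hg : HasEval g u z) : HasEval (f * g) u (y * z) := by
  have := nonarchimedeanRing_of_ultrametric K
  have h := (Finset.HasAntidiagonal.sigmaAntidiagonalEquivProd.hasSum_iff).2 (hf.mul_of_nonarchimedean hg)
  have h2 := h.sigma fun n => hasSum_fintype _
  have h3 : ∀ n, coeff n (f * g) * u ^ n = ∑ b : Finset.HasAntidiagonal.antidiagonal n,
      coeff b.1.1 f * u ^ b.1.1 * (coeff b.1.2 g * u ^ b.1.2) := by
    intro n
    rw [PowerSeries.coeff_mul, Finset.sum_mul, ← Finset.sum_coe_sort]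
    refine Finset.sum_congr rfl fun b _ => ?_
    have hb : u ^ n = u ^ b.1.1 * u ^ b.1.2 := by
      rw [← pow_add, Finset.HasAntidiagonal.mem_antidiagonal.1 b.2]
    rw [hb]
    ring
  rw [HasEval, funext h3]
  exact h2

theorem Decay.mul (hρ : 0 ≤ ρ) (hf : Decay ρ f) (hg : Decay ρ g) : Decay ρ (f * g) := by
  obtain ⟨C, hC, hf⟩ := hf
  obtain ⟨D, hD, hg⟩ := hg
  refine ⟨C * D, by positivity, fun s => ?_⟩
  rw [PowerSeries.coeff_mul]
  refine IsUltrametricDist.norm_sum_le_of_forall_le_of_nonneg (by positivity) fun ij hij => ?_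
  rw [← Finset.HasAntidiagonal.mem_antidiagonal.1 hij, norm_mul, pow_add]
  calc _ ≤ (C * ρ ^ ij.1) * (D * ρ ^ ij.2) :=
        mul_le_mul (hf _) (hg _) (norm_nonneg _) (by positivity)
    _ = _ := by ring

theorem Decay.sum (hρ : 0 ≤ ρ) {ι : Type*} {s : Finset ι} {f : ι → K⟦X⟧}
    (h : ∀ i ∈ s, Decay ρ (f i)) : Decay ρ (∑ i ∈ s, f i) := by
  choose! C hC hf using h
  refine ⟨∑ i ∈ s, C i, Finset.sum_nonneg hC, fun k => ?_⟩
  rw [map_sum]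
  refine IsUltrametricDist.norm_sum_le_of_forall_le_of_nonneg
    (mul_nonneg (Finset.sum_nonneg hC) (pow_nonneg hρ k)) fun i hi => (hf i hi k).trans ?_
  exact mul_le_mul_of_nonneg_right (Finset.single_le_sum hC hi) (pow_nonneg hρ k)

variable [CompleteSpace K]

/-- By Pascal's rule, raising k by one multiplies the series by 1 + x, as it does the power. Since 1
+ x is invertible, induction from k = 0 in both directions concludes. -/
theorem hasSum_choose_mul_pow {x : K} (hx : ‖x‖ < 1) (k : ℤ) :
    HasSum (fun s => ((Ring.choose k s : ℤ) : K) * x ^ s) ((1 + x) ^ k) := by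
  have hx1 : 1 + x ≠ 0 := by
    intro h
    rw [eq_neg_of_add_eq_zero_right h, norm_neg, norm_one] at hx
    exact lt_irrefl _ hx
  have hs : ∀ k : ℤ, Summable fun s => ((Ring.choose k s : ℤ) : K) * x ^ s := by
    intro k
    refine Summable.of_norm_bounded (summable_geometric_of_lt_one (norm_nonneg x) hx) fun s => ?_
    rw [norm_mul, norm_pow]
    exact mul_le_of_le_one_left (by positivity) (IsUltrametricDist.norm_intCast_le_one K _)
  have hrec : ∀ k : ℤ, ∑' s, ((Ring.choose (k + 1) s : ℤ) : K) * x ^ s =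
      (1 + x) * ∑' s, ((Ring.choose k s : ℤ) : K) * x ^ s := by
    intro k
    have h1 := (hs (k + 1)).tsum_eq_zero_add
    have h2 := (hs k).tsum_eq_zero_add
    have h3 : ∀ s, ((Ring.choose (k + 1) (s + 1) : ℤ) : K) * x ^ (s + 1) =
        x * (((Ring.choose k s : ℤ) : K) * x ^ s) +
          ((Ring.choose k (s + 1) : ℤ) : K) * x ^ (s + 1) := by
      intro s
      rw [Ring.choose_succ_succ]
      push_cast
      ring
    rw [tsum_congr h3, ((hs k).mul_left x).tsum_add ((summable_nat_add_iff 1).2 (hs k)),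
      tsum_mul_left] at h1
    simp only [Ring.choose_zero_right] at h1 h2
    rw [h1]
    linear_combination -h2
  have key : ∑' s, ((Ring.choose k s : ℤ) : K) * x ^ s = (1 + x) ^ k := by
    induction k with
    | zero =>
      rw [tsum_eq_single 0 fun s hs => by
        obtain ⟨s, rfl⟩ := Nat.exists_eq_succ_of_ne_zero hs
        simp [Ring.choose_zero_succ]]
      simp
    | succ i ih => rw [hrec, ih, zpow_add_one₀ hx1, mul_comm]
    | pred i ih =>
      have := hrec (-(i : ℤ) - 1)
      rw [sub_add_cancel, ih] at this
      rw [zpow_sub_one₀ hx1, this, mul_comm, ← mul_assoc, inv_mul_cancel₀ hx1, one_mul]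
  exact key ▸ (hs k).hasSum

/-! ### Convergence of the expansions of blocks -/

variable [CharZero K] {p : ℕ} [Fact p.Prime] {N : ℕ}

-- An r with 0 < r < p^α has p-adic valuation less than α, so p divides p^α / r.
omit [IsUltrametricDist K] [CompleteSpace K] in
theorem norm_pow_div_natCast_le (hK : ∀ x : ℚ, ‖(x : K)‖ = padicNorm p x) {α r : ℕ} (hr : r ≠ 0)
    (hrα : r < p ^ α) : ‖((p ^ α : ℕ) : K) / r‖ ≤ (p : ℝ)⁻¹ := by
  have hp : p.Prime := Fact.out
  have hp1 : (1 : ℝ) < p := by exact_mod_cast hp.one_lt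
  have hv : padicValNat p r < α :=
    (Nat.pow_lt_pow_iff_right hp.one_lt).1
      ((Nat.le_of_dvd (Nat.pos_of_ne_zero hr) pow_padicValNat_dvd).trans_lt hrα)
  have h1 := hK ((p ^ α : ℕ) / (r : ℚ))
  rw [padicNorm.div, padicNorm.eq_zpow_of_nonzero (q := (r : ℚ)) (by exact_mod_cast hr),
    padicValRat.of_nat, padicNorm.eq_zpow_of_nonzero (q := ((p ^ α : ℕ) : ℚ))
      (by exact_mod_cast (pow_pos hp.pos α).ne'), padicValRat.of_nat, padicValNat.prime_pow,
    Rat.cast_div, Rat.cast_natCast, Rat.cast_natCast] at h1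
  have hv' : (padicValNat p r : ℤ) < α := by exact_mod_cast hv
  rw [h1, Rat.cast_div, Rat.cast_zpow, Rat.cast_zpow, Rat.cast_natCast,
    ← zpow_sub₀ (by positivity), ← zpow_neg_one]
  exact zpow_le_zpow_right₀ hp1.le (by lia)

omit [Fact p.Prime] [CompleteSpace K] in
theorem decay_letterPS {ρ : ℝ} (ξ : K) {q r : ℕ} (h : r ≠ 0 → ‖(q : K) / r‖ ≤ ρ)
    (x : ℤ × ZMod N) : Decay ρ (letterPS ξ q x r) := by
  by_cases hr : r = 0
  · exact ⟨0, le_rfl, fun s => by simp [letterPS, hr]⟩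
  · have hr' : (r : K) ≠ 0 := by exact_mod_cast hr
    refine ⟨‖letterFun ξ x r‖, norm_nonneg _, fun s => ?_⟩
    have h1 : coeff s (letterPS ξ q x r) = ((Ring.choose (-x.1) s : ℤ) : K) *
        (letterFun ξ x r * ((q : K) / r) ^ s) := by
      rw [letterPS, if_neg hr, PowerSeries.coeff_mk, letterFun, letterFun, zpow_add₀ hr',
        zpow_natCast, div_pow]
      field_simp
    rw [h1, norm_mul, norm_mul, norm_pow]
    refine (mul_le_of_le_one_left (by positivity)
      (IsUltrametricDist.norm_intCast_le_one K _)).trans ?_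
    gcongr
    exact h hr

omit [CharZero K] [Fact p.Prime] [CompleteSpace K] in
theorem decay_nestSum {B : Type*} {ρ : ℝ} (hρ : 0 ≤ ρ) {φ : B → ℕ → K⟦X⟧} {M : ℕ}
    (h : ∀ x, ∀ r < M, Decay ρ (φ x r)) (V : List B) : Decay ρ (nestSum φ V M) := by
  induction V generalizing M with
  | nil => exact decay_one hρ
  | cons x V ih =>
    refine Decay.sum hρ fun r hr => ?_
    rw [Finset.mem_range] at hr
    exact (h x r hr).mul hρ (ih fun y s hs => h y s (hs.trans hr))

omit [CharZero K] [Fact p.Prime] [CompleteSpace K] in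
theorem hasEval_nestSum {B : Type*} {φ : B → ℕ → K⟦X⟧} {ψ : B → ℕ → K} {u : K} {M : ℕ}
    (h : ∀ x, ∀ r < M, HasEval (φ x r) u (ψ x r)) (V : List B) :
    HasEval (nestSum φ V M) u (nestSum ψ V M) := by
  induction V generalizing M with
  | nil => exact hasEval_one u
  | cons x V ih =>
    refine HasEval.sum fun r hr => ?_
    rw [Finset.mem_range] at hr
    exact (h x r hr).mul (ih fun y s hs => h y s (hs.trans hr))

omit [Fact p.Prime] in
theorem hasEval_letterPS (ξ : K) {q r : ℕ} (h : r ≠ 0 → ‖(q : K) / r‖ < 1) (u : ℕ)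
    (x : ℤ × ZMod N) : HasEval (letterPS ξ q x r) (u : K)
      (if r = 0 then 0 else (ξ ^ x.2.val) ^ r / ((q * u + r : ℕ) : K) ^ x.1) := by
  by_cases hr : r = 0
  · rw [letterPS, if_pos hr, if_pos hr]
    exact hasEval_zero _
  · have hr' : (r : K) ≠ 0 := by exact_mod_cast hr
    have hx : ‖(q : K) / r * u‖ < 1 := by
      rw [norm_mul]
      exact (mul_le_of_le_one_right (norm_nonneg _)
        (IsUltrametricDist.norm_natCast_le_one K u)).trans_lt (h hr)
    have h2 := (hasSum_choose_mul_pow hx (-x.1)).mul_left (letterFun ξ x r)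
    have h1 : ∀ s, coeff s (letterPS ξ q x r) * (u : K) ^ s = letterFun ξ x r *
        (((Ring.choose (-x.1) s : ℤ) : K) * ((q : K) / r * u) ^ s) := by
      intro s
      rw [letterPS, if_neg hr, PowerSeries.coeff_mk, letterFun, letterFun, zpow_add₀ hr',
        zpow_natCast, mul_pow, div_pow]
      field_simp
    have h3 : letterFun ξ x r * (1 + (q : K) / r * u) ^ (-x.1) =
        (ξ ^ x.2.val) ^ r / ((q * u + r : ℕ) : K) ^ x.1 := by
      have : 1 + (q : K) / r * u = ((q * u + r : ℕ) : K) / r := by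
        push_cast
        field_simp
        ring
      rw [this, letterFun, div_zpow, zpow_neg, zpow_neg]
      field_simp
    rw [HasEval, if_neg hr, ← h3]
    simpa only [h1] using h2

end Padic

/-! ### Blocks of indices with the same quotient, and their letters. -/

section Padic

variable {K : Type*} [NormedField K] {N : ℕ}

theorem HasSum.congr_of_eq {ι : Type*} {f g : ι → K} {a b : K} (h : HasSum f a)
    (hf : ∀ i, g i = f i) (hb : b = a) : HasSum g b := by
  rw [hb, funext hf]
  exact h

/-- The coefficient of the letter `(t, c)` in the expansion of the block `A`. -/
def blockLetter [CharZero K] (ξ : K) (q : ℕ) (A : List (ℤ × ZMod N)) (x : ℤ × ZMod N) : K :=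
  if x.2 = q • (A.map Prod.snd).sum then
    (if x.1 ≤ 0 then blockCoeff ξ q A (-x.1).toNat else 0) +
      match A.getLast? with
      | none => 0
      | some z => if x.1 ≤ z.1 then
          (q : K) ^ (-z.1) * blockCoeff ξ q A.dropLast (z.1 - x.1).toNat else 0
  else 0

/-- The value of the block `A` for the quotient `u`. -/
def blockVal (ξ : K) (q u : ℕ) (A : List (ℤ × ZMod N)) : K :=
  nestSum (fun x r => letterFun ξ x (q * u + r)) A q

/-- The letter of index i is the last of its block, hence carries the smallest summation variable:
it is the only one whose remainder may be 0. -/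
theorem actionCoeff_cons [CharZero K] (ξ : K) (q : ℕ) (L : List (ℤ × ZMod N)) (x : ℤ × ZMod N)
    (V : List (ℤ × ZMod N)) :
    actionCoeff ξ q L (x :: V) = ∑ i ∈ Finset.range L.length,
      blockLetter ξ q (L.take (i + 1)) x * actionCoeff ξ q (L.drop (i + 1)) V := by
  obtain ⟨t, c⟩ := x
  rw [actionCoeff, Finset.sum_range]
  refine Finset.sum_congr rfl fun i _ => ?_
  have h0 : L.take (i + 1) = L.take i ++ [L.get i] := by simp
  have h1 : (L.take (i + 1)).getLast? = some (L.get i) := by rw [h0, List.getLast?_concat]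
  have h2 : (L.take (i + 1)).dropLast = L.take i := by rw [h0, List.dropLast_concat]
  simp only [blockLetter, h1, h2, ite_mul, zero_mul]

theorem pow_val_nsmul [NeZero N] {ξ : K} (hξ : ξ ^ N = 1) (k : ℕ) (a : ZMod N) :
    ξ ^ (k • a).val = (ξ ^ a.val) ^ k := by
  induction k with
  | zero => simp
  | succ k ih => rw [succ_nsmul, pow_val_add hξ, ih, pow_succ]

theorem pow_val_list_sum [NeZero N] {ξ : K} (hξ : ξ ^ N = 1) (l : List (ZMod N)) :
    ξ ^ l.sum.val = (l.map fun a => ξ ^ a.val).prod := by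
  induction l with
  | nil => simp
  | cons a l ih => rw [List.sum_cons, pow_val_add hξ, ih, List.map_cons, List.prod_cons]

/-- The shift n accounts for a factor u^{-n} from a letter with remainder 0; the order s of the
expansion corresponds to the exponent t = n - s. -/
theorem hasSum_blockCoeff [CharZero K] [CompleteSpace K] [IsUltrametricDist K] (ξ : K) {q : ℕ}
    (h : ∀ r < q, r ≠ 0 → ‖(q : K) / r‖ < 1) {u : ℕ} (hu : u ≠ 0) (A : List (ℤ × ZMod N)) (n : ℤ) :
    HasSum (fun t : ℤ => if t ≤ n then blockCoeff ξ q A (n - t).toNat * (u : K) ^ (-t) else 0)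
      ((u : K) ^ (-n) * nestSum
        (fun x r => if r = 0 then 0 else (ξ ^ x.2.val) ^ r / ((q * u + r : ℕ) : K) ^ x.1) A q) := by
  have hu' : (u : K) ≠ 0 := by exact_mod_cast hu
  have h1 := hasEval_nestSum (φ := letterPS ξ q) (u := (u : K)) (M := q)
    (fun (x : ℤ × ZMod N) r hr => hasEval_letterPS ξ (h r hr) u x) A
  have hinj : Function.Injective fun s : ℕ => n - (s : ℤ) := fun a b hab => by simpa using hab
  rw [← hinj.hasSum_iff]
  · refine HasSum.congr_of_eq (h1.mul_left ((u : K) ^ (-n))) (fun s => ?_) rfl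
    have h2 : (n - (n - (s : ℤ))).toNat = s := by simp
    rw [Function.comp_apply, if_pos (by simp), h2, blockCoeff_eq_coeff, neg_sub, zpow_sub₀ hu',
      zpow_natCast, zpow_neg]
    ring
  · intro t ht
    rw [if_neg]
    intro htn
    exact ht ⟨(n - t).toNat, by simp [htn]⟩

/-- The characters at qu + r contribute the common factor ξ^{cu}. The remaining nested sum splits
according to whether the smallest remainder is 0, and each part is expanded by `hasSum_blockCoeff`,
with shift 0 or the exponent of the last letter. -/
theorem hasSum_blockLetter [CharZero K] [CompleteSpace K] [IsUltrametricDist K] [NeZero N] {ξ : K}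
    (hξ : ξ ^ N = 1) {q : ℕ} (hq : q ≠ 0) (h : ∀ r < q, r ≠ 0 → ‖(q : K) / r‖ < 1) {u : ℕ}
    (hu : u ≠ 0) {A : List (ℤ × ZMod N)} (hA : A ≠ []) :
    HasSum (fun x => blockLetter ξ q A x * letterFun ξ x u) (blockVal ξ q u A) := by
  have hu' : (u : K) ≠ 0 := by exact_mod_cast hu
  have hq' : (q : K) ≠ 0 := by exact_mod_cast hq
  set c := q • (A.map Prod.snd).sum with hc
  have hinj : Function.Injective fun t : ℤ => (t, c) := fun a b hab => (Prod.ext_iff.1 hab).1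
  rw [← hinj.hasSum_iff]
  swap
  · rintro ⟨t, c'⟩ ht
    rw [blockLetter, if_neg, zero_mul]
    rintro rfl
    exact ht ⟨t, rfl⟩
  obtain ⟨A', z, rfl⟩ := (List.eq_nil_or_concat' A).resolve_left hA
  set φ : ℤ × ZMod N → ℕ → K := fun x r => (ξ ^ x.2.val) ^ r / ((q * u + r : ℕ) : K) ^ x.1 with hφ
  have hval : blockVal ξ q u (A' ++ [z]) = (ξ ^ c.val) ^ u * nestSum φ (A' ++ [z]) q := by
    have h1 : blockVal ξ q u (A' ++ [z]) =
        nestSum (fun x r => (ξ ^ x.2.val) ^ (q * u) * φ x r) (A' ++ [z]) q := by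
      refine nestSum_congr fun x _ r _ => ?_
      rw [letterFun, pow_add, mul_div_assoc]
    rw [h1, nestSum_smul]
    congr 1
    rw [hc, pow_val_nsmul hξ, pow_val_list_sum hξ, ← pow_mul, List.map_map]
    generalize A' ++ [z] = B
    induction B with
    | nil => simp
    | cons x B ih => simp [mul_pow, ih]
  rw [hval, nestSum_append_singleton φ A' z (Nat.pos_of_ne_zero hq)]
  have h1 := hasSum_blockCoeff ξ h hu (A' ++ [z]) 0
  have h2 := (hasSum_blockCoeff ξ h hu A' z.1).mul_left ((q : K) ^ (-z.1))
  have h3 := (h1.add h2).mul_left ((ξ ^ c.val) ^ u)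
  have h4 : φ z 0 = (q : K) ^ (-z.1) * (u : K) ^ (-z.1) := by
    simp [hφ, mul_zpow]
    ring
  rw [h4]
  refine HasSum.congr_of_eq h3 (fun t => ?_) ?_
  · simp only [Function.comp_apply, blockLetter, ← hc, if_true, List.getLast?_concat,
      List.dropLast_concat, letterFun, zpow_neg, zero_sub]
    split_ifs <;> (field_simp; try ring)
  · rw [neg_zero, zpow_zero]
    ring

theorem norm_blockCoeff_le [CharZero K] [IsUltrametricDist K] (ξ : K) {q : ℕ} {ρ : ℝ}
    (hρ : 0 ≤ ρ) (h : ∀ r < q, r ≠ 0 → ‖(q : K) / r‖ ≤ ρ) (A : List (ℤ × ZMod N)) :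
    ∃ C, 0 ≤ C ∧ ∀ s, ‖blockCoeff ξ q A s‖ ≤ C * ρ ^ s := by
  obtain ⟨C, hC, hle⟩ := decay_nestSum (M := q) hρ
    (fun (x : ℤ × ZMod N) r hr => decay_letterPS ξ (h r hr) x) A
  exact ⟨C, hC, fun s => (blockCoeff_eq_coeff ξ q A s).symm ▸ hle s⟩

theorem norm_blockLetter_le [CharZero K] [IsUltrametricDist K] (ξ : K) {q : ℕ} {ρ : ℝ}
    (hρ : 0 < ρ) (hρ1 : ρ ≤ 1)
    (h : ∀ r < q, r ≠ 0 → ‖(q : K) / r‖ ≤ ρ) (A : List (ℤ × ZMod N)) :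
    ∃ C, 0 ≤ C ∧ ∀ x, ‖blockLetter ξ q A x‖ ≤ C * ρ ^ (-x.1).toNat := by
  obtain ⟨C, hC, hA⟩ := norm_blockCoeff_le ξ hρ.le h A
  obtain ⟨D, hD, hA'⟩ := norm_blockCoeff_le ξ hρ.le h A.dropLast
  have h1 : ∀ x : ℤ × ZMod N, ‖(if x.1 ≤ 0 then blockCoeff ξ q A (-x.1).toNat else 0 : K)‖ ≤
      C * ρ ^ (-x.1).toNat := by
    intro x
    split_ifs
    · exact hA _
    · rw [norm_zero]
      positivity
  rcases hz : A.getLast? with _ | z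
  · refine ⟨C, hC, fun x => ?_⟩
    simp only [blockLetter, hz, add_zero]
    split_ifs with h2 h3
    · exact hA _
    all_goals
      rw [norm_zero]
      positivity
  -- The inverse power of ρ compensates a negative exponent of z: for t ≤ z one has (-z)⁺ + (z - t)
  -- ≥ (-t)⁺.
  · refine ⟨C + ‖(q : K) ^ (-z.1)‖ * D * (ρ ^ (-z.1).toNat)⁻¹, by positivity, fun x => ?_⟩
    simp only [blockLetter, hz]
    by_cases hx : x.2 = q • (A.map Prod.snd).sum
    · rw [if_pos hx, add_mul]
      refine (norm_add_le _ _).trans (add_le_add (h1 x) ?_)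
      split_ifs with h3
      · rw [norm_mul, mul_assoc, mul_assoc]
        gcongr
        refine (hA' _).trans ?_
        gcongr
        rw [le_inv_mul_iff₀ (by positivity), ← pow_add]
        exact pow_le_pow_of_le_one hρ.le hρ1 (by lia)
      · rw [norm_zero]
        positivity
    · rw [if_neg hx, norm_zero]
      positivity

theorem blockLetter_eq_zero [CharZero K] {ξ : K} {q : ℕ} {A : List (ℤ × ZMod N)} {x : ℤ × ZMod N}
    (h : ∀ z ∈ A, z.1 < x.1) (h0 : 0 < x.1) : blockLetter ξ q A x = 0 := by
  rw [blockLetter, if_neg (not_le.2 h0)]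
  rcases hz : A.getLast? with _ | z
  · simp
  · simp [h z (List.mem_of_getLast? hz)]

end Padic

open Filter Topology

/-! ### Bounds for the localized harmonic action -/

theorem finite_lists_of_length_le {B : Type*} {F : Set B} (hF : F.Finite) (d : ℕ) :
    {V : List B | V.length ≤ d ∧ ∀ x ∈ V, x ∈ F}.Finite := by
  induction d with
  | zero =>
    refine (Set.finite_singleton []).subset fun V hV => ?_
    simpa using hV.1
  | succ d ih =>
    refine ((Set.finite_singleton []).union (hF.image2 List.cons ih)).subset fun V hV => ?_
    rcases V with _ | ⟨x, V⟩
    · simp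
    · right
      exact ⟨x, hV.2 x (by simp), V, ⟨by simpa using hV.1, fun y hy => hV.2 y (by simp [hy])⟩, rfl⟩

theorem finite_letters (N : ℕ) [NeZero N] (W : ℕ) : {x : ℕ+ × ZMod N | (x.1 : ℕ) ≤ W}.Finite := by
  have h : {n : ℕ+ | (n : ℕ) ≤ W}.Finite :=
    Set.Finite.of_finite_image ((Set.finite_Iic W).subset (by rintro _ ⟨n, hn, rfl⟩; exact hn))
      PNat.coe_injective.injOn
  exact (h.prod (Set.finite_univ (α := ZMod N))).subset fun x hx => ⟨hx, trivial⟩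

theorem le_posWeight_of_mem {N : ℕ} {v : List (ℕ+ × ZMod N)} {x : ℕ+ × ZMod N} (hx : x ∈ v) :
    (x.1 : ℕ) ≤ posWeight v :=
  List.single_le_sum (by simp) _ (List.mem_map.2 ⟨x, hx, rfl⟩)

theorem length_le_posWeight {N : ℕ} (v : List (ℕ+ × ZMod N)) : v.length ≤ posWeight v := by
  induction v with
  | nil => simp
  | cons x v ih =>
    have := x.1.pos
    simp only [List.length_cons, posWeight, List.map_cons, List.sum_cons] at ih ⊢
    lia

theorem finite_posWeight_le (N : ℕ) [NeZero N] (W : ℕ) :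
    {v : List (ℕ+ × ZMod N) | posWeight v ≤ W}.Finite :=
  (finite_lists_of_length_le (finite_letters N W) W).subset fun v hv =>
    ⟨(length_le_posWeight v).trans hv, fun _ hx => (le_posWeight_of_mem hx).trans hv⟩

theorem finite_negPart_le (N : ℕ) [NeZero N] (d W R : ℕ) :
    {V : List (ℤ × ZMod N) | V.length ≤ d ∧ posPart V ≤ W ∧ negPart V ≤ R}.Finite := by
  have h : ((Set.Icc (-(R : ℤ)) W) ×ˢ (Set.univ : Set (ZMod N))).Finite :=
    (Set.finite_Icc _ _).prod Set.finite_univ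
  refine (finite_lists_of_length_le h d).subset fun V hV => ⟨hV.1, fun x hx => ⟨?_, trivial⟩⟩
  have h1 : x.1.toNat ≤ posPart V :=
    List.single_le_sum (by simp) _ (List.mem_map.2 ⟨x, hx, rfl⟩)
  have h2 : (-x.1).toNat ≤ negPart V :=
    List.single_le_sum (by simp) _ (List.mem_map.2 ⟨x, hx, rfl⟩)
  have := hV.2.1
  have := hV.2.2
  constructor <;> lia

section Action

variable {K : Type*} [NormedField K] [CharZero K] {N : ℕ}

theorem posPart_take_add_drop (L : List (ℤ × ZMod N)) (i : ℕ) :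
    posPart (L.take i) + posPart (L.drop i) = posPart L := by
  rw [posPart, posPart, posPart, ← List.sum_append, ← List.map_append, List.take_append_drop]

/-- Each letter of V comes from a nonempty block of L, and if its exponent is positive it is at most
an exponent occurring in that block. Only negative exponents of V can be large. -/
theorem actionCoeff_support {ξ : K} {q : ℕ} {L V : List (ℤ × ZMod N)}
    (h : actionCoeff ξ q L V ≠ 0) : V.length ≤ L.length ∧ posPart V ≤ posPart L := by
  induction V generalizing L with
  | nil => simp [posPart]
  | cons x V ih =>
    rw [actionCoeff_cons] at h
    obtain ⟨i, hi, h⟩ := Finset.exists_ne_zero_of_sum_ne_zero h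
    have hi' := Finset.mem_range.1 hi
    obtain ⟨h1, h2⟩ := ih (right_ne_zero_of_mul h)
    have h3 : x.1.toNat ≤ posPart (L.take (i + 1)) := by
      by_contra h4
      refine left_ne_zero_of_mul h (blockLetter_eq_zero (fun z hz => ?_) (by lia))
      have : z.1.toNat ≤ posPart (L.take (i + 1)) :=
        List.single_le_sum (by simp) _ (List.mem_map.2 ⟨z, hz, rfl⟩)
      lia
    have h5 := posPart_take_add_drop L (i + 1)
    have h6 : posPart (x :: V) = x.1.toNat + posPart V := by simp [posPart]
    rw [List.length_drop] at h1
    constructor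
    · rw [List.length_cons]
      lia
    · lia

theorem norm_actionCoeff_le [IsUltrametricDist K] (ξ : K) {q : ℕ} {ρ : ℝ} (hρ : 0 < ρ)
    (hρ1 : ρ ≤ 1) (h : ∀ r < q, r ≠ 0 → ‖(q : K) / r‖ ≤ ρ) (L : List (ℤ × ZMod N)) :
    ∃ C, 0 ≤ C ∧ ∀ V, ‖actionCoeff ξ q L V‖ ≤ C * ρ ^ negPart V := by
  induction hL : L.length using Nat.strong_induction_on generalizing L with
  | _ n ih =>
    choose B hB0 hB using norm_blockLetter_le (N := N) ξ hρ hρ1 h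
    have ih' : ∀ i : Fin L.length, ∃ C, 0 ≤ C ∧
        ∀ V, ‖actionCoeff ξ q (L.drop (i + 1)) V‖ ≤ C * ρ ^ negPart V := fun i =>
      ih _ (by rw [List.length_drop]; lia) _ rfl
    choose C hC0 hC using ih'
    refine ⟨‖nestedSum ξ L q‖ + ∑ i : Fin L.length, B (L.take (i + 1)) * C i, ?_, fun V => ?_⟩
    · exact add_nonneg (norm_nonneg _) (Finset.sum_nonneg fun i _ => mul_nonneg (hB0 _) (hC0 i))
    rcases V with _ | ⟨x, V⟩
    · simp only [actionCoeff, negPart, List.map_nil, List.sum_nil, pow_zero, mul_one]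
      exact le_add_of_nonneg_right (Finset.sum_nonneg fun i _ => mul_nonneg (hB0 _) (hC0 i))
    · rw [actionCoeff_cons, Finset.sum_range, add_mul, Finset.sum_mul]
      refine le_add_of_nonneg_of_le (by positivity) ?_
      refine norm_sum_le_of_le _ fun i _ => ?_
      have h6 : negPart (x :: V) = (-x.1).toNat + negPart V := by simp [negPart]
      rw [norm_mul, h6, pow_add]
      calc _ ≤ (B (L.take (i + 1)) * ρ ^ (-x.1).toNat) * (C i * ρ ^ negPart V) :=
            mul_le_mul (hB _ _) (hC i V) (norm_nonneg _) (mul_nonneg (hB0 _) (by positivity))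
        _ = _ := by ring

variable {p : ℕ} [Fact p.Prime] [IsUltrametricDist K] [NeZero N]

/-- The geometric decay p^{-s}, with s = `negPart V`, beats a polynomial of degree d^2 in s. For
each bound on s only finitely many V remain, each with a finitely supported `locExpr`. Convergence
to 0 jointly in V and in the monomial is what later allows interchanging the sums. -/
theorem tendsto_actionCoeff_mul_locExpr (hK : ∀ x : ℚ, ‖(x : K)‖ = padicNorm p x)
    (hN : p.Coprime N) {ξ : K} (hξ : IsPrimitiveRoot ξ N) (hξ1 : ‖ξ‖ = 1) (α : ℕ)
    (L : List (ℤ × ZMod N)) :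
    Tendsto (fun z : List (ℤ × ZMod N) × ZMod N × ℕ × List (ℕ+ × ZMod N) =>
      actionCoeff ξ (p ^ α) L z.1 * locExpr ξ z.1 z.2) cofinite (𝓝 0) := by
  have hp : p.Prime := Fact.out
  have hp1 : (1 : ℝ) < p := by exact_mod_cast hp.one_lt
  have hρ1 : (p : ℝ)⁻¹ < 1 := inv_lt_one_of_one_lt₀ hp1
  obtain ⟨C, hC, hle⟩ := norm_actionCoeff_le ξ (q := p ^ α) (inv_pos.2 (zero_lt_one.trans hp1))
    hρ1.le (fun r hr hr0 => norm_pow_div_natCast_le hK hr0 hr) L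
  set d := L.length
  have hlim : Tendsto (fun s : ℕ => C * ((p : ℝ)⁻¹ ^ s * (p * (((s + d : ℕ) : ℝ) + 1)) ^ d ^ 2))
      atTop (𝓝 0) := by
    have h1 := (tendsto_pow_const_mul_const_pow_of_abs_lt_one (d ^ 2)
      (by rwa [abs_of_pos (by positivity)] : |(p : ℝ)⁻¹| < 1)).comp (tendsto_add_atTop_nat (d + 1))
    have h2 := h1.const_mul (C * ((p : ℝ) ^ d ^ 2 * (p : ℝ) ^ (d + 1)))
    rw [mul_zero] at h2
    refine h2.congr fun s => ?_
    have h3 : (p : ℝ)⁻¹ ^ s = (p : ℝ) ^ (d + 1) * (p : ℝ)⁻¹ ^ (s + (d + 1)) := by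
      rw [pow_add (p : ℝ)⁻¹ s, mul_left_comm, ← mul_pow, mul_inv_cancel₀ (by positivity), one_pow,
        mul_one]
    rw [h3, mul_pow, Function.comp_apply]
    push_cast
    ring
  have hbound : ∀ V y, ‖actionCoeff ξ (p ^ α) L V * locExpr ξ V y‖ ≤
      C * ((p : ℝ)⁻¹ ^ negPart V * (p * (((negPart V + d : ℕ) : ℝ) + 1)) ^ d ^ 2) := by
    intro V y
    by_cases h0 : actionCoeff ξ (p ^ α) L V = 0
    · rw [h0, zero_mul, norm_zero]
      positivity
    · have hlen : V.length ≤ d := (actionCoeff_support h0).1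
      have h1 := (exprBound_locExpr hK hN hξ hξ1 V le_rfl).1 y
      rw [norm_mul, ← mul_assoc]
      refine mul_le_mul (hle V) (h1.trans ?_) (norm_nonneg _) (by positivity)
      have h2 : (1 : ℝ) ≤ p * (((negPart V + V.length : ℕ) : ℝ) + 1) := by
        nlinarith [(Nat.cast_nonneg (negPart V + V.length) : (0 : ℝ) ≤ _)]
      refine (pow_le_pow_right₀ h2 (Nat.pow_le_pow_left hlen 2)).trans ?_
      gcongr
  rw [NormedAddGroup.tendsto_nhds_zero]
  intro ε hε
  obtain ⟨R, hR⟩ := eventually_atTop.1 (hlim.eventually (gt_mem_nhds hε))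
  have hfin := finite_negPart_le N d (posPart L) R
  refine ((hfin.biUnion fun V _ => ((locExpr ξ V).support.finite_toSet.image fun y => (V, y))).subset
    fun z hz => ?_)
  simp only [Set.mem_compl_iff, Set.mem_ofPred_eq, not_lt] at hz
  have h0 : actionCoeff ξ (p ^ α) L z.1 * locExpr ξ z.1 z.2 ≠ 0 := by
    intro h
    rw [h, norm_zero] at hz
    exact absurd hz (not_le.2 hε)
  obtain ⟨h1, h2⟩ := actionCoeff_support (left_ne_zero_of_mul h0)
  refine Set.mem_biUnion (x := z.1) ⟨h1, h2, ?_⟩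
    ⟨z.2, Finsupp.mem_support_iff.2 (right_ne_zero_of_mul h0), rfl⟩
  by_contra h3
  exact absurd (hz.trans (hbound z.1 z.2)) (not_le.2 (hR _ (not_le.1 h3).le))

/-! ### The coefficients of the expression and its evaluations -/

variable [CompleteSpace K]

omit [CharZero K] in
theorem summable_of_tendsto_mul_bounded {ι : Type*} {f g : ι → K} (hf : Tendsto f cofinite (𝓝 0))
    {B : ℝ} (hg : ∀ i, ‖g i‖ ≤ B) : Summable fun i => f i * g i := by
  refine NonarchimedeanAddGroup.summable_of_tendsto_cofinite_zero ?_
  exact hf.zero_mul_isBoundedUnder_le (isBoundedUnder_of ⟨B, hg⟩)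

/-- The monomial `ξ^{cm} m^t`. -/
def monoEval (ξ : K) (m : ℕ) (x : ZMod N × ℕ) : K := (ξ ^ x.1.val) ^ m * (m : K) ^ x.2

omit [CharZero K] [NeZero N] [CompleteSpace K] in
theorem norm_monoEval_le {ξ : K} (hξ1 : ‖ξ‖ = 1) (m : ℕ) (x : ZMod N × ℕ) :
    ‖monoEval ξ m x‖ ≤ 1 := by
  rw [monoEval, norm_mul, norm_pow, norm_pow, norm_pow, hξ1, one_pow, one_pow, one_mul]
  exact pow_le_one₀ (norm_nonneg _) (IsUltrametricDist.norm_natCast_le_one K m)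

omit [CharZero K] [IsUltrametricDist K] [NeZero N] [CompleteSpace K] in
theorem hasSum_evl (ξ : K) (m : ℕ) (x : Expr K N) (v : List (ℕ+ × ZMod N)) :
    HasSum (fun c : ZMod N × ℕ => x (c.1, c.2, v) * monoEval ξ m c) (evl ξ m x v) := by
  induction x using Finsupp.induction_linear with
  | zero => simp [hasSum_zero]
  | add x y hx hy => simpa [add_mul] using hx.add hy
  | single z y =>
    obtain ⟨c, t, v'⟩ := z
    by_cases hv : v' = v
    · subst hv
      refine HasSum.congr_of_eq (hasSum_ite_eq (c, t) (y * monoEval ξ m (c, t))) (fun d => ?_) ?_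
      · by_cases hd : d = (c, t)
        · simp [hd]
        · rw [if_neg hd, Finsupp.single_eq_of_ne, zero_mul]
          rintro h
          exact hd (Prod.ext (by simp_all) (by simp_all))
      · simp [evl_single, monoEval]
    · refine HasSum.congr_of_eq hasSum_zero (fun d => ?_) ?_
      · rw [Finsupp.single_eq_of_ne, zero_mul]
        rintro h
        exact hv (by simp_all)
      · rw [evl_single]
        simp [hv]

/-- The coefficient of `ξ^{cm} m^t 𝔥(v)` in the expression of the nested sum of upper bound
`q m` of the sequence `L`. -/
def nestedCoeff (ξ : K) (q : ℕ) (L : List (ℤ × ZMod N)) (y : ZMod N × ℕ × List (ℕ+ × ZMod N)) : K :=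
  ∑' V, actionCoeff ξ q L V * locExpr ξ V y

/-- The coefficient of `𝔥(v)` in the expression of the nested sum of upper bound `q m` of the
sequence `L`, for a given `m`. -/
def nestedEval (ξ : K) (q : ℕ) (L : List (ℤ × ZMod N)) (m : ℕ) (v : List (ℕ+ × ZMod N)) : K :=
  ∑' c : ZMod N × ℕ, nestedCoeff ξ q L (c.1, c.2, v) * monoEval ξ m c

/-- The element of the quasi-shuffle algebra with coefficients `nestedEval`. -/
def nestedElem (ξ : K) (q : ℕ) (L : List (ℤ × ZMod N)) (m : ℕ) : QSh K N :=
  ∑ v ∈ (finite_posWeight_le N (posPart L)).toFinset, Finsupp.single v (nestedEval ξ q L m v)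

section Eval

variable (hK : ∀ x : ℚ, ‖(x : K)‖ = padicNorm p x) (hN : p.Coprime N) {ξ : K}
  (hξ : IsPrimitiveRoot ξ N) (hξ1 : ‖ξ‖ = 1) (α : ℕ) (L : List (ℤ × ZMod N))

include hK hN hξ hξ1

theorem summable_nestedCoeff (y : ZMod N × ℕ × List (ℕ+ × ZMod N)) :
    Summable fun V => actionCoeff ξ (p ^ α) L V * locExpr ξ V y := by
  have hinj : Function.Injective fun V : List (ℤ × ZMod N) => (V, y) := fun a b h =>
    (Prod.ext_iff.1 h).1
  exact NonarchimedeanAddGroup.summable_of_tendsto_cofinite_zero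
    ((tendsto_actionCoeff_mul_locExpr hK hN hξ hξ1 α L).comp hinj.tendsto_cofinite)

omit [CompleteSpace K] in
theorem norm_nestedCoeff_le : ∃ B, 0 ≤ B ∧ ∀ y, ‖nestedCoeff ξ (p ^ α) L y‖ ≤ B := by
  obtain ⟨B, hB⟩ := (tendsto_actionCoeff_mul_locExpr hK hN hξ hξ1 α
    L).norm.bddAbove_range_of_cofinite
  refine ⟨max B 0, le_max_right _ _, fun y => ?_⟩
  refine IsUltrametricDist.norm_tsum_le_of_forall_le_of_nonneg (le_max_right _ _) fun V => ?_
  exact (hB ⟨(V, y), rfl⟩).trans (le_max_left _ _)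

/-- The family indexed by V and (c, t) is jointly summable, and the two statements are its two
orders of iterated summation. -/
theorem hasSum_nestedEval (m : ℕ) (v : List (ℕ+ × ZMod N)) :
    HasSum (fun c : ZMod N × ℕ => nestedCoeff ξ (p ^ α) L (c.1, c.2, v) * monoEval ξ m c)
        (nestedEval ξ (p ^ α) L m v) ∧
      HasSum (fun V => actionCoeff ξ (p ^ α) L V * evl ξ m (locExpr ξ V) v)
        (nestedEval ξ (p ^ α) L m v) := by
  have hinj : Function.Injective fun z : List (ℤ × ZMod N) × ZMod N × ℕ =>
      (z.1, z.2.1, z.2.2, v) := by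
    rintro ⟨V, c, t⟩ ⟨V', c', t'⟩ h
    simp_all
  have hs := summable_of_tendsto_mul_bounded
    ((tendsto_actionCoeff_mul_locExpr hK hN hξ hξ1 α L).comp hinj.tendsto_cofinite)
    (g := fun z => monoEval ξ m z.2) (fun z => norm_monoEval_le hξ1 m z.2)
  have h1 := hs.hasSum.prod_fiberwise (g := fun V =>
    actionCoeff ξ (p ^ α) L V * evl ξ m (locExpr ξ V) v) fun V =>
      HasSum.congr_of_eq ((hasSum_evl ξ m (locExpr ξ V) v).mul_left (actionCoeff ξ (p ^ α) L V))
        (fun c => by simp [mul_assoc]) rfl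
  have h2 := ((Equiv.prodComm _ _).hasSum_iff.2 hs.hasSum).prod_fiberwise (g := fun c =>
    nestedCoeff ξ (p ^ α) L (c.1, c.2, v) * monoEval ξ m c) fun c =>
      HasSum.congr_of_eq ((summable_nestedCoeff hK hN hξ hξ1 α L (c.1, c.2, v)).hasSum.mul_right
        (monoEval ξ m c)) (fun V => by simp) rfl
  rw [nestedEval, h2.tsum_eq]
  exact ⟨h2, h1⟩

omit [CompleteSpace K] in
theorem norm_nestedEval_le : ∃ B, 0 ≤ B ∧ ∀ m v, ‖nestedEval ξ (p ^ α) L m v‖ ≤ B := by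
  obtain ⟨B, hB, hle⟩ := norm_nestedCoeff_le hK hN hξ hξ1 α L
  refine ⟨B, hB, fun m v => IsUltrametricDist.norm_tsum_le_of_forall_le_of_nonneg hB fun c => ?_⟩
  rw [norm_mul]
  exact (mul_le_of_le_one_right (norm_nonneg _) (norm_monoEval_le hξ1 m c)).trans (hle _)

omit [CompleteSpace K] [NeZero N] in
theorem posWeight_le_of_mul_ne_zero {V : List (ℤ × ZMod N)}
    {y : ZMod N × ℕ × List (ℕ+ × ZMod N)}
    (h : actionCoeff ξ (p ^ α) L V * locExpr ξ V y ≠ 0) : posWeight y.2.2 ≤ posPart L :=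
  ((exprBound_locExpr hK hN hξ hξ1 V le_rfl).2 y (right_ne_zero_of_mul h)).2.2.trans
    (actionCoeff_support (left_ne_zero_of_mul h)).2

omit [CompleteSpace K] [NeZero N] in
theorem nestedCoeff_eq_zero {y : ZMod N × ℕ × List (ℕ+ × ZMod N)}
    (h : posPart L < posWeight y.2.2) : nestedCoeff ξ (p ^ α) L y = 0 := by
  rw [nestedCoeff, ← tsum_zero (α := K) (β := List (ℤ × ZMod N))]
  refine tsum_congr fun V => ?_
  by_contra h1
  exact absurd (posWeight_le_of_mul_ne_zero hK hN hξ hξ1 α L h1) (not_le.2 h)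

omit [CompleteSpace K] [NeZero N] in
theorem nestedEval_eq_zero {m : ℕ} {v : List (ℕ+ × ZMod N)} (h : posPart L < posWeight v) :
    nestedEval ξ (p ^ α) L m v = 0 := by
  rw [nestedEval, ← tsum_zero (α := K) (β := ZMod N × ℕ)]
  refine tsum_congr fun c => ?_
  rw [nestedCoeff_eq_zero hK hN hξ hξ1 α L h, zero_mul]

omit [CompleteSpace K] in
theorem nestedElem_apply (m : ℕ) (v : List (ℕ+ × ZMod N)) :
    nestedElem ξ (p ^ α) L m v = nestedEval ξ (p ^ α) L m v := by
  rw [nestedElem, Finsupp.finsetSum_apply]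
  by_cases hv : posWeight v ≤ posPart L
  · rw [Finset.sum_eq_single v]
    · simp
    · intro b _ hb
      simp [hb]
    · intro h
      exact absurd ((finite_posWeight_le N (posPart L)).mem_toFinset.2 hv) h
  · rw [nestedEval_eq_zero hK hN hξ hξ1 α L (not_le.1 hv)]
    refine Finset.sum_eq_zero fun b hb => ?_
    have hb' : posWeight b ≤ posPart L := (finite_posWeight_le N (posPart L)).mem_toFinset.1 hb
    rw [Finsupp.single_eq_of_ne]
    rintro rfl
    exact hv hb'

theorem hasSum_nestedElem (m : ℕ) (v : List (ℕ+ × ZMod N)) :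
    HasSum (fun V => actionCoeff ξ (p ^ α) L V * evl ξ m (locExpr ξ V) v)
      (nestedElem ξ (p ^ α) L m v) :=
  nestedElem_apply hK hN hξ hξ1 α L m v ▸ (hasSum_nestedEval hK hN hξ hξ1 α L m v).2

/-- At m = 1 all sums over nonempty V are empty, and the coefficient of the empty sequence is
H_q(L). -/
theorem nestedElem_one_nil : nestedElem ξ (p ^ α) L 1 [] = nestedSum ξ L (p ^ α) := by
  have h := hasSum_nestedElem hK hN hξ hξ1 α L 1 []
  refine h.unique (HasSum.congr_of_eq (hasSum_ite_eq [] (nestedSum ξ L (p ^ α))) (fun V => ?_) rfl)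
  rw [locExpr_evl_one_nil]
  rcases V with _ | ⟨x, V⟩
  · simp [actionCoeff]
  · simp

omit [CompleteSpace K] [NeZero N] in
theorem evl_locExpr_eq_zero {m : ℕ} {V : List (ℤ × ZMod N)} {v : List (ℕ+ × ZMod N)}
    (hV : actionCoeff ξ (p ^ α) L V ≠ 0) (hv : posPart L < posWeight v) :
    evl ξ m (locExpr ξ V) v = 0 := by
  refine (hasSum_evl ξ m (locExpr ξ V) v).unique (HasSum.congr_of_eq hasSum_zero (fun c => ?_) rfl)
  by_contra h
  exact absurd (posWeight_le_of_mul_ne_zero hK hN hξ hξ1 α L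
    (mul_ne_zero hV (left_ne_zero_of_mul h))) (not_le.2 hv)

/-- Applied to the expansion of x :: V, `theta` returns it at m, plus the letter x at m times the
expansion of V. Summing over x rebuilds the value of the first block for the quotient m. The term i
= 0 is the part where no index has this quotient. -/
theorem theta_nestedElem {m : ℕ} (hm : m ≠ 0) :
    theta (posLetter ξ m) (nestedElem ξ (p ^ α) L (m + 1)) =
      ∑ i ∈ Finset.range (L.length + 1),
        blockVal ξ (p ^ α) m (L.take i) • nestedElem ξ (p ^ α) (L.drop i) m := by
  have := nonarchimedeanRing_of_ultrametric K
  have hq : p ^ α ≠ 0 := pow_ne_zero _ (Fact.out : p.Prime).ne_zero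
  have hp1 : (1 : ℝ) < p := by exact_mod_cast (Fact.out : p.Prime).one_lt
  have hlt : ∀ r < p ^ α, r ≠ 0 → ‖((p ^ α : ℕ) : K) / r‖ < 1 := fun r hr hr0 =>
    (norm_pow_div_natCast_le hK hr0 hr).trans_lt (inv_lt_one_of_one_lt₀ hp1)
  ext v
  -- Words of weight above `posPart L` do not occur, so these letters suffice for all V at once, and
  -- the finite sum of `theta_apply` can be exchanged with the series.
  set F := (finite_letters N (posPart L)).toFinset with hF
  have hmemF : ∀ x : ℕ+ × ZMod N, posWeight (x :: v) ≤ posPart L → x ∈ F := fun x hx =>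
    (Set.Finite.mem_toFinset _).2 ((le_posWeight_of_mem (List.mem_cons_self ..)).trans hx)
  have h1 : HasSum (fun V => actionCoeff ξ (p ^ α) L V *
      theta (posLetter ξ m) (evl ξ (m + 1) (locExpr ξ V)) v)
      (theta (posLetter ξ m) (nestedElem ξ (p ^ α) L (m + 1)) v) := by
    have h2 := (hasSum_nestedElem hK hN hξ hξ1 α L (m + 1) v).add
      (hasSum_sum fun x (_ : x ∈ F) => (hasSum_nestedElem hK hN hξ hξ1 α L (m + 1)
        (x :: v)).mul_left (posLetter ξ m x))
    refine HasSum.congr_of_eq h2 (fun V => ?_) (theta_apply _ _ _ F fun x hx => hmemF x ?_)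
    · by_cases hV : actionCoeff ξ (p ^ α) L V = 0
      · simp [hV]
      · rw [theta_apply _ _ _ F fun x hx => hmemF x ?_, mul_add, Finset.mul_sum]
        · congr 1
          exact Finset.sum_congr rfl fun x _ => by ring
        · by_contra h
          exact hx (evl_locExpr_eq_zero hK hN hξ hξ1 α L hV (not_le.1 h))
    · by_contra h
      rw [nestedElem_apply hK hN hξ hξ1] at hx
      exact hx (nestedEval_eq_zero hK hN hξ hξ1 α L (not_le.1 h))
  have h3 : HasSum (fun z : (ℤ × ZMod N) × List (ℤ × ZMod N) =>
      actionCoeff ξ (p ^ α) L (z.1 :: z.2) * (letterFun ξ z.1 m * evl ξ m (locExpr ξ z.2) v))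
      (∑ i ∈ Finset.range L.length, blockVal ξ (p ^ α) m (L.take (i + 1)) *
        nestedElem ξ (p ^ α) (L.drop (i + 1)) m v) := by
    refine HasSum.congr_of_eq (hasSum_sum fun i (hi : i ∈ Finset.range L.length) =>
      (hasSum_blockLetter hξ.pow_eq_one hq hlt hm (A := L.take (i + 1)) ?_).mul_of_nonarchimedean
        (hasSum_nestedElem hK hN hξ hξ1 α (L.drop (i + 1)) m v)) (fun z => ?_) rfl
    · intro h
      have := congrArg List.length h
      rw [List.length_take, List.length_nil] at this
      have := Finset.mem_range.1 hi
      lia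
    · rw [actionCoeff_cons, Finset.sum_mul]
      exact Finset.sum_congr rfl fun i _ => by ring
  have hinj : Function.Injective fun z : (ℤ × ZMod N) × List (ℤ × ZMod N) => z.1 :: z.2 := by
    rintro ⟨x, V⟩ ⟨x', V'⟩ h
    simp_all
  let G : List (ℤ × ZMod N) → K := fun V => match V with
    | [] => 0
    | x :: V => actionCoeff ξ (p ^ α) L (x :: V) * (letterFun ξ x m * evl ξ m (locExpr ξ V) v)
  have h4 : HasSum G (∑ i ∈ Finset.range L.length, blockVal ξ (p ^ α) m (L.take (i + 1)) *
      nestedElem ξ (p ^ α) (L.drop (i + 1)) m v) := by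
    refine (hinj.hasSum_iff fun V hV => ?_).1 h3
    rcases V with _ | ⟨x, V⟩
    · rfl
    · exact absurd ⟨(x, V), rfl⟩ hV
  rw [Finsupp.finsetSum_apply, Finset.sum_range_succ']
  refine (h1.unique (HasSum.congr_of_eq ((hasSum_nestedElem hK hN hξ hξ1 α L m v).add h4)
    (fun V => ?_) rfl)).trans ?_
  · rcases V with _ | ⟨x, V⟩
    · simp [theta_evl_locExpr_nil, G]
    · simp only [G]
      rw [theta_evl_locExpr hξ.pow_eq_one hm, Finsupp.add_apply, Finsupp.smul_apply, smul_eq_mul,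
        mul_add]
  · simp [blockVal, add_comm]

end Eval

end Action

/-! ### The expression of the nested sums of upper bound `q m` -/

section Pairing

variable {K : Type*} [NormedField K] {N : ℕ}

/-- The linear extension of `v ↦ 𝔥_m(v)`. -/
def nestedLin (ξ : K) (m : ℕ) : QSh K N →ₗ[K] K :=
  Finsupp.linearCombination K fun v => nestedSumPos ξ v m

theorem nestedLin_single (ξ : K) (m : ℕ) (v : List (ℕ+ × ZMod N)) (y : K) :
    nestedLin ξ m (Finsupp.single v y) = y * nestedSumPos ξ v m := by
  simp [nestedLin]

/-- This is what `theta` stands for: H_{m+1}(x :: v) is H_m(x :: v) plus the term k = m, that is the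
letter x at m times H_m(v). -/
theorem nestedLin_succ (ξ : K) {m : ℕ} (hm : m ≠ 0) (f : QSh K N) :
    nestedLin ξ (m + 1) f = nestedLin ξ m (theta (posLetter ξ m) f) := by
  have key : nestedLin ξ (m + 1) = nestedLin (N := N) ξ m ∘ₗ theta (posLetter ξ m) := by
    ext v
    simp only [LinearMap.comp_apply, Finsupp.lsingle_apply, nestedLin_single, theta_single,
      map_add, one_mul, one_smul]
    rcases v with _ | ⟨x, v⟩
    · simp [nestedSumPos, nestedSum]
    · simp only [nestedSumPos, nestedSum_eq_nestSum, List.map_cons, nestSum_cons_succ, if_neg hm,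
        thetaAux_cons, map_smul, nestedLin_single, one_mul, smul_eq_mul]
      rfl
  rw [key, LinearMap.comp_apply]

theorem nestedLin_one (ξ : K) (f : QSh K N) : nestedLin ξ 1 f = f [] := by
  have key : nestedLin (N := N) ξ 1 = Finsupp.lapply [] := by
    ext v
    rcases v with _ | ⟨x, v⟩ <;>
      simp [nestedLin_single, nestedSumPos, nestedSum, show Finset.Ioo 0 1 = ∅ from rfl]
  rw [key, Finsupp.lapply_apply]

/-- The largest i indices, those in [qm, q(m+1)), form the block with quotient m; the others give a
sum of upper bound qm. -/
theorem nestedSum_add (ξ : K) (L : List (ℤ × ZMod N)) {q m : ℕ} (hq : q ≠ 0) (hm : m ≠ 0) :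
    nestedSum ξ L (q * (m + 1)) = ∑ i ∈ Finset.range (L.length + 1),
      blockVal ξ q m (L.take i) * nestedSum ξ (L.drop i) (q * m) := by
  rw [nestedSum_eq_nestSum, mul_add, mul_one, nestSum_add]
  simp only [nestedSum_eq_nestSum]
  refine Finset.sum_congr rfl fun i _ => ?_
  rw [blockVal]
  congr 1
  refine nestSum_congr fun x _ r _ => if_neg ?_
  have := Nat.mul_ne_zero hq hm
  lia

end Pairing

section Eval

variable {K : Type*} [NormedField K] [CharZero K] {N : ℕ} {p : ℕ} [Fact p.Prime]
  [IsUltrametricDist K] [NeZero N] [CompleteSpace K] (hK : ∀ x : ℚ, ‖(x : K)‖ = padicNorm p x)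
  (hN : p.Coprime N) {ξ : K} (hξ : IsPrimitiveRoot ξ N) (hξ1 : ‖ξ‖ = 1) (α : ℕ)

include hK hN hξ hξ1

theorem nestedLin_nestedElem (L : List (ℤ × ZMod N)) {m : ℕ} (hm : m ≠ 0) :
    nestedLin ξ m (nestedElem ξ (p ^ α) L m) = nestedSum ξ L (p ^ α * m) := by
  have hq : p ^ α ≠ 0 := pow_ne_zero _ (Fact.out : p.Prime).ne_zero
  induction m generalizing L with
  | zero => exact absurd rfl hm
  | succ m ih =>
    rcases Nat.eq_zero_or_pos m with rfl | hm'
    · rw [zero_add, nestedLin_one, nestedElem_one_nil hK hN hξ hξ1, mul_one]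
    · rw [nestedLin_succ ξ hm'.ne', theta_nestedElem hK hN hξ hξ1 α L hm'.ne', map_sum,
        nestedSum_add ξ L hq hm'.ne']
      refine Finset.sum_congr rfl fun i _ => ?_
      rw [map_smul, ih _ hm'.ne', smul_eq_mul]

theorem hasSum_nestedCoeff (L : List (ℤ × ZMod N)) {m : ℕ} (hm : m ≠ 0) :
    HasSum (fun y => nestedCoeff ξ (p ^ α) L y *
      (monoEval ξ m (y.1, y.2.1) * nestedSumPos ξ y.2.2 m)) (nestedSum ξ L (p ^ α * m)) := by
  have hinj : ∀ v : List (ℕ+ × ZMod N),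
      Function.Injective fun c : ZMod N × ℕ => (c.1, c.2, v) := by
    rintro v ⟨c, t⟩ ⟨c', t'⟩ h
    simp_all
  set S := (finite_posWeight_le N (posPart L)).toFinset
  have h1 : ∀ v ∈ S, HasSum (fun y : ZMod N × ℕ × List (ℕ+ × ZMod N) => if y.2.2 = v then
      nestedCoeff ξ (p ^ α) L y * (monoEval ξ m (y.1, y.2.1) * nestedSumPos ξ y.2.2 m) else 0)
      (nestedEval ξ (p ^ α) L m v * nestedSumPos ξ v m) := by
    intro v _
    rw [← (hinj v).hasSum_iff]
    · refine HasSum.congr_of_eq (((hasSum_nestedEval hK hN hξ hξ1 α L m v).1).mul_right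
        (nestedSumPos ξ v m)) (fun c => ?_) rfl
      simp [mul_assoc]
    · rintro ⟨c, t, v'⟩ hy
      rw [if_neg]
      rintro rfl
      exact hy ⟨(c, t), rfl⟩
  refine HasSum.congr_of_eq (hasSum_sum h1) (fun y => ?_) ?_
  · rw [Finset.sum_ite_eq]
    split_ifs with h
    · rfl
    · rw [nestedCoeff_eq_zero hK hN hξ hξ1, zero_mul]
      by_contra h'
      exact h ((finite_posWeight_le N (posPart L)).mem_toFinset.2 (not_lt.1 h'))
  · rw [← nestedLin_nestedElem hK hN hξ hξ1 α L hm, nestedElem, map_sum]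
    simp only [nestedLin_single]
    rfl

theorem summable_harCoeffTerm (w : HarWord ℤ N) (x : ZMod N × ℤ × List (ℕ+ × ZMod N)) :
    Summable (harCoeffTerm ξ (p ^ α) w x) := by
  unfold harCoeffTerm
  split_ifs with h
  · simp only [mul_assoc]
    exact (summable_nestedCoeff hK hN hξ hξ1 α w.chars _).mul_left _
  · exact summable_zero

omit hK hN hξ hξ1 [Fact p.Prime] [IsUltrametricDist K] [NeZero N] [CompleteSpace K] in
theorem harCoeff_eq (ξ : K) (q : ℕ) (w : HarWord ℤ N) (x : ZMod N × ℤ × List (ℕ+ × ZMod N)) :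
    harCoeff ξ q w x = if w.weight id ≤ x.2.1 then (q : K) ^ w.weight id *
      nestedCoeff ξ q w.chars (x.1 + q • w.top, (x.2.1 - w.weight id).toNat, x.2.2) else 0 := by
  unfold harCoeff harCoeffTerm
  split_ifs with h
  · rw [nestedCoeff, ← tsum_mul_left]
    exact tsum_congr fun V => mul_assoc _ _ _
  · exact tsum_zero

theorem hasSum_harCoeff (w : HarWord ℤ N) {m : ℕ} (hm : m ≠ 0) :
    HasSum (fun x : ZMod N × ℤ × List (ℕ+ × ZMod N) => harCoeff ξ (p ^ α) w x *
      ((ξ ^ x.1.val) ^ m * (m : K) ^ x.2.1 * nestedSumPos ξ x.2.2 m)) (har ξ (p ^ α * m) w) := by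
  have hm' : (m : K) ≠ 0 := by exact_mod_cast hm
  set q := p ^ α with hq
  set W := w.weight id
  -- The prefactors (qm)^W and ξ^{-q·top·m} of `har` shift the power of m by W and the character by
  -- -q·top.
  have hinj : Function.Injective fun y : ZMod N × ℕ × List (ℕ+ × ZMod N) =>
      (y.1 - q • w.top, (y.2.1 : ℤ) + W, y.2.2) := by
    rintro ⟨c, t, v⟩ ⟨c', t', v'⟩ h
    simpa using h
  have hξq : ξ ^ (q • w.top).val ≠ 0 := pow_ne_zero _ (hξ.ne_zero (NeZero.ne N))
  rw [← hinj.hasSum_iff]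
  · refine HasSum.congr_of_eq ((hasSum_nestedCoeff hK hN hξ hξ1 α w.chars hm).mul_left
      (((q * m : ℕ) : K) ^ W * (1 / ξ ^ (q • w.top).val) ^ m)) (fun y => ?_) ?_
    · have h1 : ξ ^ (y.1 - q • w.top).val = ξ ^ y.1.val * (1 / ξ ^ (q • w.top).val) := by
        rw [mul_one_div, eq_div_iff hξq, ← pow_val_add hξ.pow_eq_one, sub_add_cancel]
      have h2 : ((y.2.1 : ℤ) + W - W).toNat = y.2.1 := by simp
      rw [Function.comp_apply, harCoeff_eq, if_pos (by simp [W]), h1, h2, sub_add_cancel,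
        zpow_add₀ hm', zpow_natCast, monoEval, mul_pow]
      push_cast
      rw [mul_zpow]
      ring
    · rw [har, mhs, pow_val_nsmul hξ.pow_eq_one, pow_mul (1 / ξ ^ w.top.val), one_div_pow]
      ring
  · rintro ⟨j, l, v⟩ hx
    rw [harCoeff_eq, if_neg, zero_mul]
    intro hl
    refine hx ⟨(j + q • w.top, (l - W).toNat, v), ?_⟩
    have h : W ≤ l := hl
    simp [h]

end Eval

/-! ### Functions of `m` determined by their values near `0` in a residue class -/

section Residue

variable {K : Type*} [NormedField K] [CharZero K] {N : ℕ} {p : ℕ} [Fact p.Prime]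
  [IsUltrametricDist K]

omit [CharZero K] in
theorem exists_tendsto_zero_of_modEq (hK : ∀ x : ℚ, ‖(x : K)‖ = padicNorm p x) (hN : p.Coprime N)
    [NeZero N] (b : ℕ) : ∃ M : ℕ → ℕ, (∀ k, M k ≠ 0) ∧ (∀ k, M k ≡ b [MOD N]) ∧
      Tendsto (fun k => (M k : K)) atTop (𝓝 0) := by
  have hp : p.Prime := Fact.out
  have hp1 : (1 : ℝ) < p := by exact_mod_cast hp.one_lt
  let x : ∀ k : ℕ, { x // x ≡ 0 [MOD p ^ k] ∧ x ≡ b [MOD N] } := fun k =>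
    Nat.chineseRemainder (Nat.Coprime.pow_left k hN) 0 b
  -- Adding p^k N keeps both congruences and excludes the value 0.
  refine ⟨fun k => x k + p ^ k * N, fun k => ?_, fun k => ?_, ?_⟩
  · have := Nat.mul_ne_zero (pow_ne_zero k hp.ne_zero) (NeZero.ne N)
    lia
  · exact (Nat.add_mul_modulus_modEq_iff.2 (x k).2.2)
  · have hle : ∀ k, ‖((x k + p ^ k * N : ℕ) : K)‖ ≤ (p : ℝ)⁻¹ ^ k := by
      intro k
      obtain ⟨r, hr⟩ : p ^ k ∣ x k + p ^ k * N :=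
        Nat.dvd_add ((Nat.modEq_zero_iff_dvd).1 (x k).2.1) (dvd_mul_right _ _)
      rw [hr, Nat.cast_mul, norm_mul, Nat.cast_pow, norm_pow]
      have h1 : ‖(p : K)‖ = (p : ℝ)⁻¹ := by
        have := hK p
        rw [padicNorm.padicNorm_p_of_prime] at this
        simpa using this
      rw [h1]
      exact mul_le_of_le_one_right (by positivity) (IsUltrametricDist.norm_natCast_le_one K r)
    exact squeeze_zero_norm hle
      (tendsto_pow_atTop_nhds_zero_of_lt_one (by positivity) (inv_lt_one_of_one_lt₀ hp1))

omit [IsUltrametricDist K] [CharZero K] in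
theorem pow_val_pow_eq {ξ : K} (hξ : ξ ^ N = 1) (c : ZMod N) {m b : ℕ} (h : m ≡ b [MOD N]) :
    (ξ ^ c.val) ^ m = (ξ ^ c.val) ^ b :=
  pow_eq_pow_of_modEq h (by rw [← pow_mul, mul_comm, pow_mul, hξ, one_pow])

-- The maps b ↦ ξ^{cb} are pairwise distinct characters, since ξ is primitive, and distinct
-- characters are linearly independent.
omit [IsUltrametricDist K] [CharZero K] in
theorem eq_zero_of_sum_mul_pow_eq_zero [NeZero N] {ξ : K} (hξ : IsPrimitiveRoot ξ N)
    {κ : ZMod N → K} (h : ∀ b : ℕ, ∑ c, κ c * (ξ ^ c.val) ^ b = 0) (c : ZMod N) : κ c = 0 := by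
  have hinj : Function.Injective fun c : ZMod N => powersHom K (ξ ^ c.val) := by
    intro c c' hc
    have h1 : ξ ^ c.val = ξ ^ c'.val := (powersHom K).injective hc
    exact ZMod.val_injective N (hξ.pow_inj (ZMod.val_lt c) (ZMod.val_lt c') h1)
  have hli := (linearIndependent_monoidHom (Multiplicative ℕ) K).comp _ hinj
  refine Fintype.linearIndependent_iff.1 hli κ ?_ c
  funext b
  simpa [Finset.sum_apply] using h b.toAdd

variable [NeZero N] (hK : ∀ x : ℚ, ‖(x : K)‖ = padicNorm p x) (hN : p.Coprime N) {ξ : K}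
  (hξ : IsPrimitiveRoot ξ N)

include hK hN hξ

/-- In a residue class modulo N the sum is a polynomial in 1/m. Being bounded while 1/m tends to
infinity, it is constant, and the letters have positive exponents. Those sharing an exponent n are
then separated by their characters. -/
theorem eq_zero_of_norm_sum_posLetter_le (F : Finset (ℕ+ × ZMod N)) {κ : ℕ+ × ZMod N → K} {B : ℝ}
    (h : ∀ m : ℕ, m ≠ 0 → ‖∑ x ∈ F, posLetter ξ m x * κ x‖ ≤ B) : ∀ x ∈ F, κ x = 0 := by
  classical
  rintro ⟨n, c⟩ hx
  suffices h1 : ∀ b : ℕ, ∑ c, (if (n, c) ∈ F then κ (n, c) else 0) * (ξ ^ c.val) ^ b = 0 by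
    simpa [hx] using eq_zero_of_sum_mul_pow_eq_zero hξ h1 c
  intro b
  obtain ⟨M, hM0, hMb, hM⟩ := exists_tendsto_zero_of_modEq hK hN b
  let P : Polynomial K := ∑ x ∈ F, Polynomial.monomial (x.1 : ℕ) (κ x * (ξ ^ x.2.val) ^ b)
  have hP : ∀ k, P.eval ((M k : K)⁻¹) = ∑ x ∈ F, posLetter ξ (M k) x * κ x := by
    intro k
    rw [Polynomial.eval_finsetSum]
    refine Finset.sum_congr rfl fun x _ => ?_
    rw [Polynomial.eval_monomial, posLetter, letterFun, pow_val_pow_eq hξ.pow_eq_one _ (hMb k)]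
    simp only [zpow_natCast, inv_pow, div_eq_mul_inv]
    ring
  have hlim : Tendsto (fun k => ‖((M k : K)⁻¹)‖) atTop atTop := by
    simp only [norm_inv]
    refine Tendsto.inv_tendsto_nhdsGT_zero (tendsto_nhdsWithin_iff.2 ⟨?_, ?_⟩)
    · simpa using hM.norm
    · exact Eventually.of_forall fun k => norm_pos_iff.2 (by exact_mod_cast hM0 k)
  have hdeg : ¬ 0 < P.degree := by
    intro hd
    have h2 := Polynomial.tendsto_norm_atTop P hd hlim
    obtain ⟨k, hk⟩ := (h2.eventually_gt_atTop B).exists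
    rw [hP] at hk
    exact absurd (h (M k) (hM0 k)) (not_le.2 hk)
  have hcoeff : P.coeff n = 0 :=
    Polynomial.coeff_eq_zero_of_degree_lt
      ((not_lt.1 hdeg).trans_lt (by exact_mod_cast n.pos))
  rw [Polynomial.finsetSum_coeff] at hcoeff
  simp only [Polynomial.coeff_monomial] at hcoeff
  have hinj : Function.Injective fun c : ZMod N => (n, c) := fun c c' h => (Prod.ext_iff.1 h).2
  have h3 : ∑ c, (if (n, c) ∈ F then κ (n, c) else 0) * (ξ ^ c.val) ^ b =
      ∑ x ∈ Finset.univ.map ⟨_, hinj⟩, (if x ∈ F then κ x else 0) * (ξ ^ x.2.val) ^ b := by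
    rw [Finset.sum_map]
    rfl
  rw [h3]
  refine (Finset.sum_congr_of_eq_on_inter ?_ ?_ ?_).trans hcoeff
  · intro x _ hxF
    simp [hxF]
  · rintro ⟨n', c'⟩ hxF hx
    refine if_neg fun hn => hx ?_
    rw [PNat.coe_inj] at hn
    simpa using hn.symm
  · rintro ⟨n', c'⟩ hx hxF
    have hn : n = n' := by simpa using hx
    simp [hxF, hn]

-- Once the coefficients before t vanish, the tail gives ‖f t‖ ‖x‖^t ≤ B ‖x‖^(t+1); dividing and
-- letting x tend to 0 kills f t.
omit hK hN hξ [NeZero N] [CharZero K] [Fact p.Prime] in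
theorem eq_zero_of_hasSum_zero {f : ℕ → K} {B : ℝ} (hB : ∀ t, ‖f t‖ ≤ B) {x : ℕ → K}
    (hx0 : ∀ k, x k ≠ 0) (hx : Tendsto x atTop (𝓝 0))
    (h : ∀ k, HasSum (fun t => f t * x k ^ t) 0) (t : ℕ) : f t = 0 := by
  have hB0 : 0 ≤ B := (norm_nonneg _).trans (hB 0)
  induction t using Nat.strong_induction_on with
  | _ t ih =>
    have hle : ∀ᶠ k in atTop, ‖f t‖ ≤ B * ‖x k‖ := by
      filter_upwards [(tendsto_zero_iff_norm_tendsto_zero.1 hx).eventually_le_const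
        (zero_lt_one (α := ℝ))] with k hk
      have h1 := (h k).update t 0
      rw [zero_sub, add_zero] at h1
      have h2 : ‖-(f t * x k ^ t)‖ ≤ B * ‖x k‖ ^ (t + 1) := by
        rw [← h1.tsum_eq]
        refine IsUltrametricDist.norm_tsum_le_of_forall_le_of_nonneg (by positivity) fun s => ?_
        rcases lt_trichotomy s t with hs | rfl | hs
        · rw [Function.update_of_ne hs.ne, ih s hs, zero_mul, norm_zero]
          positivity
        · rw [Function.update_self, norm_zero]
          positivity
        · rw [Function.update_of_ne hs.ne', norm_mul, norm_pow]
          exact mul_le_mul (hB s) (pow_le_pow_of_le_one (norm_nonneg _) hk hs) (by positivity) hB0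
      rw [norm_neg, norm_mul, norm_pow, pow_succ, mul_left_comm, mul_comm] at h2
      exact le_of_mul_le_mul_left h2 (pow_pos (norm_pos_iff.2 (hx0 k)) t)
    have hlim : Tendsto (fun k => B * ‖x k‖) atTop (𝓝 0) := by
      simpa using hx.norm.const_mul B
    exact norm_le_zero_iff.1 (ge_of_tendsto hlim hle)

end Residue

/-! ### Bounded families of elements of the quasi-shuffle algebra -/

section Bounded

variable {K : Type*} [NormedField K] {N : ℕ}

/-- The families with bounded coefficients and support in a given finite set. -/
def BoundedFamily (g : ℕ → QSh K N) : Prop :=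
  ∃ (S : Finset (List (ℕ+ × ZMod N))) (B : ℝ), ∀ m v, (v ∉ S → g m v = 0) ∧ ‖g m v‖ ≤ B

theorem BoundedFamily.add {g h : ℕ → QSh K N} (hg : BoundedFamily g) (hh : BoundedFamily h) :
    BoundedFamily fun m => g m + h m := by
  classical
  obtain ⟨S, B, hg⟩ := hg
  obtain ⟨T, C, hh⟩ := hh
  refine ⟨S ∪ T, B + C, fun m v => ⟨fun hv => ?_, ?_⟩⟩
  · rw [Finset.mem_union, not_or] at hv
    rw [Finsupp.add_apply, (hg m v).1 hv.1, (hh m v).1 hv.2, add_zero]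
  · exact (norm_add_le _ _).trans (add_le_add (hg m v).2 (hh m v).2)

theorem BoundedFamily.neg {g : ℕ → QSh K N} (hg : BoundedFamily g) :
    BoundedFamily fun m => -g m := by
  obtain ⟨S, B, hg⟩ := hg
  refine ⟨S, B, fun m v => ⟨fun hv => ?_, ?_⟩⟩
  · rw [Finsupp.neg_apply, (hg m v).1 hv, neg_zero]
  · rw [Finsupp.neg_apply, norm_neg]
    exact (hg m v).2

theorem BoundedFamily.zero : BoundedFamily fun _ => (0 : QSh K N) :=
  ⟨∅, 0, fun _ _ => ⟨fun _ => rfl, by simp⟩⟩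

theorem BoundedFamily.sum {ι : Type*} (s : Finset ι) {g : ι → ℕ → QSh K N}
    (hg : ∀ i ∈ s, BoundedFamily (g i)) : BoundedFamily fun m => ∑ i ∈ s, g i m := by
  classical
  induction s using Finset.induction_on with
  | empty => exact BoundedFamily.zero
  | insert i s hi ih =>
    simp only [Finset.sum_insert hi]
    exact (hg i (by simp)).add (ih fun j hj => hg j (by simp [hj]))

theorem BoundedFamily.list_sum {ι : Type*} (l : List ι) {g : ι → ℕ → QSh K N}
    (hg : ∀ i ∈ l, BoundedFamily (g i)) : BoundedFamily fun m => (l.map fun i => g i m).sum := by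
  induction l with
  | nil => exact BoundedFamily.zero
  | cons i l ih =>
    simp only [List.map_cons, List.sum_cons]
    exact (hg i (by simp)).add (ih fun j hj => hg j (by simp [hj]))

theorem BoundedFamily.smul {c : ℕ → K} {B : ℝ} (hc : ∀ m, ‖c m‖ ≤ B) (f : QSh K N) :
    BoundedFamily fun m => c m • f := by
  refine ⟨f.support, B * ∑ u ∈ f.support, ‖f u‖, fun m v => ⟨fun hv => ?_, ?_⟩⟩
  · rw [Finsupp.smul_apply, Finsupp.notMem_support_iff.1 hv, smul_zero]
  · rw [Finsupp.smul_apply, norm_smul]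
    refine mul_le_mul (hc m) ?_ (norm_nonneg _) ((norm_nonneg _).trans (hc 0))
    by_cases hv : v ∈ f.support
    · exact Finset.single_le_sum (f := fun u => ‖f u‖) (fun _ _ => norm_nonneg _) hv
    · rw [Finsupp.notMem_support_iff.1 hv, norm_zero]
      exact Finset.sum_nonneg fun _ _ => norm_nonneg _

theorem BoundedFamily.qmul {g h : ℕ → QSh K N} (hg : BoundedFamily g) (hh : BoundedFamily h) :
    BoundedFamily fun m => LocHar.qmul (g m) (h m) := by
  obtain ⟨S, B, hg⟩ := hg
  obtain ⟨T, C, hh⟩ := hh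
  have hexp : ∀ (f : QSh K N) (S : Finset (List (ℕ+ × ZMod N))), (∀ v, v ∉ S → f v = 0) →
      f = ∑ v ∈ S, f v • Finsupp.single v (1 : K) := by
    intro f S hf
    conv_lhs => rw [← Finsupp.sum_single f]
    rw [Finsupp.sum_of_support_subset f (s := S) (fun v hv => ?_) _ (by simp)]
    · simp
    · by_contra h
      exact Finsupp.mem_support_iff.1 hv (hf v h)
  have heq : (fun m => LocHar.qmul (g m) (h m)) = fun m => ∑ u ∈ S, ∑ v ∈ T,
      (g m u * h m v) • LocHar.qmul (Finsupp.single u (1 : K)) (Finsupp.single v 1) := by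
    funext m
    conv_lhs => rw [hexp (g m) S fun v hv => (hg m v).1 hv, hexp (h m) T fun v hv => (hh m v).1 hv]
    simp only [map_sum, LinearMap.sum_apply, map_smul, LinearMap.smul_apply, Finset.smul_sum,
      smul_smul]
    rw [Finset.sum_comm]
    refine Finset.sum_congr rfl fun u _ => Finset.sum_congr rfl fun v _ => ?_
    rw [mul_comm]
  rw [heq]
  refine BoundedFamily.sum S fun u _ => BoundedFamily.sum T fun v _ =>
    BoundedFamily.smul (B := B * C) (fun m => ?_) _
  rw [norm_mul]
  exact mul_le_mul (hg m u).2 (hh m v).2 (norm_nonneg _) ((norm_nonneg _).trans (hg m u).2)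

variable [CharZero K] {p : ℕ} [Fact p.Prime] [IsUltrametricDist K] [NeZero N]

/-- A bounded family which is compatible with the shift of the upper bound of the sums, and of
constant term `0`, vanishes. -/
theorem BoundedFamily.eq_zero (hK : ∀ x : ℚ, ‖(x : K)‖ = padicNorm p x) (hN : p.Coprime N) {ξ : K}
    (hξ : IsPrimitiveRoot ξ N) {g : ℕ → QSh K N} (hg : BoundedFamily g)
    (hθ : ∀ m, m ≠ 0 → theta (posLetter ξ m) (g (m + 1)) = g m) (h1 : g 1 [] = 0) {m : ℕ}
    (hm : m ≠ 0) : g m = 0 := by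
  classical
  obtain ⟨S, B, hg⟩ := hg
  let D := S.sup List.length
  suffices h : ∀ (d : ℕ) (v : List (ℕ+ × ZMod N)), D < v.length + d → ∀ m, m ≠ 0 → g m v = 0 by
    ext v
    exact h (D + 1) v (by lia) m hm
  have hF : ∀ v : List (ℕ+ × ZMod N), ∃ F : Finset (ℕ+ × ZMod N), ∀ m x, g m (x :: v) ≠ 0 → x ∈ F :=
    fun v => ⟨S.biUnion List.toFinset, fun m x hx => by
      have : x :: v ∈ S := by
        by_contra h
        exact hx ((hg m _).1 h)
      exact Finset.mem_biUnion.2 ⟨_, this, by simp⟩⟩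
  have hstep : ∀ (v : List (ℕ+ × ZMod N)) (F : Finset (ℕ+ × ZMod N)),
      (∀ m x, g m (x :: v) ≠ 0 → x ∈ F) → ∀ m, m ≠ 0 →
      g m v = g (m + 1) v + ∑ x ∈ F, posLetter ξ m x * g (m + 1) (x :: v) := fun v F hF m hm => by
    conv_lhs => rw [← hθ m hm]
    exact theta_apply _ _ _ _ (hF (m + 1))
  intro d
  induction d with
  | zero =>
    intro v hv m _
    refine (hg m v).1 fun h => ?_
    have : v.length ≤ D := Finset.le_sup h
    lia
  | succ d ih =>
    -- Words longer than D - d already have coefficient 0, so nothing feeds the shift relation at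
    -- length D - d and these coefficients do not depend on m.
    have hconst : ∀ v : List (ℕ+ × ZMod N), D < v.length + (d + 1) → ∀ m, m ≠ 0 →
        g m v = g 1 v := by
      intro v hv m hm
      obtain ⟨F, hF⟩ := hF v
      induction m, Nat.one_le_iff_ne_zero.2 hm using Nat.le_induction with
      | base => rfl
      | succ m hm' ih' =>
        have hm0 : m ≠ 0 := by lia
        have h := hstep v F hF m hm0
        rw [Finset.sum_eq_zero, add_zero] at h
        · rw [← h, ih' hm0]
        · intro x _
          rw [ih (x :: v) (by simp only [List.length_cons]; lia) _ (by lia), mul_zero]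
    rintro (_ | ⟨x, v⟩) hv m hm
    · rw [hconst _ hv m hm, h1]
    · by_cases hlt : D < (x :: v).length + d
      · exact ih _ hlt m hm
      obtain ⟨F, hF⟩ := hF v
      have hlen : ∀ y : ℕ+ × ZMod N, D < (y :: v).length + (d + 1) := fun y => by
        simpa using hv
      -- Without its head letter, the relation at v writes the bounded difference of g m v and g
      -- (m+1) v as a combination of letters at m with coefficients independent of m.
      have h := eq_zero_of_norm_sum_posLetter_le hK hN hξ F (κ := fun y => g 1 (y :: v))
        (B := B + B) fun m hm => by
          have h2 := hstep v F hF m hm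
          simp only [hconst _ (hlen _) (m + 1) (by lia)] at h2
          rw [← sub_eq_of_eq_add' h2]
          exact (norm_sub_le _ _).trans (add_le_add (hg m v).2 (hg (m + 1) v).2)
      rw [hconst _ hv m hm]
      by_contra h3
      exact h3 (h x (hF 1 x h3))

end Bounded

/-! ### The localized adjoint quasi-shuffle relations -/

section Relations

variable {K : Type*} [NormedField K] [CharZero K] {N : ℕ} [NeZero N]

theorem blockVal_mul {ξ : K} (hξ : ξ ^ N = 1) {q m : ℕ} (hq : q ≠ 0) (hm : m ≠ 0)
    (A B : List (ℤ × ZMod N)) :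
    blockVal ξ q m A * blockVal ξ q m B =
      ((quasiShuffle A B).map fun W => blockVal ξ q m W).sum :=
  nestSum_mul (fun x r => letterFun ξ x (q * m + r)) (fun x y r => letterFun_add hξ x y (by
    have := Nat.mul_ne_zero hq hm
    lia)) A B q

/-- The coefficient of `m^t` in the expression of `nestedEval ξ q L m []` for `m ≡ b` modulo `N`. -/
def residueCoeff (ξ : K) (q : ℕ) (L : List (ℤ × ZMod N)) (b t : ℕ) : K :=
  ∑ c, nestedCoeff ξ q L (c, t, []) * (ξ ^ c.val) ^ b

variable {p : ℕ} [Fact p.Prime] [IsUltrametricDist K] [CompleteSpace K]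
  (hK : ∀ x : ℚ, ‖(x : K)‖ = padicNorm p x) (hN : p.Coprime N) {ξ : K}
  (hξ : IsPrimitiveRoot ξ N) (hξ1 : ‖ξ‖ = 1) (α : ℕ)

include hK hN hξ hξ1

omit [CompleteSpace K] in
theorem boundedFamily_nestedElem (L : List (ℤ × ZMod N)) :
    BoundedFamily (nestedElem ξ (p ^ α) L) := by
  obtain ⟨B, -, hB⟩ := norm_nestedEval_le hK hN hξ hξ1 α L
  refine ⟨(finite_posWeight_le N (posPart L)).toFinset, B, fun m v => ⟨fun hv => ?_, ?_⟩⟩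
  · rw [nestedElem_apply hK hN hξ hξ1, nestedEval_eq_zero hK hN hξ hξ1]
    by_contra h
    exact hv ((finite_posWeight_le N (posPart L)).mem_toFinset.2 (not_lt.1 h))
  · rw [nestedElem_apply hK hN hξ hξ1]
    exact hB m v

/-- Both sides satisfy the same recursion under `theta`, because block values and deconcatenation
are compatible with the quasi-shuffle. The rigidity of bounded families then avoids comparing
coefficients of the expansions directly. -/
theorem qmul_nestedElem (L L' : List (ℤ × ZMod N)) {m : ℕ} (hm : m ≠ 0) :
    qmul (nestedElem ξ (p ^ α) L m) (nestedElem ξ (p ^ α) L' m) =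
      ((quasiShuffle L L').map fun W => nestedElem ξ (p ^ α) W m).sum := by
  have hq : p ^ α ≠ 0 := pow_ne_zero _ (Fact.out : p.Prime).ne_zero
  induction hn : L.length + L'.length using Nat.strong_induction_on generalizing L L' m with
  | _ n ih =>
    let E := fun (W : List (ℤ × ZMod N)) (m : ℕ) => nestedElem ξ (p ^ α) W m
    let g := fun m => qmul (E L m) (E L' m) + -((quasiShuffle L L').map fun W => E W m).sum
    suffices h : g m = 0 from eq_of_sub_eq_zero ((sub_eq_add_neg _ _).trans h)
    have hE := boundedFamily_nestedElem hK hN hξ hξ1 α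
    refine BoundedFamily.eq_zero hK hN hξ (((hE L).qmul (hE L')).add
      (BoundedFamily.list_sum _ fun W _ => hE W).neg) (fun m hm => ?_) ?_ hm
    · have h1 : theta (posLetter ξ m) ((quasiShuffle L L').map fun W => E W (m + 1)).sum =
          ∑ i ∈ Finset.range (L.length + 1), ∑ j ∈ Finset.range (L'.length + 1),
            (blockVal ξ (p ^ α) m (L.take i) * blockVal ξ (p ^ α) m (L'.take j)) •
              ((quasiShuffle (L.drop i) (L'.drop j)).map fun W => E W m).sum := by
        rw [map_list_sum, List.map_map]
        simp only [E, Function.comp_def, theta_nestedElem hK hN hξ hξ1 α _ hm]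
        rw [sum_quasiShuffle_take_drop fun X Y =>
          blockVal ξ (p ^ α) m X • nestedElem ξ (p ^ α) Y m]
        refine Finset.sum_congr rfl fun i _ => Finset.sum_congr rfl fun j _ => ?_
        rw [blockVal_mul hξ.pow_eq_one hq hm, List.sum_smul, List.map_map]
        congr 1
        refine List.map_congr_left fun X _ => ?_
        rw [Function.comp_apply, List.smul_sum, List.map_map]
        rfl
      have h2 : theta (posLetter ξ m) (g (m + 1)) =
          ∑ i ∈ Finset.range (L.length + 1), ∑ j ∈ Finset.range (L'.length + 1),
            (blockVal ξ (p ^ α) m (L.take i) * blockVal ξ (p ^ α) m (L'.take j)) •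
              (qmul (E (L.drop i) m) (E (L'.drop j) m) -
                ((quasiShuffle (L.drop i) (L'.drop j)).map fun W => E W m).sum) := by
        simp only [g]
        rw [map_add, map_neg, h1, theta_qmul (posLetter_add hξ.pow_eq_one hm)]
        simp only [E, theta_nestedElem hK hN hξ hξ1 α _ hm]
        simp only [map_sum, LinearMap.sum_apply, map_smul, LinearMap.smul_apply, smul_sub,
          Finset.sum_sub_distrib, ← sub_eq_add_neg, Finset.smul_sum, smul_smul]
        rw [Finset.sum_comm]
        simp only [mul_comm]
      -- Splitting off a nonempty block lowers the total length, so the induction hypothesis leaves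
      -- only the term i = j = 0, which is g m itself.
      have h3 : ∀ i j, i ≠ 0 ∨ j ≠ 0 → i ∈ Finset.range (L.length + 1) →
          j ∈ Finset.range (L'.length + 1) → qmul (E (L.drop i) m) (E (L'.drop j) m) -
            ((quasiShuffle (L.drop i) (L'.drop j)).map fun W => E W m).sum = 0 := by
        intro i j hij hi hj
        rw [Finset.mem_range] at hi hj
        exact sub_eq_zero.2 (ih _ (by simp only [List.length_drop]; lia) _ _ hm rfl)
      change theta (posLetter ξ m) (g (m + 1)) = g m
      rw [h2, Finset.sum_eq_single_of_mem 0 (by simp), Finset.sum_eq_single_of_mem 0 (by simp)]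
      · simp [g, blockVal, sub_eq_add_neg]
      · intro j hj hj0
        rw [h3 0 j (Or.inr hj0) (by simp) hj, smul_zero]
      · intro i hi hi0
        refine Finset.sum_eq_zero fun j hj => ?_
        rw [h3 i j (Or.inl hi0) hi hj, smul_zero]
    -- At m = 1 the constant terms are the sums H_q, and the claim is their quasi-shuffle relation.
    · change (qmul (E L 1) (E L' 1) + -((quasiShuffle L L').map fun W => E W 1).sum) [] = 0
      have h := map_list_sum (Finsupp.lapply (R := K) ([] : List (ℕ+ × ZMod N)))
        ((quasiShuffle L L').map fun W => E W 1)
      rw [Finsupp.lapply_apply, List.map_map] at h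
      rw [Finsupp.add_apply, Finsupp.neg_apply, h, qmul_apply_nil]
      simp only [E, Function.comp_def, Finsupp.lapply_apply, nestedElem_one_nil hK hN hξ hξ1]
      rw [nestedSum_mul hξ.pow_eq_one, add_neg_cancel]

theorem nestedEval_nil_mul (L L' : List (ℤ × ZMod N)) {m : ℕ} (hm : m ≠ 0) :
    nestedEval ξ (p ^ α) L m [] * nestedEval ξ (p ^ α) L' m [] =
      ((quasiShuffle L L').map fun W => nestedEval ξ (p ^ α) W m []).sum := by
  have h := congrArg (Finsupp.lapply (R := K) ([] : List (ℕ+ × ZMod N)))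
    (qmul_nestedElem hK hN hξ hξ1 α L L' hm)
  rw [map_list_sum, List.map_map, Finsupp.lapply_apply, qmul_apply_nil] at h
  simpa only [Function.comp_def, Finsupp.lapply_apply, nestedElem_apply hK hN hξ hξ1] using h

omit [CompleteSpace K] in
theorem norm_residueCoeff_le (L : List (ℤ × ZMod N)) :
    ∃ B, 0 ≤ B ∧ ∀ b t, ‖residueCoeff ξ (p ^ α) L b t‖ ≤ B := by
  obtain ⟨B, hB, hle⟩ := norm_nestedCoeff_le hK hN hξ hξ1 α L
  refine ⟨B, hB, fun b t => IsUltrametricDist.norm_sum_le_of_forall_le_of_nonneg hB fun c _ => ?_⟩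
  rw [norm_mul, norm_pow, norm_pow, hξ1, one_pow, one_pow, mul_one]
  exact hle _

theorem hasSum_residueCoeff (L : List (ℤ × ZMod N)) {m b : ℕ} (h : m ≡ b [MOD N]) :
    HasSum (fun t => residueCoeff ξ (p ^ α) L b t * (m : K) ^ t) (nestedEval ξ (p ^ α) L m []) := by
  have h1 := (Equiv.prodComm ℕ (ZMod N)).hasSum_iff.2 (hasSum_nestedEval hK hN hξ hξ1 α L m []).1
  refine HasSum.congr_of_eq (h1.prod_fiberwise fun t => hasSum_fintype _) (fun t => ?_) rfl
  rw [residueCoeff, Finset.sum_mul]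
  refine Finset.sum_congr rfl fun c _ => ?_
  simp only [Function.comp_apply, Equiv.prodComm_apply, Prod.swap_prod_mk, monoEval,
    pow_val_pow_eq hξ.pow_eq_one c h]
  ring

/-- On the class of b modulo N both sides are convergent power series in m with bounded
coefficients, equal at integers tending p-adically to 0. -/
theorem residueCoeff_mul (L L' : List (ℤ × ZMod N)) (b t : ℕ) :
    ∑ k ∈ Finset.HasAntidiagonal.antidiagonal t,
        residueCoeff ξ (p ^ α) L b k.1 * residueCoeff ξ (p ^ α) L' b k.2 =
      ((quasiShuffle L L').map fun W => residueCoeff ξ (p ^ α) W b t).sum := by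
  have := nonarchimedeanRing_of_ultrametric K
  obtain ⟨M, hM0, hMb, hM⟩ := exists_tendsto_zero_of_modEq hK hN b
  obtain ⟨B, hB, hle⟩ := norm_residueCoeff_le hK hN hξ hξ1 α L
  obtain ⟨B', hB', hle'⟩ := norm_residueCoeff_le hK hN hξ hξ1 α L'
  choose C hC hleC using norm_residueCoeff_le hK hN hξ hξ1 α
  rw [← sub_eq_zero]
  have hlist : ∀ l : List (List (ℤ × ZMod N)), (∃ C, 0 ≤ C ∧
      ∀ t, ‖(l.map fun W => residueCoeff ξ (p ^ α) W b t).sum‖ ≤ C) := by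
    intro l
    induction l with
    | nil => exact ⟨0, le_rfl, by simp⟩
    | cons W l ih =>
      obtain ⟨D, hD, hle⟩ := ih
      refine ⟨C W + D, add_nonneg (hC W) hD, fun t => ?_⟩
      rw [List.map_cons, List.sum_cons]
      exact (norm_add_le _ _).trans (add_le_add (hleC W b t) (hle t))
  have hlistSum : ∀ (l : List (List (ℤ × ZMod N))) (k : ℕ), HasSum (fun t =>
      (l.map fun W => residueCoeff ξ (p ^ α) W b t).sum * (M k : K) ^ t)
      (l.map fun W => nestedEval ξ (p ^ α) W (M k) []).sum := by
    intro l k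
    induction l with
    | nil => simp [hasSum_zero]
    | cons W l ih =>
      simp only [List.map_cons, List.sum_cons, add_mul]
      exact (hasSum_residueCoeff hK hN hξ hξ1 α W (hMb k)).add ih
  obtain ⟨D, hD, hleD⟩ := hlist (quasiShuffle L L')
  refine eq_zero_of_hasSum_zero (f := fun t => ∑ k ∈ Finset.HasAntidiagonal.antidiagonal t,
        residueCoeff ξ (p ^ α) L b k.1 * residueCoeff ξ (p ^ α) L' b k.2 -
      ((quasiShuffle L L').map fun W => residueCoeff ξ (p ^ α) W b t).sum) (B := B * B' + D)
    (fun t => ?_) (fun k => Nat.cast_ne_zero.2 (hM0 k)) hM (fun k => ?_) t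
  · refine (norm_sub_le _ _).trans (add_le_add ?_ (hleD t))
    refine IsUltrametricDist.norm_sum_le_of_forall_le_of_nonneg (by positivity) fun k _ => ?_
    rw [norm_mul]
    exact mul_le_mul (hle b _) (hle' b _) (norm_nonneg _) hB
  · have h1 := hasSum_residueCoeff hK hN hξ hξ1 α L (hMb k)
    have h2 := hasSum_residueCoeff hK hN hξ hξ1 α L' (hMb k)
    have h3 := h1.summable.mul_of_nonarchimedean h2.summable
    have h4 := (summable_sum_mul_antidiagonal_of_summable_mul
      (f := fun t => residueCoeff ξ (p ^ α) L b t * (M k : K) ^ t)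
      (g := fun t => residueCoeff ξ (p ^ α) L' b t * (M k : K) ^ t) h3).hasSum
    rw [← h1.summable.tsum_mul_tsum_eq_tsum_sum_antidiagonal h2.summable h3, h1.tsum_eq,
      h2.tsum_eq, nestedEval_nil_mul hK hN hξ hξ1 α L L' (hM0 k)] at h4
    refine HasSum.congr_of_eq (h4.sub (hlistSum (quasiShuffle L L') k)) (fun t => ?_)
      (sub_self _).symm
    rw [sub_mul, Finset.sum_mul]
    congr 1
    refine Finset.sum_congr rfl fun x hx => ?_
    rw [← Finset.HasAntidiagonal.mem_antidiagonal.1 hx, pow_add]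
    ring

/-- The previous identity holds for every class b; as a function of b it is a relation between the
characters ξ^{cb}, whose independence isolates each c. -/
theorem nestedCoeff_nil_mul (L L' : List (ℤ × ZMod N)) (c : ZMod N) (t : ℕ) :
    ∑ c₁, ∑ k ∈ Finset.HasAntidiagonal.antidiagonal t, nestedCoeff ξ (p ^ α) L (c₁, k.1, []) *
        nestedCoeff ξ (p ^ α) L' (c - c₁, k.2, []) =
      ((quasiShuffle L L').map fun W => nestedCoeff ξ (p ^ α) W (c, t, [])).sum := by
  rw [← sub_eq_zero]
  refine eq_zero_of_sum_mul_pow_eq_zero hξ (κ := fun c => ∑ c₁, ∑ k ∈ Finset.HasAntidiagonal.antidiagonal t,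
    nestedCoeff ξ (p ^ α) L (c₁, k.1, []) * nestedCoeff ξ (p ^ α) L' (c - c₁, k.2, []) -
      ((quasiShuffle L L').map fun W => nestedCoeff ξ (p ^ α) W (c, t, [])).sum) (fun b => ?_) c
  have h1 : ∀ l : List (List (ℤ × ZMod N)),
      ∑ c, (l.map fun W => nestedCoeff ξ (p ^ α) W (c, t, [])).sum * (ξ ^ c.val) ^ b =
        (l.map fun W => residueCoeff ξ (p ^ α) W b t).sum := by
    intro l
    induction l with
    | nil => simp
    | cons W l ih =>
      simp only [List.map_cons, List.sum_cons, add_mul, Finset.sum_add_distrib, ih]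
      rfl
  simp only [sub_mul, Finset.sum_sub_distrib]
  rw [h1, ← residueCoeff_mul hK hN hξ hξ1, sub_eq_zero]
  simp only [Finset.sum_mul]
  rw [Finset.sum_comm]
  have h2 : ∀ c₁ : ZMod N, ∑ c, ∑ k ∈ Finset.HasAntidiagonal.antidiagonal t,
      nestedCoeff ξ (p ^ α) L (c₁, k.1, []) * nestedCoeff ξ (p ^ α) L' (c - c₁, k.2, []) *
        (ξ ^ c.val) ^ b =
      ∑ c, ∑ k ∈ Finset.HasAntidiagonal.antidiagonal t, nestedCoeff ξ (p ^ α) L (c₁, k.1, []) *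
        (ξ ^ c₁.val) ^ b * (nestedCoeff ξ (p ^ α) L' (c, k.2, []) * (ξ ^ c.val) ^ b) := by
    intro c₁
    rw [← Equiv.sum_comp (Equiv.addRight c₁)]
    refine Finset.sum_congr rfl fun c _ => Finset.sum_congr rfl fun k _ => ?_
    rw [Equiv.coe_addRight, add_sub_cancel_right, pow_val_add hξ.pow_eq_one, mul_pow]
    ring
  simp only [h2, residueCoeff, Finset.sum_mul_sum]
  rw [Finset.sum_comm (s := Finset.HasAntidiagonal.antidiagonal t)]
  exact Finset.sum_congr rfl fun c₁ _ => Finset.sum_comm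

theorem aeval_locAdMZV_adjointRel (w w' : HarWord ℤ N) (j : ZMod N) (l : ℤ) :
    MvPolynomial.aeval (locAdMZV ξ p α) (adjointRel id w w' j l) = 0 := by
  set q := p ^ α with hq
  have hq0 : (q : K) ≠ 0 := by
    exact_mod_cast pow_ne_zero α (Fact.out : p.Prime).ne_zero
  set W := w.weight id with hW
  set W' := w'.weight id with hW'
  have hstar : ((w.star w').map fun v => locAdMZV ξ p α (j, l, v)).sum =
      if W + W' ≤ l then (q : K) ^ (W + W') * ((quasiShuffle w.chars w'.chars).map fun V =>
        nestedCoeff ξ q V (j + q • (w.top + w'.top), (l - (W + W')).toNat, [])).sum else 0 := by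
    have h : ∀ v ∈ w.star w', locAdMZV ξ p α (j, l, v) = if W + W' ≤ l then (q : K) ^ (W + W') *
        nestedCoeff ξ q v.chars (j + q • (w.top + w'.top), (l - (W + W')).toNat, []) else 0 := by
      intro v hv
      rw [locAdMZV, harCoeff_eq, HarWord.weight_of_mem_star (fun _ _ => rfl) hv,
        (HarWord.top_chars_of_mem_star hv).1]
    rw [List.map_congr_left h]
    split_ifs with hl
    · rw [← HarWord.map_chars_star, List.map_map, ← List.sum_map_mul_left]
      rfl
    · simp
  rw [adjointRel, map_sub, map_list_sum, List.map_map, sub_eq_zero]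
  simp only [map_sum, map_mul, Function.comp_def, MvPolynomial.aeval_X]
  rw [hstar]
  split_ifs with hl
  -- Removing the shift q·top from the characters and the weights from the powers of m turns the
  -- double sum into the convolution over c and t.
  · rw [← nestedCoeff_nil_mul hK hN hξ hξ1, ← Equiv.sum_comp (Equiv.subRight (q • w.top)), Finset.mul_sum]
    refine Finset.sum_congr rfl fun i _ => ?_
    rw [Finset.mul_sum]
    refine Finset.sum_bij' (fun k _ => ((k - W).toNat, (l - k - W').toNat))
      (fun k _ => (k.1 : ℤ) + W) ?_ ?_ ?_ ?_ ?_
    · intro k hk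
      rw [Finset.mem_Icc] at hk
      rw [Finset.HasAntidiagonal.mem_antidiagonal]
      lia
    · intro k hk
      rw [Finset.HasAntidiagonal.mem_antidiagonal] at hk
      rw [Finset.mem_Icc]
      lia
    · intro k hk
      rw [Finset.mem_Icc] at hk
      lia
    · intro k hk
      rw [Finset.HasAntidiagonal.mem_antidiagonal] at hk
      ext <;> lia
    · intro k hk
      rw [Finset.mem_Icc] at hk
      simp only [locAdMZV, harCoeff_eq]
      rw [if_pos hk.1, if_pos (by change W' ≤ l - k; lia), zpow_add₀ hq0, Equiv.subRight_apply]
      have h : j - (i - q • w.top) + q • w'.top = j + q • (w.top + w'.top) - i := by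
        rw [smul_add]
        abel
      rw [sub_add_cancel, h]
      ring
  · rw [Finset.Icc_eq_empty (by lia)]
    simp

end Relations

end LocHar

end

/-! ### Assembly of the statements. -/

theorem mainTheorem5 (N : ℕ) [NeZero N] :
    -- the localized quasi-shuffle product and the localized multiple harmonic sums
    (∀ (K : Type*) [Field K] [CharZero K] (ξ : K), IsPrimitiveRoot ξ N →
      ∀ (m : ℕ) (w w' : HarWord ℤ N),
        mhs ξ m w * mhs ξ m w' = mhsLin N ξ m (locStar N w.toAlg w'.toAlg)) ∧
    -- it extends the quasi-shuffle product of ordinary words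
    (∀ w w' : HarWord ℕ+ N,
      locStar N w.toLoc.toAlg w'.toLoc.toAlg =
        ((w.star w').map fun v => v.toLoc.toAlg).sum) ∧
    -- the family of relations generalizes the adjoint quasi-shuffle relations
    (∀ (w w' : HarWord ℕ+ N) (j : ZMod N) (l : ℤ),
      MvPolynomial.rename (fun x => (x.1, x.2.1, x.2.2.toLoc))
          (adjointRel (fun n : ℕ+ => (n : ℤ)) w w' j l) =
        adjointRel id w.toLoc w'.toLoc j l) ∧
    (∀ (p : ℕ) [Fact p.Prime], p.Coprime N →
      ∀ (K : Type*) [NormedField K] [NormedAlgebra ℚ_[p] K] [CompleteSpace K] [CharZero K]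
        (ξ : K), IsPrimitiveRoot ξ N → ∀ α : ℕ, 1 ≤ α →
        -- the series defining the coefficients converge, and give the expression of `har_{p^α m}`
        (∀ w : HarWord ℤ N,
          (∀ x, Summable (harCoeffTerm ξ (p ^ α) w x)) ∧
          ∀ m : ℕ, 1 ≤ m →
            HasSum (fun x : ZMod N × ℤ × List (ℕ+ × ZMod N) =>
              harCoeff ξ (p ^ α) w x *
                ((ξ ^ x.1.val) ^ m * (m : K) ^ x.2.1 * nestedSumPos ξ x.2.2 m))
              (har ξ (p ^ α * m) w)) ∧
        -- the localized adjoint quasi-shuffle relations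
        (∀ (w w' : HarWord ℤ N) (j : ZMod N) (l : ℤ),
          MvPolynomial.aeval (locAdMZV ξ p α) (adjointRel id w w' j l) = 0)) := by
  refine ⟨fun K _ _ ξ hξ m w w' => mhs_mul hξ.pow_eq_one m w w', locStar_toLoc,
    rename_adjointRel, fun p _ hN K _ _ _ _ ξ hξ α _ => ?_⟩
  -- The analytic part uses the `ℚ_[p]`-algebra structure only through this identification of the
  -- norm on ℚ, which also makes K ultrametric.
  have hK := norm_ratCast_eq_padicNorm (p := p) (K := K)
  have := isUltrametricDist_of_padicNorm hK
  have hξ1 : ‖ξ‖ = 1 := by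
    refine (pow_eq_one_iff_of_nonneg (norm_nonneg ξ) (NeZero.ne N)).1 ?_
    rw [← norm_pow, hξ.pow_eq_one, norm_one]
  exact ⟨fun w => ⟨summable_harCoeffTerm hK hN hξ hξ1 α w,
    fun m hm => hasSum_harCoeff hK hN hξ hξ1 α w (Nat.one_le_iff_ne_zero.1 hm)⟩,
    aeval_locAdMZV_adjointRel hK hN hξ hξ1 α⟩
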